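/- Let $N\ge 3$, $2^*=2N/(N-2)$, $a,b>0$ and $\eta\in(0,1)$. Let $V_1,V_2\in C(\mathbb R^N,\mathbb R)$ be $1$-periodic in each of $x_1,\dots,x_N$, with $$|V_2(x)|\le \frac{2\eta ab}{a^2+b^2}V_1(x)\quad(x\in\mathbb R^N),\qquad 0<\inf_{\mathbb R^N}V_1\le\sup_{\mathbb R^N}V_1<\infty .$$ Let $\mathcal{ND}$ be the set of continuous $h:\mathbb R^N\times[0,\infty)\to[0,\infty)$ such that $h(x,t)$ is $1$-periodic in each of $x_1,\dots,x_N$, nondecreasing in $t\ge 0$ for every $x$, $h(x,0)=0$ for all $x$, and there are $p\in(2,2^*)$ and $C>0$ with $|h(x,t)|\le C(1+t^{p-2})$ for all $x\in\mathbb R^N$, $t\ge 0$. Let $$W(x,u,v)=\sum_{i=1}^k\int_0^{|\alpha_iu+\beta_iv|}g_i(x,s)\,s\,ds+\sum_{j=1}^l\int_0^{\sqrt{u^2+2\beta_j'uv+\alpha_j'v^2}}h_j(x,s)\,s\,ds,$$ where $g_i,h_j\in\mathcal{ND}$, $\alpha_i,\beta_i,\alpha_j',\beta_j'\in\mathbb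 R$, $\alpha_i^2+\beta_i^2\neq0$ and $\alpha_j'>\beta_j'^2$ (either sum may be empty), and assume that for a.e. $x\in\mathbb R^N$ $$\lim_{|au+bv|\to\infty}\frac{|W(x,u,v)|}{|au+bv|^2}=\infty .$$ Let $E=H^1(\mathbb R^N)\times H^1(\mathbb R^N)$, $E^-=\{(-u/a,u/b):u\in H^1(\mathbb R^N)\}$, and for $z=(u,v)\in E$ let $$\Phi(z)=\int_{\mathbb R^N}\Big[\nabla u\cdot\nabla v+V_1(x)uv+\tfrac12V_2(x)|z|^2\Big]dx-\int_{\mathbb R^N}W(x,z)\,dx,$$ $$\mathcal N^-=\{z\in E\setminus E^-:\ \langle\Phi'(z),z\rangle=0\ \text{and}\ \langle\Phi'(z),\zeta\rangle=0\ \text{for all}\ \zeta\in E^-\},$$ where $\Phi'(z)$ is the Fréchet derivative of $\Phi$ at $z$. Then there is $z^*=(u,v)\in\mathcal N^-$ which is a weak solution of $$-\Delta u+V_1(x)u+V_2(x)v=W_v(x,u,v),\qquad -\Delta v+V_1(x)v+V_2(x)u=W_u(x,u,v)\quad\text{in }\mathbb R^N,\qquad u,v\in H^1(\mathbb R^N),$$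 and which satisfies $\Phi(z^*)=\inf_{\mathcal N^-}\Phi>0$. -/

import Mathlib

open MeasureTheory Filter Topology
open scoped ContDiff

noncomputable section

namespace HamSys

/-- The Euclidean space `ℝ^N`. -/
abbrev Rn (N : ℕ) : Type := EuclideanSpace ℝ (Fin N)

/-- The `i`-th standard unit vector of `ℝ^N`. -/
abbrev unitVec {N : ℕ} (i : Fin N) : Rn N := EuclideanSpace.single i (1 : ℝ)

/-- `φ ∈ C_c^∞(ℝ^N)`. -/
structure IsTest {N : ℕ} (φ : Rn N → ℝ) : Prop where
  smooth : ContDiff ℝ ∞ φ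
  compact : HasCompactSupport φ

/-- `∂_i φ` for a smooth function `φ`. -/
def partialD {N : ℕ} (i : Fin N) (φ : Rn N → ℝ) (x : Rn N) : ℝ := fderiv ℝ φ x (unitVec i)

theorem IsTest.memLp {N : ℕ} {φ : Rn N → ℝ} (h : IsTest φ) :
    MemLp φ 2 (volume : Measure (Rn N)) :=
  h.smooth.continuous.memLp_of_hasCompactSupport h.compact

theorem IsTest.memLp_partialD {N : ℕ} {φ : Rn N → ℝ} (h : IsTest φ) (i : Fin N) :
    MemLp (partialD i φ) 2 (volume : Measure (Rn N)) := by
  refine Continuous.memLp_of_hasCompactSupport ?_ ?_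
  · exact (h.smooth.continuous_fderiv (by simp)).clm_apply continuous_const
  · exact h.compact.fderiv_apply ℝ (unitVec i)

theorem memLp_coord {N : ℕ} (G : Lp (Rn N) 2 (volume : Measure (Rn N))) (i : Fin N) :
    MemLp (fun x => G x i) 2 (volume : Measure (Rn N)) :=
  (EuclideanSpace.proj (𝕜 := ℝ) i : Rn N →L[ℝ] ℝ).comp_memLp' (Lp.memLp G)

/-- `G ∈ L²(ℝ^N; ℝ^N)` is the weak gradient of `u ∈ L²(ℝ^N)`. -/
def IsWeakGrad {N : ℕ} (u : Lp ℝ 2 (volume : Measure (Rn N)))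
    (G : Lp (Rn N) 2 (volume : Measure (Rn N))) : Prop :=
  ∀ φ : Rn N → ℝ, IsTest φ → ∀ i : Fin N,
    ∫ x, u x * partialD i φ x = -∫ x, G x i * φ x

/-- The Sobolev space `H¹(ℝ^N)`: the `L²` functions with a weak gradient in `L²`. An element is
stored together with its (unique) weak gradient, so that the norm inherited from the `ℓ²` product
is the usual one, `‖u‖² = ∫ u² + |∇u|²`. -/
def H1 (N : ℕ) : Submodule ℝ
    (WithLp 2 (Lp ℝ 2 (volume : Measure (Rn N)) × Lp (Rn N) 2 (volume : Measure (Rn N)))) where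
  carrier := {p | IsWeakGrad p.fst p.snd}
  zero_mem' := by
    intro φ _ i
    have h1 : ∫ x, (0 : Lp ℝ 2 (volume : Measure (Rn N))) x * partialD i φ x = 0 := by
      simp
    have h2 : ∫ x, (0 : Lp (Rn N) 2 (volume : Measure (Rn N))) x i * φ x = 0 := by
      simp
    simp only [WithLp.zero_fst, WithLp.zero_snd]
    rw [h1, h2, neg_zero]
  add_mem' := by
    intro p q hp hq φ hφ i
    have h1 : ∫ x, (p.fst + q.fst) x * partialD i φ x
        = (∫ x, p.fst x * partialD i φ x) + ∫ x, q.fst x * partialD i φ x := by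
      refine Eq.trans (integral_congr_ae ?_)
        (integral_add ((Lp.memLp p.fst).integrable_mul (hφ.memLp_partialD i))
          ((Lp.memLp q.fst).integrable_mul (hφ.memLp_partialD i)))
      filter_upwards [Lp.coeFn_add p.fst q.fst] with x hx
      rw [hx]
      exact add_mul _ _ _
    have h2 : ∫ x, (p.snd + q.snd) x i * φ x
        = (∫ x, p.snd x i * φ x) + ∫ x, q.snd x i * φ x := by
      refine Eq.trans (integral_congr_ae ?_)
        (integral_add ((memLp_coord p.snd i).integrable_mul hφ.memLp)
          ((memLp_coord q.snd i).integrable_mul hφ.memLp))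
      filter_upwards [Lp.coeFn_add p.snd q.snd] with x hx
      rw [hx]
      exact add_mul _ _ _
    simp only [WithLp.add_fst, WithLp.add_snd]
    rw [h1, h2, hp φ hφ i, hq φ hφ i, neg_add]
  smul_mem' := by
    intro c p hp φ hφ i
    have h1 : ∫ x, (c • p.fst) x * partialD i φ x = c * ∫ x, p.fst x * partialD i φ x := by
      rw [← integral_const_mul]
      refine integral_congr_ae ?_
      filter_upwards [Lp.coeFn_smul c p.fst] with x hx
      simp [hx, mul_assoc]
    have h2 : ∫ x, (c • p.snd) x i * φ x = c * ∫ x, p.snd x i * φ x := by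
      rw [← integral_const_mul]
      refine integral_congr_ae ?_
      filter_upwards [Lp.coeFn_smul c p.snd] with x hx
      simp [hx, mul_assoc]
    simp only [WithLp.smul_fst, WithLp.smul_snd]
    rw [h1, h2, hp φ hφ i, mul_neg]

/-- The (a.e. defined) function underlying an element of `H¹(ℝ^N)`. -/
def val {N : ℕ} (u : H1 N) (x : Rn N) : ℝ := u.1.fst x

/-- The weak gradient of an element of `H¹(ℝ^N)`. -/
def grad {N : ℕ} (u : H1 N) (x : Rn N) : Rn N := u.1.snd x

/-- `E = H¹(ℝ^N) × H¹(ℝ^N)`, with the `ℓ²` product of the `H¹` norms. -/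
abbrev ESpace (N : ℕ) : Type := WithLp 2 (H1 N × H1 N)

/-- `E⁻ = {(-u/a, u/b) : u ∈ H¹(ℝ^N)}`. -/
def EMinus (N : ℕ) (a b : ℝ) : Set (ESpace N) :=
  {z | ∃ u : H1 N, z.fst = -(a⁻¹ • u) ∧ z.snd = b⁻¹ • u}

/-- `f` is `1`-periodic in each of `x_1, …, x_N`. -/
def Periodic1 {N : ℕ} {α : Type*} (f : Rn N → α) : Prop :=
  ∀ (i : Fin N) (x : Rn N), f (x + unitVec i) = f x

/-- The potentials are continuous, `|V₂| ≤ (2ηab/(a²+b²)) V₁` and `0 < inf V₁ ≤ sup V₁ < ∞`. -/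
structure CondV0 {N : ℕ} (a b η : ℝ) (V₁ V₂ : Rn N → ℝ) : Prop where
  cont₁ : Continuous V₁
  cont₂ : Continuous V₂
  bound : ∀ x, |V₂ x| ≤ 2 * η * a * b / (a ^ 2 + b ^ 2) * V₁ x
  inf_pos : ∃ m : ℝ, 0 < m ∧ ∀ x, m ≤ V₁ x
  sup_lt : ∃ M : ℝ, ∀ x, V₁ x ≤ M

/-- `|W(x,u,v)| / |au+bv|² → ∞` as `|au+bv| → ∞`, for a.e. `x`. -/
def CondW2 {N : ℕ} (a b : ℝ) (W : Rn N → ℝ → ℝ → ℝ) : Prop :=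
  ∀ᵐ x : Rn N, Tendsto (fun z : ℝ × ℝ => |W x z.1 z.2| / |a * z.1 + b * z.2| ^ 2)
    (comap (fun z : ℝ × ℝ => |a * z.1 + b * z.2|) atTop) atTop

/-- The class `ND` of functions `h : ℝ^N × [0,∞) → [0,∞)`; only the values `h x t` with `0 ≤ t`
matter. Here `2* = 2N/(N-2)`. -/
structure ClassND {N : ℕ} (h : Rn N → ℝ → ℝ) : Prop where
  cont : ContinuousOn (fun q : Rn N × ℝ => h q.1 q.2) (Set.univ ×ˢ Set.Ici 0)
  nonneg : ∀ x t, 0 ≤ t → 0 ≤ h x t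
  periodic : ∀ t, 0 ≤ t → Periodic1 (fun x => h x t)
  mono : ∀ x, MonotoneOn (h x) (Set.Ici 0)
  zero : ∀ x, h x 0 = 0
  growth : ∃ p C : ℝ, 2 < p ∧ p < 2 * (N : ℝ) / ((N : ℝ) - 2) ∧ 0 < C ∧
    ∀ x t, 0 ≤ t → |h x t| ≤ C * (1 + t ^ (p - 2))

/-- `W_u(x,u,v)`. -/
def Wu {N : ℕ} (W : Rn N → ℝ → ℝ → ℝ) (x : Rn N) (u v : ℝ) : ℝ := deriv (fun s => W x s v) u

/-- `W_v(x,u,v)`. -/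
def Wv {N : ℕ} (W : Rn N → ℝ → ℝ → ℝ) (x : Rn N) (u v : ℝ) : ℝ := deriv (fun s => W x u s) v

/-- The energy functional
`Φ(z) = ∫ [∇u·∇v + V₁ u v + ½ V₂ |z|²] dx - ∫ W(x,z) dx`, `z = (u,v) ∈ E`. -/
def Phi {N : ℕ} (V₁ V₂ : Rn N → ℝ) (W : Rn N → ℝ → ℝ → ℝ) (z : ESpace N) : ℝ :=
  (∫ x, (inner ℝ (grad z.fst x) (grad z.snd x) + V₁ x * (val z.fst x * val z.snd x)
      + 1 / 2 * V₂ x * (val z.fst x ^ 2 + val z.snd x ^ 2)))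
    - ∫ x, W x (val z.fst x) (val z.snd x)

/-- The Nehari–Pankov set
`𝒩⁻ = {z ∈ E ∖ E⁻ : ⟨Φ'(z), z⟩ = 0 and ⟨Φ'(z), ζ⟩ = 0 for all ζ ∈ E⁻}`,
where `Φ'(z)` is the Fréchet derivative of `Φ` at `z`. -/
def NMinus {N : ℕ} (a b : ℝ) (V₁ V₂ : Rn N → ℝ) (W : Rn N → ℝ → ℝ → ℝ) : Set (ESpace N) :=
  {z | z ∉ EMinus N a b ∧ ∃ D : ESpace N →L[ℝ] ℝ, HasFDerivAt (Phi V₁ V₂ W) D z ∧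
    D z = 0 ∧ ∀ ζ ∈ EMinus N a b, D ζ = 0}

/-- `z = (u,v)`, `u, v ∈ H¹(ℝ^N)`, is a weak solution of
`-Δu + V₁ u + V₂ v = W_v(x,u,v)`, `-Δv + V₁ v + V₂ u = W_u(x,u,v)` in `ℝ^N`. -/
structure IsSolution {N : ℕ} (V₁ V₂ : Rn N → ℝ) (W : Rn N → ℝ → ℝ → ℝ) (z : ESpace N) :
    Prop where
  locInt_v : LocallyIntegrable (fun x => Wv W x (val z.fst x) (val z.snd x)) volume
  locInt_u : LocallyIntegrable (fun x => Wu W x (val z.fst x) (val z.snd x)) volume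
  eq₁ : ∀ φ : Rn N → ℝ, IsTest φ →
    ∫ x, ((∑ i, grad z.fst x i * partialD i φ x)
        + (V₁ x * val z.fst x + V₂ x * val z.snd x) * φ x)
      = ∫ x, Wv W x (val z.fst x) (val z.snd x) * φ x
  eq₂ : ∀ φ : Rn N → ℝ, IsTest φ →
    ∫ x, ((∑ i, grad z.snd x i * partialD i φ x)
        + (V₁ x * val z.snd x + V₂ x * val z.fst x) * φ x)
      = ∫ x, Wu W x (val z.fst x) (val z.snd x) * φ x

end HamSys

end

/-! ### Sobolev's inequality for compactly supported functions, by mollification. -/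

open MeasureTheory Filter Topology
open scoped ContDiff

noncomputable section

namespace HamSys

open scoped Convolution ENNReal NNReal

/-! Write `Φ = ½ B(z,z) - Ψ(z)` with `Ψ(z) = ∫ W(x,z)`. The space splits as `E = E⁺ ⊕ E⁻`, where `E⁺
= {(u/a, u/b)}`; the bound on `V₂` with `η < 1` makes `B` positive definite on `E⁺` and negative
definite on `E⁻`. Both copies are parametrized by `H¹`.

Everything about the nonlinearity flows from one pointwise inequality, for all `z, z'` and all real
`t`: `W(z') - W(z) + (1+t²)/2 ∇W(z)·z - t ∇W(z)·z' ≥ 0`. For one term of `W`, monotonicity of `g`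
bounds the left side below by `½ g(ρ)|Lz' - tLz|²`, where `ρ = |Lz|` and `L` is linear. The choice
`t = 1` is convexity, `t = 0`, `z' = 0` is `W ≤ ½ ∇W·z`, and `z' = sz`, `t = s` gives growth at
least quadratic along rays. The inequality survives integration, so the variational argument is
carried out in an abstract structure `Saddle` that retains only this inequality, uniform continuity
of `Ψ'` on bounded sets and `⟨Ψ'(z),z⟩ = o(‖z‖²)`.

Since `Ψ` is convex, `Φ` is strongly concave on each slice `p + E⁻`, so it has a unique maximizer
there, depending continuously on `p`. This defines a reduced functional `J` on `H¹`; points of the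
Nehari–Pankov set are the maximizers over those `p ≠ 0` with `θ(p) = ⟨Φ'(z_p), z_p⟩ = 0`. The
inequality `J_smul_le` shows that such a `p` maximizes `J` on its whole ray. Monotonicity is not
strict, so the maximizer on a ray need not be unique and the Nehari set need not be a manifold; the
proof works with rays instead.

Let `c₀ > 0` be the infimum of `J` over the Nehari set. A minimizing sequence gives unit directions
`eₙ` with `J ≤ c₀ + 1/(n+1)` on the whole ray. They cannot vanish in Lions' sense, for then `J(s
eₙ)` would be at least `½ c s² - o(1)` for each `s`. After lattice translations, which preserve `J`,
and a subsequence, `eₙ` converges weakly to some `e₀ ≠ 0`. Superquadratic growth then provides a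
single `T` with `J(T eₙ) ≤ -1` for infinitely many `n` (`exists_J_le_neg_one`). If the segment
`[0,T] eₙ` had no almost critical point near level `c₀`, one gradient step would push the segment to
a path that meets no Nehari point of energy at least `c₀`, although every such path must meet one
(`exists_almost_critical`, `exists_θ_eq_zero`).

So there are `tₙ ∈ [0,T]` with `J(tₙ eₙ) → c₀` and `J'(tₙ eₙ) → 0`. The bound by `T` replaces any a
priori boundedness of Palais–Smale sequences. The corresponding points of `E` have a weak limit `z`;
weak continuity of `Ψ'` (from Rellich's theorem) makes `z` critical, the limit of `tₙ` is nonzero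
because `J(p) ≤ A‖p‖²`, and Fatou's lemma for `½⟨Ψ'(z),z⟩ - Ψ(z) ≥ 0` gives `Φ(z) ≤ c₀`. The Sobolev
embedding, Rellich's theorem and Lions' lemma are proved along the way for the concrete space `H1`.
-/

/-- `G` is a weak gradient of the function `u`. -/
def IsWeakGradFun {N : ℕ} (u : Rn N → ℝ) (G : Rn N → Rn N) : Prop :=
  ∀ φ : Rn N → ℝ, IsTest φ → ∀ i : Fin N,
    ∫ x, u x * partialD i φ x = -∫ x, G x i * φ x

theorem IsTest.comp_sub_left {N : ℕ} {φ : Rn N → ℝ} (h : IsTest φ) (x : Rn N) :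
    IsTest (fun t => φ (x - t)) where
  smooth := h.smooth.comp (contDiff_const.sub contDiff_id)
  compact := by
    have := h.compact.comp_homeomorph (Homeomorph.subLeft x)
    exact this

theorem partialD_comp_sub_left {N : ℕ} {φ : Rn N → ℝ} (h : IsTest φ) (x : Rn N) (i : Fin N)
    (t : Rn N) : partialD i (fun t => φ (x - t)) t = - partialD i φ (x - t) := by
  have h1 : HasFDerivAt φ (fderiv ℝ φ (x - t)) (x - t) :=
    ((h.smooth.differentiable (by simp)) _).hasFDerivAt
  have h2 : HasFDerivAt (fun t : Rn N => x - t) (-(ContinuousLinearMap.id ℝ (Rn N))) t := by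
    simpa using (hasFDerivAt_id (𝕜 := ℝ) t).const_sub x
  have := (h1.comp t h2).fderiv
  unfold partialD
  change fderiv ℝ (φ ∘ fun t => x - t) t _ = _
  rw [this]; simp

theorem IsTest.comp_add_right {N : ℕ} {φ : Rn N → ℝ} (h : IsTest φ) (y : Rn N) :
    IsTest (fun t => φ (t + y)) where
  smooth := h.smooth.comp (contDiff_id.add contDiff_const)
  compact := h.compact.comp_homeomorph (Homeomorph.addRight y)

theorem partialD_comp_add_right {N : ℕ} {φ : Rn N → ℝ} (y : Rn N) (i : Fin N)
    (t : Rn N) : partialD i (fun t => φ (t + y)) t = partialD i φ (t + y) := by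
  unfold partialD
  rw [fderiv_comp_add_right]

theorem IsTest.isTest_partialD {N : ℕ} {φ : Rn N → ℝ} (h : IsTest φ) (i : Fin N) :
    IsTest (partialD i φ) where
  smooth := (h.smooth.fderiv_right (m := ∞) (by simp)).clm_apply contDiff_const
  compact := h.compact.fderiv_apply ℝ (unitVec i)

theorem IsTest.mul {N : ℕ} {φ χ : Rn N → ℝ} (h : IsTest φ) (h' : IsTest χ) :
    IsTest (fun x => φ x * χ x) where
  smooth := h.smooth.mul h'.smooth
  compact := h.compact.mul_right

theorem partialD_mul {N : ℕ} {φ χ : Rn N → ℝ} (h : IsTest φ) (h' : IsTest χ) (i : Fin N)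
    (x : Rn N) : partialD i (fun x => φ x * χ x) x = φ x * partialD i χ x + partialD i φ x * χ x := by
  unfold partialD
  rw [fderiv_fun_mul ((h.smooth.differentiable (by simp)) x) ((h'.smooth.differentiable (by simp)) x)]
  simp; ring

/-- A smooth normalized bump is a test function. -/
theorem isTest_normed {N : ℕ} (ρ : ContDiffBump (0 : Rn N)) :
    IsTest (ρ.normed (volume : Measure (Rn N))) :=
  ⟨ρ.contDiff_normed, ρ.hasCompactSupport_normed⟩

/-- Mollification of a function with a weak gradient: derivative of the mollification. -/
theorem fderiv_convolution_unitVec {N : ℕ} {k v : Rn N → ℝ} {G : Rn N → Rn N} (hk : IsTest k)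
    (hv : LocallyIntegrable v volume) (hG : IsWeakGradFun v G) (x : Rn N) (i : Fin N) :
    fderiv ℝ (k ⋆[ContinuousLinearMap.lsmul ℝ ℝ, volume] v) x (unitVec i)
      = ∫ t, k (x - t) * G t i := by
  have h1 := hk.compact.hasFDerivAt_convolution_left (ContinuousLinearMap.lsmul ℝ ℝ)
    (hk.smooth.of_le (by simp)) hv x
  rw [h1.fderiv]
  have hex : ConvolutionExistsAt (fderiv ℝ k) v x
      ((ContinuousLinearMap.lsmul ℝ ℝ).precompL (Rn N)) volume :=
    (hk.compact.fderiv ℝ).convolutionExists_left _ (hk.smooth.continuous_fderiv (by simp)) hv x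
  unfold convolution
  rw [ContinuousLinearMap.integral_apply hex]
  have : ∀ t, ((((ContinuousLinearMap.lsmul ℝ ℝ).precompL (Rn N)) (fderiv ℝ k t)) (v (x - t)))
      (unitVec i) = partialD i k t * v (x - t) := by
    intro t; simp [partialD]
  simp_rw [this]
  rw [← integral_sub_left_eq_self (fun t => partialD i k t * v (x - t)) volume x]
  have h2 := hG _ (hk.comp_sub_left x) i
  simp_rw [partialD_comp_sub_left hk] at h2
  simp only [sub_sub_cancel]
  calc ∫ t, partialD i k (x - t) * v t = - ∫ t, v t * - partialD i k (x - t) := by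
        rw [← integral_neg]; congr 1; ext t; ring
    _ = _ := by rw [h2, neg_neg]; congr 1; ext t; ring

/-- The coordinate identities assemble to `T w = ∫ k ⟨G, w⟩`, so Cauchy–Schwarz is applied to the
whole vector. A coordinatewise estimate would lose a dimensional factor, and the constant one is
used below. -/
theorem norm_le_of_coord {N : ℕ} (T : Rn N →L[ℝ] ℝ) (k : Rn N → ℝ) (hk : ∀ x, 0 ≤ k x)
    (G : Rn N → Rn N)
    (hintg : ∀ i, Integrable (fun t => k t * G t i))
    (hT : ∀ i, T (unitVec i) = ∫ t, k t * G t i) :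
    ‖T‖ₑ ≤ ∫⁻ t, ENNReal.ofReal (k t) * ‖G t‖ₑ := by
  by_cases htop : ∫⁻ t, ENNReal.ofReal (k t) * ‖G t‖ₑ = ⊤
  · rw [htop]; exact le_top
  have key : ∀ w : Rn N, ‖T w‖ ≤ (∫⁻ t, ENNReal.ofReal (k t) * ‖G t‖ₑ).toReal * ‖w‖ := by
    intro w
    have hw : T w = ∫ t, k t * inner ℝ (G t) w := by
      have : w = ∑ i, w i • unitVec i := by
        ext j; simp [Finset.sum_apply, Pi.single_apply]
      conv_lhs => rw [this]
      rw [map_sum]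
      simp_rw [map_smul, hT]
      simp_rw [smul_eq_mul, ← integral_const_mul]
      rw [← integral_finsetSum _ (fun i _ => (hintg i).const_mul _)]
      congr 1; ext t
      simp only [PiLp.inner_apply, Finset.mul_sum]
      refine Finset.sum_congr rfl fun i _ => ?_
      simp; ring
    have h3 : ‖T w‖ₑ ≤ (∫⁻ t, ENNReal.ofReal (k t) * ‖G t‖ₑ) * ‖w‖ₑ := by
      rw [hw]
      refine (enorm_integral_le_lintegral_enorm _).trans ?_
      rw [← lintegral_mul_const' _ _ enorm_ne_top]
      refine lintegral_mono fun t => ?_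
      rw [enorm_mul, Real.enorm_of_nonneg (hk t), mul_assoc]
      gcongr
      rw [← ofReal_norm, ← ofReal_norm, ← ofReal_norm, ← ENNReal.ofReal_mul (norm_nonneg _)]
      exact ENNReal.ofReal_le_ofReal (norm_inner_le_norm _ _)
    have := ENNReal.toReal_mono (ENNReal.mul_ne_top htop enorm_ne_top) h3
    simpa [ENNReal.toReal_mul] using this
  have := T.opNorm_le_bound ENNReal.toReal_nonneg key
  rw [← ofReal_norm]
  exact (ENNReal.ofReal_le_ofReal this).trans_eq (ENNReal.ofReal_toReal htop)

/-- Young's inequality `L¹ * L² ⊂ L²`: Cauchy–Schwarz for the probability density `κ(x - ·)`, then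
Tonelli and translation invariance. -/
theorem lintegral_convolution_sq_le {N : ℕ} {κ γ : Rn N → ℝ≥0∞} (hκ : Measurable κ)
    (hγ : AEMeasurable γ volume) (h1 : ∫⁻ t, κ t = 1) :
    ∫⁻ x, (∫⁻ t, κ (x - t) * γ t) ^ (2 : ℝ) ≤ ∫⁻ t, γ t ^ (2 : ℝ) := by
  have hx : ∀ x, (∫⁻ t, κ (x - t) * γ t) ^ (2 : ℝ) ≤ ∫⁻ t, κ (x - t) * γ t ^ (2 : ℝ) := by
    intro x
    have hm : Measurable fun t => κ (x - t) := hκ.comp (measurable_const.sub measurable_id)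
    have h := ENNReal.lintegral_mul_norm_pow_le (μ := (volume : Measure (Rn N)))
      (f := fun t => κ (x - t)) (g := fun t => κ (x - t) * γ t ^ (2 : ℝ))
      hm.aemeasurable (hm.aemeasurable.mul (hγ.pow_const _)) (p := 1 / 2) (q := 1 / 2)
      (by norm_num) (by norm_num) (by norm_num)
    have e1 : ∫⁻ t, κ (x - t) = 1 := by rw [lintegral_sub_left_eq_self, h1]
    have e2 : ∀ t, κ (x - t) ^ (1 / 2 : ℝ) * (κ (x - t) * γ t ^ (2 : ℝ)) ^ (1 / 2 : ℝ)
        = κ (x - t) * γ t := by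
      intro t
      rw [ENNReal.mul_rpow_of_nonneg _ _ (by norm_num), ← mul_assoc,
        ← ENNReal.rpow_add_of_nonneg _ _ (by norm_num) (by norm_num), ← ENNReal.rpow_mul]
      norm_num
    simp_rw [e2] at h
    rw [e1, ENNReal.one_rpow, one_mul] at h
    calc _ ≤ ((∫⁻ t, κ (x - t) * γ t ^ (2 : ℝ)) ^ (1 / 2 : ℝ)) ^ (2 : ℝ) := by gcongr
      _ = _ := by rw [← ENNReal.rpow_mul]; norm_num
  calc _ ≤ ∫⁻ x, ∫⁻ t, κ (x - t) * γ t ^ (2 : ℝ) := lintegral_mono hx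
    _ = ∫⁻ t, ∫⁻ x, κ (x - t) * γ t ^ (2 : ℝ) := by
      apply lintegral_lintegral_swap
      refine AEMeasurable.mul ?_ ?_
      · exact (hκ.comp (measurable_fst.sub measurable_snd)).aemeasurable
      · exact (hγ.pow_const _).comp_snd
    _ = ∫⁻ t, γ t ^ (2 : ℝ) := by
      refine lintegral_congr fun t => ?_
      have hm : Measurable fun x => κ (x - t) := hκ.comp (measurable_id.sub measurable_const)
      rw [lintegral_mul_const _ hm,
        lintegral_sub_right_eq_self (μ := (volume : Measure (Rn N))) κ t, h1, one_mul]

/-- The critical Sobolev exponent `2* = 2N/(N-2)`. -/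
def sStar (N : ℕ) : ℝ := 2 * (N : ℝ) / ((N : ℝ) - 2)

theorem two_lt_sStar {N : ℕ} (hN : 3 ≤ N) : 2 < sStar N := by
  have h : (3 : ℝ) ≤ N := by exact_mod_cast hN
  unfold sStar
  rw [lt_div_iff₀ (by linarith)]; linarith

/-- A sequence of bumps shrinking to the origin. -/
def shrinkingBump (N : ℕ) (n : ℕ) : ContDiffBump (0 : Rn N) where
  rIn := 1 / ((n : ℝ) + 1)
  rOut := 2 / ((n : ℝ) + 1)
  rIn_pos := by positivity
  rIn_lt_rOut := by
    have : (0 : ℝ) < (n : ℝ) + 1 := by positivity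
    gcongr; norm_num

/-- The Gagliardo–Nirenberg–Sobolev inequality at `p = 2`; the exponent relation is `1/2* = 1/2 -
1/N`. -/
theorem exists_sobolev_const_contDiff {N : ℕ} (hN : 3 ≤ N) :
    ∃ C : ℝ≥0, ∀ w : Rn N → ℝ, ContDiff ℝ 1 w → HasCompactSupport w →
      eLpNorm w (ENNReal.ofReal (sStar N)) volume ≤ C * eLpNorm (fderiv ℝ w) 2 volume := by
  have h3 : (3 : ℝ) ≤ N := by exact_mod_cast hN
  have hs := two_lt_sStar hN
  refine ⟨SNormLESNormFDerivOfEqConst ℝ (volume : Measure (Rn N)) 2, fun w hw hc => ?_⟩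
  refine eLpNorm_le_eLpNorm_fderiv_of_eq (μ := (volume : Measure (Rn N))) hw hc
    (p := 2) (p' := (sStar N).toNNReal) (by norm_num) (by simp; omega) ?_
  rw [Real.coe_toNNReal _ (by linarith)]
  simp only [finrank_euclideanSpace, Fintype.card_fin, sStar]
  push_cast
  have h4 : (N : ℝ) - 2 ≠ 0 := by linarith
  have h5 : (N : ℝ) ≠ 0 := by linarith
  field_simp

/-- The gradient of the mollification is the mollification of the weak gradient, and averaging
against a probability density does not increase the `L²` norm. The bound is independent of the
scale. -/
theorem eLpNorm_fderiv_convolution_le {N : ℕ} {k v : Rn N → ℝ} {G : Rn N → Rn N}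
    (hk : IsTest k) (hk0 : ∀ x, 0 ≤ k x) (hk1 : ∫⁻ x, ENNReal.ofReal (k x) = 1)
    (hv : LocallyIntegrable v volume) (hG : MemLp G 2 volume) (hw : IsWeakGradFun v G) :
    eLpNorm (fderiv ℝ (k ⋆[ContinuousLinearMap.lsmul ℝ ℝ, volume] v)) 2 volume
      ≤ eLpNorm G 2 volume := by
  have hGl : ∀ i, LocallyIntegrable (fun x => G x i) volume := fun i =>
    ((EuclideanSpace.proj (𝕜 := ℝ) i : Rn N →L[ℝ] ℝ).comp_memLp' hG).locallyIntegrable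
      (by norm_num)
  have hpt : ∀ x, ‖fderiv ℝ (k ⋆[ContinuousLinearMap.lsmul ℝ ℝ, volume] v) x‖ₑ
      ≤ ∫⁻ t, ENNReal.ofReal (k (x - t)) * ‖G t‖ₑ := by
    intro x
    refine norm_le_of_coord _ (fun t => k (x - t)) (fun t => hk0 _) G (fun i => ?_)
      (fun i => fderiv_convolution_unitVec hk hv hw x i)
    have := (hGl i).integrable_smul_left_of_hasCompactSupport
      (hk.comp_sub_left x).smooth.continuous (hk.comp_sub_left x).compact
    simpa using this
  rw [eLpNorm_eq_lintegral_rpow_enorm_toReal (by norm_num) (by norm_num),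
    eLpNorm_eq_lintegral_rpow_enorm_toReal (by norm_num) (by norm_num)]
  refine ENNReal.rpow_le_rpow ?_ (by norm_num)
  simp only [ENNReal.toReal_ofNat]
  refine (lintegral_mono fun x => ENNReal.rpow_le_rpow (hpt x) (by norm_num)).trans ?_
  exact lintegral_convolution_sq_le (κ := fun x => ENNReal.ofReal (k x))
    hk.smooth.continuous.measurable.ennreal_ofReal hG.1.enorm hk1

theorem lintegral_normed_eq_one {N : ℕ} (ρ : ContDiffBump (0 : Rn N)) :
    ∫⁻ x, ENNReal.ofReal (ρ.normed volume x) = 1 := by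
  rw [← ofReal_integral_eq_lintegral_ofReal
    ((isTest_normed ρ).smooth.continuous.integrable_of_hasCompactSupport (isTest_normed ρ).compact)
    (Eventually.of_forall ρ.nonneg_normed), ρ.integral_normed, ENNReal.ofReal_one]

/-- Lebesgue differentiation; it applies because the outer radius of each bump is at most twice the
inner one, hence `K = 2`. -/
theorem ae_tendsto_convolution_shrinkingBump {N : ℕ} {v : Rn N → ℝ}
    (hv : LocallyIntegrable v volume) :
    ∀ᵐ x, Tendsto (fun n => ((shrinkingBump N n).normed volume
      ⋆[ContinuousLinearMap.lsmul ℝ ℝ, volume] v) x) atTop (𝓝 (v x)) := by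
  refine ContDiffBump.ae_convolution_tendsto_right_of_locallyIntegrable (K := 2)
    (φ := fun n => shrinkingBump N n) ?_ (Eventually.of_forall fun n => ?_) hv
  · have : Tendsto (fun n : ℕ => (2 : ℝ) * (1 / ((n : ℝ) + 1))) atTop (𝓝 (2 * 0)) :=
      tendsto_one_div_add_atTop_nhds_zero_nat.const_mul 2
    simpa [shrinkingBump, div_eq_mul_inv] using this
  · simp [shrinkingBump, div_eq_mul_inv]

/-- The Sobolev inequality for compactly supported functions with a weak gradient in `L²`. -/
theorem exists_sobolev_const_of_hasCompactSupport {N : ℕ} (hN : 3 ≤ N) :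
    ∃ C : ℝ≥0, ∀ (v : Rn N → ℝ) (G : Rn N → Rn N), MemLp v 2 volume → MemLp G 2 volume →
      HasCompactSupport v → IsWeakGradFun v G →
      eLpNorm v (ENNReal.ofReal (sStar N)) volume ≤ C * eLpNorm G 2 volume := by
  obtain ⟨C, hC⟩ := exists_sobolev_const_contDiff hN
  refine ⟨C, fun v G hv hG hc hw => ?_⟩
  have hvl : LocallyIntegrable v volume := hv.locallyIntegrable (by norm_num)
  have hk := fun n => isTest_normed (shrinkingBump N n)
  have hwc : ∀ n, ContDiff ℝ 1 ((shrinkingBump N n).normed volume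
      ⋆[ContinuousLinearMap.lsmul ℝ ℝ, volume] v) := fun n =>
    (hk n).compact.contDiff_convolution_left _ ((hk n).smooth.of_le (by simp)) hvl
  have hsob : ∀ n, eLpNorm ((shrinkingBump N n).normed volume
      ⋆[ContinuousLinearMap.lsmul ℝ ℝ, volume] v) (ENNReal.ofReal (sStar N)) volume
      ≤ C * eLpNorm G 2 volume := by
    intro n
    refine (hC _ (hwc n) ((hk n).compact.convolution _ hc)).trans ?_
    gcongr
    exact eLpNorm_fderiv_convolution_le (hk n) (shrinkingBump N n).nonneg_normed
      (lintegral_normed_eq_one _) hvl hG hw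
  -- Fatou's lemma transfers the uniform bound on the mollifications to their almost everywhere
  -- limit.
  refine (Lp.eLpNorm_lim_le_liminf_eLpNorm
    (fun n => (hwc n).continuous.aestronglyMeasurable) v
    (ae_tendsto_convolution_shrinkingBump hvl)).trans ?_
  exact liminf_le_of_frequently_le' (Frequently.of_forall hsob)

end HamSys
end

/-! ### The Sobolev embedding of `H¹` and Lions' vanishing lemma, by cutoffs. -/

noncomputable section

namespace HamSys

open scoped Convolution ENNReal NNReal

theorem isWeakGradFun_val {N : ℕ} (u : H1 N) : IsWeakGradFun (val u) (grad u) := u.2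

theorem memLp_val {N : ℕ} (u : H1 N) : MemLp (val u) 2 volume := Lp.memLp u.1.fst

theorem memLp_grad {N : ℕ} (u : H1 N) : MemLp (grad u) 2 volume := Lp.memLp u.1.snd

theorem norm_sq_eq {N : ℕ} (u : H1 N) : ‖u‖ ^ 2 = ‖u.1.fst‖ ^ 2 + ‖u.1.snd‖ ^ 2 := by
  have := WithLp.prod_norm_sq_eq_of_L2 u.1
  simpa using this

theorem norm_fst_le {N : ℕ} (u : H1 N) : ‖u.1.fst‖ ≤ ‖u‖ := by
  have := norm_sq_eq u
  exact le_of_sq_le_sq (by nlinarith [sq_nonneg ‖u.1.snd‖]) (norm_nonneg _)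

theorem norm_snd_le {N : ℕ} (u : H1 N) : ‖u.1.snd‖ ≤ ‖u‖ := by
  have := norm_sq_eq u
  exact le_of_sq_le_sq (by nlinarith [sq_nonneg ‖u.1.fst‖]) (norm_nonneg _)

theorem eLpNorm_val_le {N : ℕ} (u : H1 N) : eLpNorm (val u) 2 volume ≤ ‖u‖ₑ := by
  have h : eLpNorm (val u) 2 volume = ‖u.1.fst‖ₑ := (Lp.enorm_def _).symm
  rw [h, ← ofReal_norm, ← ofReal_norm]
  exact ENNReal.ofReal_le_ofReal (norm_fst_le u)

theorem eLpNorm_grad_le {N : ℕ} (u : H1 N) : eLpNorm (grad u) 2 volume ≤ ‖u‖ₑ := by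
  have h : eLpNorm (grad u) 2 volume = ‖u.1.snd‖ₑ := (Lp.enorm_def _).symm
  rw [h, ← ofReal_norm, ← ofReal_norm]
  exact ENNReal.ofReal_le_ofReal (norm_snd_le u)

/-- The classical gradient of a function on `ℝ^N`. -/
def gradC {N : ℕ} (χ : Rn N → ℝ) (x : Rn N) : Rn N := WithLp.toLp 2 fun i => partialD i χ x

theorem IsTest.continuous_gradC {N : ℕ} {χ : Rn N → ℝ} (h : IsTest χ) : Continuous (gradC χ) := by
  refine (PiLp.continuous_toLp 2 _).comp (continuous_pi fun i => ?_)
  exact (h.isTest_partialD i).smooth.continuous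

theorem IsTest.hasCompactSupport_gradC {N : ℕ} {χ : Rn N → ℝ} (h : IsTest χ) :
    HasCompactSupport (gradC χ) := by
  refine (h.compact.fderiv ℝ).mono fun x hx => ?_
  contrapose! hx
  simp only [Function.mem_support, ne_eq, not_not] at hx ⊢
  ext i
  simp [gradC, partialD, hx]

/-- The product rule for weak gradients. -/
theorem IsWeakGradFun.mul_test {N : ℕ} {u χ : Rn N → ℝ} {G : Rn N → Rn N}
    (hu : MemLp u 2 volume) (hG : MemLp G 2 volume) (hw : IsWeakGradFun u G) (hχ : IsTest χ) :
    IsWeakGradFun (fun x => χ x * u x) (fun x => χ x • G x + u x • gradC χ x) := by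
  intro φ hφ i
  have hGi : MemLp (fun x => G x i) 2 volume :=
    (EuclideanSpace.proj (𝕜 := ℝ) i : Rn N →L[ℝ] ℝ).comp_memLp' hG
  have h := hw _ (hχ.mul hφ) i
  have i1 : Integrable (fun x => u x * (χ x * partialD i φ x)) :=
    hu.integrable_mul (hχ.mul (hφ.isTest_partialD i)).memLp
  have i2 : Integrable (fun x => u x * (partialD i χ x * φ x)) :=
    hu.integrable_mul ((hχ.isTest_partialD i).mul hφ).memLp
  have i3 : Integrable (fun x => G x i * (χ x * φ x)) := hGi.integrable_mul (hχ.mul hφ).memLp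
  simp_rw [partialD_mul hχ hφ, mul_add] at h
  rw [integral_add i1 i2] at h
  have e1 : ∀ x, χ x * u x * partialD i φ x = u x * (χ x * partialD i φ x) := fun x => by ring
  have e2 : ∀ x, (χ x • G x + u x • gradC χ x) i * φ x
      = G x i * (χ x * φ x) + u x * (partialD i χ x * φ x) := fun x => by
    simp [gradC]; ring
  simp_rw [e1, e2]
  rw [integral_add i3 i2]; linarith

theorem memLp_mul_test {N : ℕ} {u χ : Rn N → ℝ} (hu : MemLp u 2 volume) (hχ : IsTest χ) :
    MemLp (fun x => χ x * u x) 2 volume := by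
  obtain ⟨C, hC⟩ := hχ.compact.exists_bound_of_continuous hχ.smooth.continuous
  refine hu.of_le_mul (c := C) (hχ.smooth.continuous.aestronglyMeasurable.mul hu.1)
    (Eventually.of_forall fun x => ?_)
  rw [norm_mul]
  exact mul_le_mul_of_nonneg_right (hC x) (norm_nonneg _)

theorem memLp_grad_mul_test {N : ℕ} {u χ : Rn N → ℝ} {G : Rn N → Rn N}
    (hu : MemLp u 2 volume) (hG : MemLp G 2 volume) (hχ : IsTest χ) :
    MemLp (fun x => χ x • G x + u x • gradC χ x) 2 volume := by
  obtain ⟨C, hC⟩ := hχ.compact.exists_bound_of_continuous hχ.smooth.continuous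
  obtain ⟨K, hK⟩ := hχ.hasCompactSupport_gradC.exists_bound_of_continuous hχ.continuous_gradC
  refine MemLp.add ?_ ?_
  · refine hG.of_le_mul (c := C) (hχ.smooth.continuous.aestronglyMeasurable.smul hG.1)
      (Eventually.of_forall fun x => ?_)
    rw [norm_smul]
    exact mul_le_mul_of_nonneg_right (hC x) (norm_nonneg _)
  · refine hu.of_le_mul (c := K) (hu.1.smul hχ.continuous_gradC.aestronglyMeasurable)
      (Eventually.of_forall fun x => ?_)
    rw [norm_smul, mul_comm]
    exact mul_le_mul_of_nonneg_right (hK x) (norm_nonneg _)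

theorem eLpNorm_two_sq {α F : Type*} [MeasurableSpace α] {μ : Measure α} [NormedAddCommGroup F]
    (f : α → F) : eLpNorm f 2 μ ^ (2 : ℝ) = ∫⁻ x, ‖f x‖ₑ ^ (2 : ℝ) ∂μ := by
  have := eLpNorm_nnreal_pow_eq_lintegral (f := f) (μ := μ) (p := 2) (by norm_num)
  simpa using this

theorem eLpNorm_ofReal_rpow {α F : Type*} [MeasurableSpace α] {μ : Measure α}
    [NormedAddCommGroup F] (f : α → F) {p : ℝ} (hp : 0 < p) :
    eLpNorm f (ENNReal.ofReal p) μ ^ p = ∫⁻ x, ‖f x‖ₑ ^ p ∂μ := by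
  have := eLpNorm_nnreal_pow_eq_lintegral (f := f) (μ := μ) (p := p.toNNReal) (by simpa using hp)
  rwa [Real.coe_toNNReal _ hp.le] at this

/-- The energy density `|u|² + |∇u|²`. -/
def energyDensity {N : ℕ} (u : H1 N) (x : Rn N) : ℝ≥0∞ :=
  ‖val u x‖ₑ ^ (2 : ℝ) + ‖grad u x‖ₑ ^ (2 : ℝ)

theorem aemeasurable_energyDensity {N : ℕ} (u : H1 N) :
    AEMeasurable (energyDensity u) volume :=
  ((memLp_val u).1.enorm.pow_const _).add ((memLp_grad u).1.enorm.pow_const _)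

theorem lintegral_energyDensity_le {N : ℕ} (u : H1 N) :
    ∫⁻ x, energyDensity u x ≤ 2 * ‖u‖ₑ ^ (2 : ℝ) := by
  unfold energyDensity
  rw [lintegral_add_left' ((memLp_val u).1.enorm.pow_const _), ← eLpNorm_two_sq,
    ← eLpNorm_two_sq, two_mul]
  gcongr
  · exact eLpNorm_val_le u
  · exact eLpNorm_grad_le u

/-- The squared size of a test function and its gradient. -/
def cutWeight {N : ℕ} (χ : Rn N → ℝ) (x : Rn N) : ℝ≥0∞ := ‖χ x‖ₑ ^ (2 : ℝ) + ‖gradC χ x‖ₑ ^ (2 : ℝ)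

theorem continuous_cutWeight {N : ℕ} {χ : Rn N → ℝ} (hχ : IsTest χ) :
    Continuous (cutWeight χ) := by
  unfold cutWeight
  exact (ENNReal.continuous_rpow_const.comp hχ.smooth.continuous.enorm).add
    (ENNReal.continuous_rpow_const.comp hχ.continuous_gradC.enorm)

theorem lintegral_cutWeight_ne_top {N : ℕ} {χ : Rn N → ℝ} (hχ : IsTest χ) :
    ∫⁻ x, cutWeight χ x ≠ ⊤ := by
  unfold cutWeight
  rw [lintegral_add_left' (hχ.smooth.continuous.aestronglyMeasurable.enorm.pow_const _),
    ← eLpNorm_two_sq, ← eLpNorm_two_sq]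
  refine ENNReal.add_ne_top.2 ⟨?_, ?_⟩
  · exact ENNReal.rpow_ne_top_of_nonneg (by norm_num) hχ.memLp.eLpNorm_ne_top
  · exact ENNReal.rpow_ne_top_of_nonneg (by norm_num)
      (hχ.continuous_gradC.memLp_of_hasCompactSupport hχ.hasCompactSupport_gradC).eLpNorm_ne_top

theorem gradC_comp_add_right {N : ℕ} (χ : Rn N → ℝ) (y x : Rn N) :
    gradC (fun t => χ (t + y)) x = gradC χ (x + y) := by
  ext i; simp [gradC, partialD_comp_add_right]

theorem cutWeight_comp_add_right {N : ℕ} (χ : Rn N → ℝ) (y x : Rn N) :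
    cutWeight (fun t => χ (t + y)) x = cutWeight χ (x + y) := by
  simp [cutWeight, gradC_comp_add_right]

/-- The Sobolev inequality localized by a cutoff function. -/
theorem exists_local_sobolev_const {N : ℕ} (hN : 3 ≤ N) :
    ∃ C : ℝ≥0, ∀ (χ : Rn N → ℝ), IsTest χ → ∀ u : H1 N,
      eLpNorm (fun x => χ x * val u x) (ENNReal.ofReal (sStar N)) volume ^ (2 : ℝ)
        ≤ C * ∫⁻ x, cutWeight χ x * energyDensity u x := by
  obtain ⟨C, hC⟩ := exists_sobolev_const_of_hasCompactSupport hN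
  refine ⟨C ^ (2 : ℝ) * 2, fun χ hχ u => ?_⟩
  have h := hC _ _ (memLp_mul_test (memLp_val u) hχ)
    (memLp_grad_mul_test (memLp_val u) (memLp_grad u) hχ) hχ.compact.mul_right
    (IsWeakGradFun.mul_test (memLp_val u) (memLp_grad u) (isWeakGradFun_val u) hχ)
  have hpt : ∀ x, ‖χ x • grad u x + val u x • gradC χ x‖ₑ ^ (2 : ℝ)
      ≤ 2 * (cutWeight χ x * energyDensity u x) := by
    intro x
    calc _ ≤ (‖χ x‖ₑ * ‖grad u x‖ₑ + ‖val u x‖ₑ * ‖gradC χ x‖ₑ) ^ (2 : ℝ) := by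
          gcongr
          refine (enorm_add_le _ _).trans ?_
          rw [enorm_smul, enorm_smul]
      _ ≤ 2 ^ ((2 : ℝ) - 1) * ((‖χ x‖ₑ * ‖grad u x‖ₑ) ^ (2 : ℝ)
            + (‖val u x‖ₑ * ‖gradC χ x‖ₑ) ^ (2 : ℝ)) :=
          ENNReal.rpow_add_le_mul_rpow_add_rpow _ _ (by norm_num)
      _ = 2 * (‖χ x‖ₑ ^ (2 : ℝ) * ‖grad u x‖ₑ ^ (2 : ℝ)
            + ‖gradC χ x‖ₑ ^ (2 : ℝ) * ‖val u x‖ₑ ^ (2 : ℝ)) := by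
          rw [ENNReal.mul_rpow_of_nonneg _ _ (by norm_num),
            ENNReal.mul_rpow_of_nonneg _ _ (by norm_num), mul_comm (‖val u x‖ₑ ^ (2 : ℝ))]
          norm_num
      _ ≤ 2 * (cutWeight χ x * energyDensity u x) := by
          unfold cutWeight energyDensity
          rw [add_mul, mul_add, mul_add]
          gcongr
          · exact le_add_self
          · exact le_self_add
  calc _ ≤ (C * eLpNorm (fun x => χ x • grad u x + val u x • gradC χ x) 2 volume) ^ (2 : ℝ) := by
        gcongr
    _ = C ^ (2 : ℝ) * ∫⁻ x, ‖χ x • grad u x + val u x • gradC χ x‖ₑ ^ (2 : ℝ) := by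
        rw [ENNReal.mul_rpow_of_nonneg _ _ (by norm_num), eLpNorm_two_sq]
    _ ≤ C ^ (2 : ℝ) * ∫⁻ x, 2 * (cutWeight χ x * energyDensity u x) := by
        gcongr with x; exact hpt x
    _ = _ := by
        rw [lintegral_const_mul' _ _ (by norm_num), ← mul_assoc]
        congr 1
        rw [ENNReal.coe_mul, ENNReal.coe_rpow_of_nonneg _ (by norm_num)]
        norm_num

/-- A fixed cutoff function, equal to one on the unit ball. -/
def cutoff (N : ℕ) : ContDiffBump (0 : Rn N) where
  rIn := 1
  rOut := 2
  rIn_pos := one_pos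
  rIn_lt_rOut := one_lt_two

theorem isTest_cutoff (N : ℕ) : IsTest (cutoff N) :=
  ⟨(cutoff N).contDiff, (cutoff N).hasCompactSupport⟩

theorem IsTest.comp_smul {N : ℕ} {χ : Rn N → ℝ} (h : IsTest χ) {r : ℝ} (hr : r ≠ 0) :
    IsTest (fun x => χ (r • x)) :=
  ⟨h.smooth.comp (contDiff_const_smul r), h.compact.comp_smul hr⟩

theorem gradC_comp_smul {N : ℕ} {χ : Rn N → ℝ} (r : ℝ) (x : Rn N) :
    gradC (fun x => χ (r • x)) x = r • gradC χ (r • x) := by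
  ext i
  simp [gradC, partialD, fderiv_comp_smul]

/-- The Sobolev embedding `H¹(ℝ^N) ⊂ L^{2*}(ℝ^N)`. -/
theorem exists_sobolev_const {N : ℕ} (hN : 3 ≤ N) :
    ∃ C : ℝ≥0, ∀ u : H1 N,
      eLpNorm (val u) (ENNReal.ofReal (sStar N)) volume ≤ C * ‖u‖ₑ := by
  obtain ⟨C, hC⟩ := exists_local_sobolev_const hN
  have hχ := isTest_cutoff N
  obtain ⟨K, hK⟩ := hχ.hasCompactSupport_gradC.exists_bound_of_continuous hχ.continuous_gradC
  have hr : ∀ n : ℕ, (1 : ℝ) / ((n : ℝ) + 1) ≠ 0 := fun n => by positivity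
  -- Dilating the cutoff only shrinks its gradient, so the localized inequality holds with a
  -- constant independent of `n`.
  have hw : ∀ (n : ℕ) x, cutWeight (fun x => cutoff N ((1 / ((n : ℝ) + 1)) • x)) x
      ≤ 1 + (K.toNNReal : ℝ≥0∞) ^ (2 : ℝ) := by
    intro n x
    unfold cutWeight
    have hn1 : ‖(1 : ℝ) / ((n : ℝ) + 1)‖ ≤ 1 := by
      rw [Real.norm_of_nonneg (by positivity)]
      rw [div_le_one (by positivity)]
      linarith [(Nat.cast_nonneg n : (0 : ℝ) ≤ n)]
    gcongr
    · rw [← ofReal_norm, Real.norm_of_nonneg (cutoff N).nonneg]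
      refine ENNReal.rpow_le_one ?_ (by norm_num)
      exact ENNReal.ofReal_le_one.2 (cutoff N).le_one
    · rw [gradC_comp_smul, ← ofReal_norm]
      refine ENNReal.ofReal_le_ofReal ?_
      rw [norm_smul]
      calc _ ≤ 1 * ‖gradC (cutoff N) ((1 / ((n : ℝ) + 1)) • x)‖ := by gcongr
        _ ≤ K := by rw [one_mul]; exact hK _
  obtain ⟨A, hA, hA'⟩ : ∃ A : ℝ≥0∞, A ≠ ⊤ ∧
      A = C * ((1 + (K.toNNReal : ℝ≥0∞) ^ (2 : ℝ)) * 2) := by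
    refine ⟨_, ?_, rfl⟩
    refine ENNReal.mul_ne_top ENNReal.coe_ne_top (ENNReal.mul_ne_top ?_ (by norm_num))
    exact ENNReal.add_ne_top.2 ⟨by norm_num,
      ENNReal.rpow_ne_top_of_nonneg (by norm_num) ENNReal.coe_ne_top⟩
  have hA2 : A ^ (1 / 2 : ℝ) ≠ ⊤ := ENNReal.rpow_ne_top_of_nonneg (by norm_num) hA
  refine ⟨(A ^ (1 / 2 : ℝ)).toNNReal, fun u => ?_⟩
  rw [ENNReal.coe_toNNReal hA2]
  have hb : ∀ n : ℕ, eLpNorm (fun x => cutoff N ((1 / ((n : ℝ) + 1)) • x) * val u x)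
      (ENNReal.ofReal (sStar N)) volume ≤ A ^ (1 / 2 : ℝ) * ‖u‖ₑ := by
    intro n
    have h1 := hC _ (hχ.comp_smul (hr n)) u
    have h2 : ∫⁻ x, cutWeight (fun x => cutoff N ((1 / ((n : ℝ) + 1)) • x)) x * energyDensity u x
        ≤ (1 + (K.toNNReal : ℝ≥0∞) ^ (2 : ℝ)) * (2 * ‖u‖ₑ ^ (2 : ℝ)) := by
      calc _ ≤ ∫⁻ x, (1 + (K.toNNReal : ℝ≥0∞) ^ (2 : ℝ)) * energyDensity u x := by
            gcongr with x; exact hw n x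
        _ = (1 + (K.toNNReal : ℝ≥0∞) ^ (2 : ℝ)) * ∫⁻ x, energyDensity u x :=
            lintegral_const_mul'' _ (aemeasurable_energyDensity u)
        _ ≤ _ := by gcongr; exact lintegral_energyDensity_le u
    have h3 := h1.trans (mul_le_mul_right h2 (C : ℝ≥0∞))
    have h4 := ENNReal.rpow_le_rpow h3 (z := 1 / 2) (by norm_num)
    rw [← ENNReal.rpow_mul, show (2 : ℝ) * (1 / 2) = 1 by norm_num, ENNReal.rpow_one] at h4
    refine h4.trans_eq ?_
    rw [hA', show (C : ℝ≥0∞) * ((1 + (K.toNNReal : ℝ≥0∞) ^ (2 : ℝ)) * (2 * ‖u‖ₑ ^ (2 : ℝ)))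
      = C * ((1 + (K.toNNReal : ℝ≥0∞) ^ (2 : ℝ)) * 2) * ‖u‖ₑ ^ (2 : ℝ) by
        generalize ‖u‖ₑ = t; ring]
    generalize ‖u‖ₑ = t
    rw [ENNReal.mul_rpow_of_nonneg _ _ (by norm_num), ← ENNReal.rpow_mul]
    norm_num
  -- The dilated cutoffs tend to one pointwise, and Fatou's lemma removes them.
  refine (Lp.eLpNorm_lim_le_liminf_eLpNorm (fun n => ?_) (val u)
    (Eventually.of_forall fun x => ?_)).trans (liminf_le_of_frequently_le' (Frequently.of_forall hb))
  · exact (memLp_mul_test (memLp_val u) (hχ.comp_smul (hr n))).1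
  · have hl : Tendsto (fun n : ℕ => (1 / ((n : ℝ) + 1)) • x) atTop (𝓝 ((0 : ℝ) • x)) :=
      tendsto_one_div_add_atTop_nhds_zero_nat.smul_const x
    rw [zero_smul] at hl
    have h0 : cutoff N (0 : Rn N) = 1 := (cutoff N).one_of_mem_closedBall (by simp [cutoff])
    have := (((isTest_cutoff N).smooth.continuous.tendsto 0).comp hl).mul_const (val u x)
    simpa [h0] using this

/-- Quantitative form of Lions' vanishing lemma. -/
theorem exists_vanishing_const {N : ℕ} (hN : 3 ≤ N) :
    ∃ C : ℝ≥0∞, C ≠ ⊤ ∧ ∀ (u : H1 N) (κ : ℝ≥0∞),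
      (∀ y, ∫⁻ x, ‖cutoff N (x + y) * val u x‖ₑ ≤ κ) →
      ∫⁻ x, ‖val u x‖ₑ ^ (2 / (N : ℝ) + 2) ≤ C * (κ ^ (2 / (N : ℝ)) * ‖u‖ₑ ^ (2 : ℝ)) := by
  obtain ⟨C, hC⟩ := exists_local_sobolev_const hN
  have h3 : (3 : ℝ) ≤ N := by exact_mod_cast hN
  have hs := two_lt_sStar hN
  have hχ := isTest_cutoff N
  -- The interpolation weight between `L¹` and `L^{2*}` is fixed by `2* (1 - s) = 2`: the local
  -- Sobolev norm then enters with power exactly two, so the local estimates add up to the total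
  -- energy.
  set s : ℝ := 2 / (N : ℝ) with hs_def
  have hs0 : 0 < s := by positivity
  have hs1 : s ≤ 1 := by rw [hs_def, div_le_one (by linarith)]; linarith
  have hss : sStar N * (1 - s) = 2 := by
    have h4 : (N : ℝ) - 2 ≠ 0 := by linarith
    have h5 : (N : ℝ) ≠ 0 := by linarith
    rw [hs_def, sStar]; field_simp
  set c₀ : ℝ≥0∞ := ∫⁻ x, ‖cutoff N x‖ₑ ^ (s + 2) with hc₀
  set c₁ : ℝ≥0∞ := ∫⁻ x, cutWeight (cutoff N) x with hc₁
  have hc₁t : c₁ ≠ ⊤ := lintegral_cutWeight_ne_top hχ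
  have hc₀0 : c₀ ≠ 0 := by
    rw [hc₀, Ne, lintegral_eq_zero_iff
      (hχ.smooth.continuous.enorm.measurable.pow_const _)]
    intro h
    have hz : (fun x : Rn N => ‖cutoff N x‖ₑ ^ (s + 2)) = 0 :=
      Continuous.ae_eq_iff_eq volume (ENNReal.continuous_rpow_const.comp
        hχ.smooth.continuous.enorm) continuous_const |>.1 h
    have h0 : cutoff N (0 : Rn N) = 1 := (cutoff N).one_of_mem_closedBall (by simp [cutoff])
    have := congrFun hz 0
    simp [h0] at this
  have hc₀t : c₀ ≠ ⊤ := by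
    have := (hχ.smooth.continuous.memLp_of_hasCompactSupport (p := ENNReal.ofReal (s + 2))
      (μ := (volume : Measure (Rn N))) hχ.compact).eLpNorm_ne_top
    rw [hc₀, ← eLpNorm_ofReal_rpow _ (by positivity)]
    exact ENNReal.rpow_ne_top_of_nonneg (by positivity) this
  refine ⟨c₀⁻¹ * (C * c₁ * 2), ENNReal.mul_ne_top (ENNReal.inv_ne_top.2 hc₀0)
    (ENNReal.mul_ne_top (ENNReal.mul_ne_top ENNReal.coe_ne_top hc₁t) (by norm_num)), ?_⟩
  intro u κ hκ
  have hum := (memLp_val u).1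
  have hloc : ∀ y, ∫⁻ x, ‖cutoff N (x + y) * val u x‖ₑ ^ (s + 2)
      ≤ κ ^ s * (C * ∫⁻ x, cutWeight (cutoff N) (x + y) * energyDensity u x) := by
    intro y
    have hχy := hχ.comp_add_right y
    have hm : AEMeasurable (fun x => ‖cutoff N (x + y) * val u x‖ₑ) volume :=
      (memLp_mul_test (memLp_val u) hχy).1.enorm
    have h := ENNReal.lintegral_mul_norm_pow_le (μ := (volume : Measure (Rn N))) hm
      (hm.pow_const (sStar N)) hs0.le (sub_nonneg.2 hs1) (by ring)
    have e : ∀ x, ‖cutoff N (x + y) * val u x‖ₑ ^ s *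
        (‖cutoff N (x + y) * val u x‖ₑ ^ sStar N) ^ (1 - s)
        = ‖cutoff N (x + y) * val u x‖ₑ ^ (s + 2) := by
      intro x
      rw [← ENNReal.rpow_mul, hss, ← ENNReal.rpow_add_of_nonneg _ _ hs0.le (by norm_num)]
    simp_rw [e] at h
    refine h.trans ?_
    gcongr
    · exact hκ y
    · rw [← eLpNorm_ofReal_rpow _ (by linarith), ← ENNReal.rpow_mul, hss]
      simpa only [cutWeight_comp_add_right] using hC _ hχy u
  -- Integrating the local estimate over all centres `y` plays the role of a covering of bounded
  -- overlap; by Tonelli each side becomes a constant times a global integral.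
  have hL : ∫⁻ y, ∫⁻ x, ‖cutoff N (x + y) * val u x‖ₑ ^ (s + 2)
      = c₀ * ∫⁻ x, ‖val u x‖ₑ ^ (s + 2) := by
    rw [lintegral_lintegral_swap]
    · rw [← lintegral_const_mul'' _ (hum.enorm.pow_const _)]
      refine lintegral_congr fun x => ?_
      simp_rw [enorm_mul, ENNReal.mul_rpow_of_nonneg _ _ (show 0 ≤ s + 2 by positivity)]
      rw [lintegral_mul_const', hc₀,
        lintegral_add_left_eq_self (μ := (volume : Measure (Rn N)))
          (fun y => ‖cutoff N y‖ₑ ^ (s + 2)) x]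
      exact ENNReal.rpow_ne_top_of_nonneg (by positivity) enorm_ne_top
    · refine AEMeasurable.pow_const ?_ _
      refine AEStronglyMeasurable.enorm (AEStronglyMeasurable.mul ?_ hum.comp_snd)
      exact (hχ.smooth.continuous.comp
        (continuous_snd.add continuous_fst)).aestronglyMeasurable
  have hR : ∫⁻ y, ∫⁻ x, cutWeight (cutoff N) (x + y) * energyDensity u x
      = c₁ * ∫⁻ x, energyDensity u x := by
    rw [lintegral_lintegral_swap]
    · rw [← lintegral_const_mul'' _ (aemeasurable_energyDensity u)]
      refine lintegral_congr fun x => ?_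
      have hm : Measurable fun y => cutWeight (cutoff N) (x + y) :=
        ((continuous_cutWeight hχ).comp (continuous_const.add continuous_id)).measurable
      rw [lintegral_mul_const _ hm, hc₁,
        lintegral_add_left_eq_self (μ := (volume : Measure (Rn N))) (cutWeight (cutoff N)) x]
    · refine AEMeasurable.mul ?_ (aemeasurable_energyDensity u).comp_snd
      exact ((continuous_cutWeight hχ).comp
        (continuous_snd.add continuous_fst)).aemeasurable
  have hfin : c₀ * ∫⁻ x, ‖val u x‖ₑ ^ (s + 2) ≤ κ ^ s * (C * (c₁ * (2 * ‖u‖ₑ ^ (2 : ℝ)))) := by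
    rw [← hL]
    have hm : AEMeasurable
        (fun y => ∫⁻ x, cutWeight (cutoff N) (x + y) * energyDensity u x) volume := by
      refine AEMeasurable.lintegral_prod_right'
        (f := fun q : Rn N × Rn N => cutWeight (cutoff N) (q.2 + q.1) * energyDensity u q.2) ?_
      refine AEMeasurable.mul ?_ (aemeasurable_energyDensity u).comp_snd
      exact ((continuous_cutWeight hχ).comp
        (continuous_snd.add continuous_fst)).aemeasurable
    calc ∫⁻ y, ∫⁻ x, ‖cutoff N (x + y) * val u x‖ₑ ^ (s + 2)
        ≤ ∫⁻ y, κ ^ s * (C * ∫⁻ x, cutWeight (cutoff N) (x + y) * energyDensity u x) :=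
          lintegral_mono hloc
      _ = κ ^ s * ∫⁻ y, (C * ∫⁻ x, cutWeight (cutoff N) (x + y) * energyDensity u x) :=
          lintegral_const_mul'' _ (hm.const_mul _)
      _ = κ ^ s * (C * ∫⁻ y, ∫⁻ x, cutWeight (cutoff N) (x + y) * energyDensity u x) :=
          congrArg (κ ^ s * ·) (lintegral_const_mul'' _ hm)
      _ = κ ^ s * (C * (c₁ * ∫⁻ x, energyDensity u x)) := by rw [hR]
      _ ≤ _ := mul_le_mul' le_rfl (mul_le_mul' le_rfl
          (mul_le_mul' le_rfl (lintegral_energyDensity_le u)))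
  clear_value c₀ c₁ s
  calc ∫⁻ x, ‖val u x‖ₑ ^ (s + 2) = c₀⁻¹ * (c₀ * ∫⁻ x, ‖val u x‖ₑ ^ (s + 2)) := by
        rw [← mul_assoc, ENNReal.inv_mul_cancel hc₀0 hc₀t, one_mul]
    _ ≤ c₀⁻¹ * (κ ^ s * (C * (c₁ * (2 * ‖u‖ₑ ^ (2 : ℝ))))) := mul_le_mul' le_rfl hfin
    _ = _ := by generalize ‖u‖ₑ = t; ring

end HamSys
end

/-! ### Weak convergence, completeness and separability of `H¹`, and Rellich's theorem. -/

noncomputable section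

namespace HamSys

open scoped Convolution ENNReal NNReal

/-- Weak convergence of sequences in a real normed space. -/
def WeakTo {X : Type*} [NormedAddCommGroup X] [NormedSpace ℝ X] (u : ℕ → X) (l : X) : Prop :=
  ∀ D : X →L[ℝ] ℝ, Tendsto (fun n => D (u n)) atTop (𝓝 (D l))

theorem WeakTo.map {X Y : Type*} [NormedAddCommGroup X] [NormedSpace ℝ X]
    [NormedAddCommGroup Y] [NormedSpace ℝ Y] {u : ℕ → X} {l : X} (h : WeakTo u l)
    (T : X →L[ℝ] Y) : WeakTo (fun n => T (u n)) (T l) := fun D => h (D.comp T)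

theorem WeakTo.comp {X : Type*} [NormedAddCommGroup X] [NormedSpace ℝ X] {u : ℕ → X} {l : X}
    (h : WeakTo u l) {φ : ℕ → ℕ} (hφ : StrictMono φ) : WeakTo (u ∘ φ) l :=
  fun D => (h D).comp hφ.tendsto_atTop

theorem WeakTo.add {X : Type*} [NormedAddCommGroup X] [NormedSpace ℝ X] {u v : ℕ → X} {l m : X}
    (h : WeakTo u l) (h' : WeakTo v m) : WeakTo (fun n => u n + v n) (l + m) := fun D => by
  simpa using (h D).add (h' D)

theorem WeakTo.sub_const {X : Type*} [NormedAddCommGroup X] [NormedSpace ℝ X] {u : ℕ → X} {l : X}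
    (h : WeakTo u l) : WeakTo (fun n => u n - l) 0 := fun D => by
  simpa using (h D).sub_const (D l)

theorem WeakTo.smul {X : Type*} [NormedAddCommGroup X] [NormedSpace ℝ X] {u : ℕ → X} {l : X}
    (h : WeakTo u l) {t : ℕ → ℝ} {t₀ : ℝ} (ht : Tendsto t atTop (𝓝 t₀)) :
    WeakTo (fun n => t n • u n) (t₀ • l) := fun D => by
  simpa using ht.mul (h D)

/-- Bounded sequences in a separable Hilbert space have weakly convergent subsequences. -/
theorem exists_weakTo_subseq {X : Type*} [NormedAddCommGroup X] [InnerProductSpace ℝ X]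
    [CompleteSpace X] [TopologicalSpace.SeparableSpace X] {u : ℕ → X} {R : ℝ}
    (hu : ∀ n, ‖u n‖ ≤ R) : ∃ (l : X) (φ : ℕ → ℕ), StrictMono φ ∧ WeakTo (u ∘ φ) l := by
  have hc := WeakDual.isSeqCompact_closedBall ℝ (E := X) 0 R
  obtain ⟨ℓ, -, φ, hφ, hl⟩ := hc (x := fun n => StrongDual.toWeakDual
    (InnerProductSpace.toDual ℝ X (u n))) (fun n => by simpa using hu n)
  refine ⟨(InnerProductSpace.toDual ℝ X).symm (WeakDual.toStrongDual ℓ), φ, hφ, fun D => ?_⟩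
  have h := ((WeakDual.eval_continuous ((InnerProductSpace.toDual ℝ X).symm D)).tendsto ℓ).comp hl
  have e : ∀ x, D x = inner ℝ x ((InnerProductSpace.toDual ℝ X).symm D) := fun x => by
    rw [real_inner_comm, InnerProductSpace.toDual_symm_apply]
  rw [e, InnerProductSpace.toDual_symm_apply]
  refine h.congr fun n => ?_
  simp only [Function.comp, e (u (φ n))]
  rfl

theorem integral_mul_eq_inner {N : ℕ} (u : Lp ℝ 2 (volume : Measure (Rn N))) {ψ : Rn N → ℝ}
    (hψ : MemLp ψ 2 volume) : ∫ x, u x * ψ x = inner ℝ (hψ.toLp ψ) u := by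
  rw [L2.inner_def]
  refine integral_congr_ae ?_
  filter_upwards [hψ.coeFn_toLp] with x hx
  rw [hx]; simp

/-- For each fixed test function the defining identity equates inner products with fixed `L²`
elements, which is a closed condition. This yields completeness. -/
theorem isClosed_H1 (N : ℕ) : IsClosed (H1 N : Set (WithLp 2 (Lp ℝ 2 (volume : Measure (Rn N)) ×
    Lp (Rn N) 2 (volume : Measure (Rn N))))) := by
  have : (H1 N : Set (WithLp 2 (Lp ℝ 2 (volume : Measure (Rn N)) ×
      Lp (Rn N) 2 (volume : Measure (Rn N))))) = ⋂ (φ : Rn N → ℝ) (_ : IsTest φ) (i : Fin N),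
      {p | ∫ x, p.fst x * partialD i φ x = -∫ x, p.snd x i * φ x} := by
    ext p; simp only [Set.mem_iInter]; rfl
  rw [this]
  refine isClosed_iInter fun φ => isClosed_iInter fun hφ => isClosed_iInter fun i => ?_
  have hψ : MemLp (fun x => φ x • unitVec i) 2 (volume : Measure (Rn N)) := by
    refine (hφ.smooth.continuous.smul continuous_const).memLp_of_hasCompactSupport ?_
    exact hφ.compact.smul_right
  have e : ∀ p : WithLp 2 (Lp ℝ 2 (volume : Measure (Rn N)) ×
      Lp (Rn N) 2 (volume : Measure (Rn N))),
      ∫ x, p.snd x i * φ x = inner ℝ (hψ.toLp _) p.snd := by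
    intro p
    rw [L2.inner_def]
    refine integral_congr_ae ?_
    filter_upwards [hψ.coeFn_toLp] with x hx
    rw [hx]
    simp [inner_smul_left, EuclideanSpace.inner_single_left]
    ring
  simp_rw [integral_mul_eq_inner _ (hφ.memLp_partialD i), e]
  exact isClosed_eq (continuous_const.inner (WithLp.continuous_fst 2 _ _))
    (continuous_const.inner (WithLp.continuous_snd 2 _ _)).neg

instance instCompleteSpaceH1 (N : ℕ) : CompleteSpace (H1 N) :=
  (isClosed_H1 N).completeSpace_coe

/-- Needed to extract weakly convergent subsequences from bounded sequences. -/
theorem separableSpace_H1 (N : ℕ) : TopologicalSpace.SeparableSpace (H1 N) := by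
  have : Fact ((2 : ℝ≥0∞) ≠ ⊤) := ⟨by norm_num⟩
  have h1 : SecondCountableTopology (Lp ℝ 2 (volume : Measure (Rn N))) :=
    Lp.SecondCountableTopology
  have h2 : SecondCountableTopology (Lp (Rn N) 2 (volume : Measure (Rn N))) :=
    Lp.SecondCountableTopology
  have h3 : SecondCountableTopology (WithLp 2 (Lp ℝ 2 (volume : Measure (Rn N)) ×
      Lp (Rn N) 2 (volume : Measure (Rn N)))) := WithLp.secondCountableTopology 2 _ _
  have h4 : SecondCountableTopology (H1 N) :=
    TopologicalSpace.Subtype.secondCountableTopology _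
  exact TopologicalSpace.SecondCountableTopology.to_separableSpace

theorem tendsto_zero_of_le_add {f : ℕ → ℝ≥0∞}
    (h : ∀ ε : ℝ≥0∞, 0 < ε → ∃ g : ℕ → ℝ≥0∞, Tendsto g atTop (𝓝 0) ∧ ∀ n, f n ≤ ε + g n) :
    Tendsto f atTop (𝓝 0) := by
  rw [ENNReal.tendsto_nhds_zero]
  intro ε hε
  obtain ⟨g, hg, hfg⟩ := h (ε / 2) (ENNReal.half_pos hε.ne')
  filter_upwards [(ENNReal.tendsto_nhds_zero.1 hg) (ε / 2) (ENNReal.half_pos hε.ne')] with n hn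
  calc f n ≤ ε / 2 + g n := hfg n
    _ ≤ ε / 2 + ε / 2 := by gcongr
    _ = ε := ENNReal.add_halves ε

/-- Translates of a `C¹` function differ in `L²` by at most the gradient. -/
theorem eLpNorm_translate_sub_le_of_contDiff {N : ℕ} {w : Rn N → ℝ} (hw : ContDiff ℝ 1 w)
    (y : Rn N) : eLpNorm (fun x => w (x + y) - w x) 2 volume
      ≤ ‖y‖ₑ * eLpNorm (fderiv ℝ w) 2 volume := by
  have hfc : Continuous (fderiv ℝ w) := hw.continuous_fderiv (by norm_num)
  have hpt : ∀ x, ‖w (x + y) - w x‖ₑ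
      ≤ ‖y‖ₑ * ∫⁻ t in Set.Ioc (0 : ℝ) 1, ‖fderiv ℝ w (x + t • y)‖ₑ := by
    intro x
    have hd : ∀ t ∈ Set.uIcc (0 : ℝ) 1, HasDerivAt (fun t : ℝ => w (x + t • y))
        (fderiv ℝ w (x + t • y) y) t := by
      intro t _
      have h1 : HasFDerivAt w (fderiv ℝ w (x + t • y)) (x + t • y) :=
        (hw.differentiable (by norm_num) _).hasFDerivAt
      have h2 : HasDerivAt (fun t : ℝ => x + t • y) y t := by
        simpa using ((hasDerivAt_id t).smul_const y).const_add x
      exact h1.comp_hasDerivAt t h2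
    have hc : Continuous fun t : ℝ => fderiv ℝ w (x + t • y) y :=
      (hfc.comp (by fun_prop)).clm_apply continuous_const
    have h := intervalIntegral.integral_eq_sub_of_hasDerivAt hd (hc.intervalIntegrable _ _)
    simp only [one_smul, zero_smul, add_zero] at h
    rw [← h, intervalIntegral.integral_of_le zero_le_one]
    refine (enorm_integral_le_lintegral_enorm _).trans ?_
    rw [← lintegral_const_mul' _ _ enorm_ne_top]
    refine lintegral_mono fun t => ?_
    rw [mul_comm]
    exact ContinuousLinearMap.le_opENorm _ _
  have hsq : ∀ x, ‖w (x + y) - w x‖ₑ ^ (2 : ℝ)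
      ≤ ‖y‖ₑ ^ (2 : ℝ) * ∫⁻ t in Set.Ioc (0 : ℝ) 1, ‖fderiv ℝ w (x + t • y)‖ₑ ^ (2 : ℝ) := by
    intro x
    have hm : AEMeasurable (fun t : ℝ => ‖fderiv ℝ w (x + t • y)‖ₑ)
        (volume.restrict (Set.Ioc (0 : ℝ) 1)) :=
      (hfc.comp (by fun_prop : Continuous fun t : ℝ => x + t • y)).enorm.aemeasurable
    have h := ENNReal.lintegral_mul_norm_pow_le (μ := volume.restrict (Set.Ioc (0 : ℝ) 1))
      (hm.pow_const (2 : ℝ)) (aemeasurable_const (b := 1)) (p := 1 / 2) (q := 1 / 2)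
      (by norm_num) (by norm_num) (by norm_num)
    have e : ∀ t : ℝ, (‖fderiv ℝ w (x + t • y)‖ₑ ^ (2 : ℝ)) ^ (1 / 2 : ℝ)
        = ‖fderiv ℝ w (x + t • y)‖ₑ := fun t => by rw [← ENNReal.rpow_mul]; norm_num
    simp only [ENNReal.one_rpow, mul_one, lintegral_const, e,
      Measure.restrict_apply MeasurableSet.univ, Set.univ_inter, Real.volume_Ioc, sub_zero,
      ENNReal.ofReal_one] at h
    calc _ ≤ (‖y‖ₑ * ∫⁻ t in Set.Ioc (0 : ℝ) 1, ‖fderiv ℝ w (x + t • y)‖ₑ) ^ (2 : ℝ) := by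
          gcongr; exact hpt x
      _ ≤ (‖y‖ₑ * (∫⁻ t in Set.Ioc (0 : ℝ) 1, ‖fderiv ℝ w (x + t • y)‖ₑ ^ (2 : ℝ))
            ^ (1 / 2 : ℝ)) ^ (2 : ℝ) := by
          gcongr
      _ = _ := by
          rw [ENNReal.mul_rpow_of_nonneg _ _ (by norm_num), ← ENNReal.rpow_mul]; norm_num
  have hintg : ∫⁻ x, ‖w (x + y) - w x‖ₑ ^ (2 : ℝ)
      ≤ ‖y‖ₑ ^ (2 : ℝ) * ∫⁻ x, ‖fderiv ℝ w x‖ₑ ^ (2 : ℝ) := by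
    refine (lintegral_mono hsq).trans ?_
    rw [lintegral_const_mul' _ _ (ENNReal.rpow_ne_top_of_nonneg (by norm_num) enorm_ne_top)]
    refine mul_le_mul' le_rfl ?_
    rw [lintegral_lintegral_swap]
    · have : ∀ t : ℝ, ∫⁻ x, ‖fderiv ℝ w (x + t • y)‖ₑ ^ (2 : ℝ)
          = ∫⁻ x, ‖fderiv ℝ w x‖ₑ ^ (2 : ℝ) := fun t =>
        lintegral_add_right_eq_self (fun x => ‖fderiv ℝ w x‖ₑ ^ (2 : ℝ)) (t • y)
      simp_rw [this]
      simp
    · refine AEMeasurable.pow_const ?_ _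
      refine Continuous.aemeasurable ?_
      exact (hfc.comp (by fun_prop : Continuous fun q : Rn N × ℝ => q.1 + q.2 • y)).enorm
  rw [← ENNReal.rpow_le_rpow_iff (z := 2) (by norm_num),
    ENNReal.mul_rpow_of_nonneg _ _ (by norm_num), eLpNorm_two_sq, eLpNorm_two_sq]
  exact hintg

/-- Translates of an `H¹` function differ in `L²` by at most the gradient. -/
theorem eLpNorm_translate_sub_le {N : ℕ} (u : H1 N) (y : Rn N) :
    eLpNorm (fun x => val u (x + y) - val u x) 2 volume ≤ ‖y‖ₑ * ‖u‖ₑ := by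
  have hvl : LocallyIntegrable (val u) volume := (memLp_val u).locallyIntegrable (by norm_num)
  have hk := fun n => isTest_normed (shrinkingBump N n)
  have hwc : ∀ n, ContDiff ℝ 1 ((shrinkingBump N n).normed volume
      ⋆[ContinuousLinearMap.lsmul ℝ ℝ, volume] val u) := fun n =>
    (hk n).compact.contDiff_convolution_left _ ((hk n).smooth.of_le (by simp)) hvl
  have hb : ∀ n, eLpNorm (fun x => ((shrinkingBump N n).normed volume
      ⋆[ContinuousLinearMap.lsmul ℝ ℝ, volume] val u) (x + y) - ((shrinkingBump N n).normed volume
      ⋆[ContinuousLinearMap.lsmul ℝ ℝ, volume] val u) x) 2 volume ≤ ‖y‖ₑ * ‖u‖ₑ := by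
    intro n
    refine (eLpNorm_translate_sub_le_of_contDiff (hwc n) y).trans ?_
    refine mul_le_mul' le_rfl (le_trans ?_ (eLpNorm_grad_le u))
    exact eLpNorm_fderiv_convolution_le (hk n) (shrinkingBump N n).nonneg_normed
      (lintegral_normed_eq_one _) hvl (memLp_grad u) (isWeakGradFun_val u)
  have hae := ae_tendsto_convolution_shrinkingBump hvl
  have hae' := (measurePreserving_add_right volume y).quasiMeasurePreserving.ae hae
  refine (Lp.eLpNorm_lim_le_liminf_eLpNorm (fun n => ?_) _ ?_).trans
    (liminf_le_of_frequently_le' (Frequently.of_forall hb))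
  · exact (((hwc n).continuous.comp (continuous_id.add continuous_const)).sub
      (hwc n).continuous).aestronglyMeasurable
  · filter_upwards [hae, hae'] with x h1 h2
    exact h2.sub h1

theorem lintegral_enorm_mul_le {N : ℕ} {f g : Rn N → ℝ} (hf : AEStronglyMeasurable f volume)
    (hg : AEStronglyMeasurable g volume) :
    ∫⁻ x, ‖f x‖ₑ * ‖g x‖ₑ ≤ eLpNorm f 2 volume * eLpNorm g 2 volume := by
  have h := ENNReal.lintegral_mul_norm_pow_le (μ := (volume : Measure (Rn N)))
    (hf.enorm.pow_const (2 : ℝ)) (hg.enorm.pow_const (2 : ℝ)) (p := 1 / 2) (q := 1 / 2)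
    (by norm_num) (by norm_num) (by norm_num)
  have e : ∀ t : ℝ≥0∞, (t ^ (2 : ℝ)) ^ (1 / 2 : ℝ) = t := fun t => by
    rw [← ENNReal.rpow_mul]; norm_num
  simp_rw [← eLpNorm_two_sq, e] at h
  exact h

/-- Mollification at scale `r` moves an `H¹` function by at most `r` in `L²`, tested against an
`L²` function. -/
theorem lintegral_sub_convolution_le {N : ℕ} (ρ : ContDiffBump (0 : Rn N)) (u : H1 N)
    {η : Rn N → ℝ} (hη : MemLp η 2 volume) :
    ∫⁻ x, ‖val u x - (ρ.normed volume ⋆[ContinuousLinearMap.lsmul ℝ ℝ, volume] val u) x‖ₑ * ‖η x‖ₑ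
      ≤ ENNReal.ofReal ρ.rOut * (‖u‖ₑ * eLpNorm η 2 volume) := by
  have hvl : LocallyIntegrable (val u) volume := (memLp_val u).locallyIntegrable (by norm_num)
  have hk := isTest_normed ρ
  have hum := (memLp_val u).1
  have hk1 := lintegral_normed_eq_one ρ
  set k := ρ.normed (volume : Measure (Rn N)) with hkdef
  have hk0 : ∀ x, 0 ≤ k x := ρ.nonneg_normed
  have hpt : ∀ x, ‖val u x - (k ⋆[ContinuousLinearMap.lsmul ℝ ℝ, volume] val u) x‖ₑ
      ≤ ∫⁻ t, ENNReal.ofReal (k t) * ‖val u (x + -t) - val u x‖ₑ := by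
    intro x
    have hex : Integrable (fun t => k t * val u (x - t)) volume := by
      have := hk.compact.convolutionExists_left (ContinuousLinearMap.lsmul ℝ ℝ)
        hk.smooth.continuous hvl x
      simpa [ConvolutionExistsAt] using this
    have hki : Integrable k volume := hk.smooth.continuous.integrable_of_hasCompactSupport hk.compact
    have e : val u x - (k ⋆[ContinuousLinearMap.lsmul ℝ ℝ, volume] val u) x
        = ∫ t, k t * (val u x - val u (x + -t)) := by
      simp_rw [mul_sub, ← sub_eq_add_neg]
      rw [integral_sub (hki.mul_const _) hex, integral_mul_const, hkdef, ρ.integral_normed, one_mul]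
      rfl
    rw [e]
    refine (enorm_integral_le_lintegral_enorm _).trans (lintegral_mono fun t => ?_)
    rw [enorm_mul, Real.enorm_of_nonneg (hk0 t), ← enorm_neg (val u x - _), neg_sub]
  have hmeas : AEStronglyMeasurable
      (fun q : Rn N × Rn N => val u (q.1 + -q.2) - val u q.1) (volume.prod volume) := by
    refine AEStronglyMeasurable.sub ?_ hum.comp_fst
    have hq := quasiMeasurePreserving_sub (volume : Measure (Rn N)) (volume : Measure (Rn N))
    simp_rw [← sub_eq_add_neg]
    exact hum.comp_quasiMeasurePreserving hq
  calc _ ≤ ∫⁻ x, ∫⁻ t, (ENNReal.ofReal (k t) * ‖val u (x + -t) - val u x‖ₑ) * ‖η x‖ₑ := by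
        refine lintegral_mono fun x => ?_
        rw [lintegral_mul_const' _ _ enorm_ne_top]
        exact mul_le_mul' (hpt x) le_rfl
    _ = ∫⁻ t, ∫⁻ x, (ENNReal.ofReal (k t) * ‖val u (x + -t) - val u x‖ₑ) * ‖η x‖ₑ := by
        refine lintegral_lintegral_swap ?_
        refine AEMeasurable.mul (AEMeasurable.mul ?_ hmeas.enorm) hη.1.enorm.comp_fst
        exact (hk.smooth.continuous.comp continuous_snd).measurable.ennreal_ofReal.aemeasurable
    _ ≤ ∫⁻ t, ENNReal.ofReal (k t) * (ENNReal.ofReal ρ.rOut * (‖u‖ₑ * eLpNorm η 2 volume)) := by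
        refine lintegral_mono fun t => ?_
        simp_rw [mul_assoc]
        rw [lintegral_const_mul' _ _ ENNReal.ofReal_ne_top]
        by_cases ht : k t = 0
        · simp [ht]
        refine mul_le_mul' le_rfl ?_
        have htb : ‖-t‖ₑ ≤ ENNReal.ofReal ρ.rOut := by
          rw [← ofReal_norm, norm_neg]
          refine ENNReal.ofReal_le_ofReal ?_
          have : t ∈ Function.support k := ht
          rw [hkdef, ρ.support_normed_eq] at this
          simpa using (mem_ball_zero_iff.1 this).le
        have htm : AEStronglyMeasurable (fun x => val u (x + -t) - val u x) volume :=
          (hum.comp_measurePreserving (measurePreserving_add_right volume (-t))).sub hum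
        calc _ ≤ eLpNorm (fun x => val u (x + -t) - val u x) 2 volume * eLpNorm η 2 volume :=
              lintegral_enorm_mul_le htm hη.1
          _ ≤ (‖-t‖ₑ * ‖u‖ₑ) * eLpNorm η 2 volume :=
              mul_le_mul' (eLpNorm_translate_sub_le u (-t)) le_rfl
          _ ≤ (ENNReal.ofReal ρ.rOut * ‖u‖ₑ) * eLpNorm η 2 volume :=
              mul_le_mul' (mul_le_mul' htb le_rfl) le_rfl
          _ = _ := mul_assoc _ _ _
    _ = _ := by
        rw [lintegral_mul_const _ hk.smooth.continuous.measurable.ennreal_ofReal, hk1, one_mul]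

/-- The functional `u ↦ ∫ u ψ` on `H¹`. -/
def pairing {N : ℕ} (ψ : Lp ℝ 2 (volume : Measure (Rn N))) : H1 N →L[ℝ] ℝ :=
  (innerSL ℝ ψ).comp ((WithLp.fstL 2 ℝ _ _).comp (H1 N).subtypeL)

theorem pairing_toLp_apply {N : ℕ} {ψ : Rn N → ℝ} (hψ : MemLp ψ 2 volume) (u : H1 N) :
    pairing (hψ.toLp ψ) u = ∫ x, val u x * ψ x :=
  (integral_mul_eq_inner u.1.fst hψ).symm

theorem eLpNorm_comp_sub_left {N : ℕ} (k : Rn N → ℝ) (x : Rn N) :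
    eLpNorm (fun t => k (x - t)) 2 volume = eLpNorm k 2 volume := by
  refine ENNReal.rpow_left_injective (x := 2) (by norm_num) ?_
  simp only [eLpNorm_two_sq]
  exact lintegral_sub_left_eq_self (fun t => ‖k t‖ₑ ^ (2 : ℝ)) x

/-- At a fixed point a mollification is a continuous linear functional of `u`, so weak convergence
in `H¹` becomes pointwise convergence of mollifications. -/
theorem convolution_eq_pairing {N : ℕ} {k : Rn N → ℝ} (hk : IsTest k) (u : H1 N) (x : Rn N) :
    (k ⋆[ContinuousLinearMap.lsmul ℝ ℝ, volume] val u) x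
      = pairing ((hk.comp_sub_left x).memLp.toLp _) u := by
  rw [pairing_toLp_apply, convolution_eq_swap]
  congr 1; ext t; simp [mul_comm]

theorem enorm_convolution_le {N : ℕ} {k : Rn N → ℝ} (hk : IsTest k) (u : H1 N) (x : Rn N) :
    ‖(k ⋆[ContinuousLinearMap.lsmul ℝ ℝ, volume] val u) x‖ₑ ≤ ‖u‖ₑ * eLpNorm k 2 volume := by
  rw [convolution_eq_pairing hk, pairing_toLp_apply]
  calc ‖∫ t, val u t * k (x - t)‖ₑ ≤ ∫⁻ t, ‖val u t * k (x - t)‖ₑ :=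
        enorm_integral_le_lintegral_enorm _
    _ = ∫⁻ t, ‖val u t‖ₑ * ‖k (x - t)‖ₑ := by simp_rw [enorm_mul]
    _ ≤ _ := lintegral_enorm_mul_le (memLp_val u).1 (hk.comp_sub_left x).memLp.1
    _ ≤ _ := mul_le_mul' (eLpNorm_val_le _) (eLpNorm_comp_sub_left k x).le

theorem tendsto_lintegral_mul_zero {N : ℕ} {F : ℕ → Rn N → ℝ} {η : Rn N → ℝ} {B : ℝ≥0∞}
    (hF : ∀ n, Continuous (F n)) (hB : B ≠ ⊤) (hFB : ∀ n x, ‖F n x‖ₑ ≤ B)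
    (hF0 : ∀ x, Tendsto (fun n => F n x) atTop (𝓝 0)) (hη : Integrable η volume) :
    Tendsto (fun n => ∫⁻ x, ‖F n x‖ₑ * ‖η x‖ₑ) atTop (𝓝 0) := by
  have := tendsto_lintegral_of_dominated_convergence' (μ := (volume : Measure (Rn N)))
    (F := fun n x => ‖F n x‖ₑ * ‖η x‖ₑ)
    (f := fun _ => 0) (fun x => B * ‖η x‖ₑ)
    (fun n => (hF n).enorm.measurable.aemeasurable.mul hη.1.enorm)
    (fun n => Eventually.of_forall fun x => mul_le_mul' (hFB n x) le_rfl)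
    (by rw [lintegral_const_mul' _ _ hB]; exact ENNReal.mul_ne_top hB hη.2.ne)
    (Eventually.of_forall fun x => by
      have h0 := (hF0 x).enorm
      rw [enorm_zero] at h0
      have := ENNReal.Tendsto.mul_const h0 (Or.inr (enorm_ne_top (x := η x)))
      rwa [zero_mul] at this)
  simpa using this

/-- Mollify at a small scale. The error is controlled by the scale uniformly in `n`, by the
translation estimate; the mollified sequence is uniformly bounded and tends to zero pointwise, so
dominated convergence applies against the integrable weight `η`. -/
theorem rellich_of_continuous {N : ℕ} {w : ℕ → H1 N} {M : ℝ≥0} (hM : ∀ n, ‖w n‖ ≤ M)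
    (hw : WeakTo w 0) {η : Rn N → ℝ} (hη : Continuous η) (hηc : HasCompactSupport η) :
    Tendsto (fun n => ∫⁻ x, ‖val (w n) x‖ₑ * ‖η x‖ₑ) atTop (𝓝 0) := by
  have hη2 : MemLp η 2 (volume : Measure (Rn N)) := hη.memLp_of_hasCompactSupport hηc
  have hMe : ∀ n, ‖w n‖ₑ ≤ M := fun n => by
    rw [← ofReal_norm, ← ENNReal.ofReal_coe_nnreal]
    exact ENNReal.ofReal_le_ofReal (hM n)
  refine tendsto_zero_of_le_add fun ε hε => ?_
  have hA : (M : ℝ≥0∞) * eLpNorm η 2 volume ≠ ⊤ :=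
    ENNReal.mul_ne_top ENNReal.coe_ne_top hη2.eLpNorm_ne_top
  obtain ⟨ρ, hρ⟩ : ∃ ρ : ContDiffBump (0 : Rn N),
      ENNReal.ofReal ρ.rOut * (M * eLpNorm η 2 volume) ≤ ε := by
    have hl : Tendsto (fun n : ℕ => ENNReal.ofReal (shrinkingBump N n).rOut *
        (M * eLpNorm η 2 volume)) atTop (𝓝 (ENNReal.ofReal 0 * (M * eLpNorm η 2 volume))) := by
      refine ENNReal.Tendsto.mul_const ?_ (Or.inr hA)
      refine ENNReal.tendsto_ofReal ?_
      have : Tendsto (fun n : ℕ => (2 : ℝ) * (1 / ((n : ℝ) + 1))) atTop (𝓝 (2 * 0)) :=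
        tendsto_one_div_add_atTop_nhds_zero_nat.const_mul 2
      simpa [shrinkingBump, div_eq_mul_inv] using this
    rw [ENNReal.ofReal_zero, zero_mul] at hl
    obtain ⟨n, hn⟩ := ((ENNReal.tendsto_nhds_zero.1 hl) ε hε).exists
    exact ⟨_, hn⟩
  have hk := isTest_normed ρ
  set k := ρ.normed (volume : Measure (Rn N)) with hkdef
  have hcm : ∀ n, Continuous (k ⋆[ContinuousLinearMap.lsmul ℝ ℝ, volume] val (w n)) := fun n =>
    (hk.compact.contDiff_convolution_left (n := 0) _ (hk.smooth.of_le (by simp))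
      ((memLp_val _).locallyIntegrable (by norm_num))).continuous
  refine ⟨fun n => ∫⁻ x, ‖(k ⋆[ContinuousLinearMap.lsmul ℝ ℝ, volume] val (w n)) x‖ₑ * ‖η x‖ₑ,
    ?_, fun n => ?_⟩
  · refine tendsto_lintegral_mul_zero hcm
      (ENNReal.mul_ne_top ENNReal.coe_ne_top hk.memLp.eLpNorm_ne_top)
      (fun n x => (enorm_convolution_le hk (w n) x).trans (mul_le_mul' (hMe n) le_rfl))
      (fun x => ?_) (hη.integrable_of_hasCompactSupport hηc)
    simp_rw [convolution_eq_pairing hk]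
    have h0 := hw (pairing ((hk.comp_sub_left x).memLp.toLp _))
    rwa [map_zero] at h0
  · calc ∫⁻ x, ‖val (w n) x‖ₑ * ‖η x‖ₑ
        ≤ ∫⁻ x, (‖val (w n) x - (k ⋆[ContinuousLinearMap.lsmul ℝ ℝ, volume] val (w n)) x‖ₑ * ‖η x‖ₑ
          + ‖(k ⋆[ContinuousLinearMap.lsmul ℝ ℝ, volume] val (w n)) x‖ₑ * ‖η x‖ₑ) := by
          refine lintegral_mono fun x => ?_
          rw [← add_mul]
          refine mul_le_mul' ?_ le_rfl
          refine le_trans (le_of_eq ?_) (enorm_add_le _ _)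
          rw [sub_add_cancel]
      _ = (∫⁻ x, ‖val (w n) x - (k ⋆[ContinuousLinearMap.lsmul ℝ ℝ, volume] val (w n)) x‖ₑ * ‖η x‖ₑ)
          + ∫⁻ x, ‖(k ⋆[ContinuousLinearMap.lsmul ℝ ℝ, volume] val (w n)) x‖ₑ * ‖η x‖ₑ :=
          lintegral_add_right _ ((hcm n).enorm.measurable.mul hη.enorm.measurable)
      _ ≤ ε + _ := by
          refine add_le_add ((lintegral_sub_convolution_le ρ (w n) hη2).trans ?_) le_rfl
          exact le_trans (mul_le_mul' le_rfl (mul_le_mul' (hMe n) le_rfl)) hρ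

/-- Rellich's theorem: weak convergence in `H¹` implies local convergence, here tested against an
arbitrary `L²` weight. -/
theorem rellich {N : ℕ} {w : ℕ → H1 N} {M : ℝ≥0} (hM : ∀ n, ‖w n‖ ≤ M)
    (hw : WeakTo w 0) {η : Rn N → ℝ} (hη : MemLp η 2 volume) :
    Tendsto (fun n => ∫⁻ x, ‖val (w n) x‖ₑ * ‖η x‖ₑ) atTop (𝓝 0) := by
  have hMe : ∀ n, ‖w n‖ₑ ≤ M := fun n => by
    rw [← ofReal_norm, ← ENNReal.ofReal_coe_nnreal]
    exact ENNReal.ofReal_le_ofReal (hM n)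
  refine tendsto_zero_of_le_add fun ε hε => ?_
  -- If `M = 0` the quotient `ε / M` is `⊤`, and `M * δ = 0` still meets the bound.
  obtain ⟨δ, hδ, hδε⟩ : ∃ δ : ℝ≥0∞, δ ≠ 0 ∧ M * δ ≤ ε := by
    refine ⟨ε / M, ?_, ENNReal.mul_div_le⟩
    exact (ENNReal.div_pos hε.ne' ENNReal.coe_ne_top).ne'
  obtain ⟨g, hgc, hgd, hg, hg2⟩ := hη.exists_hasCompactSupport_eLpNorm_sub_le (by norm_num) hδ
  refine ⟨_, rellich_of_continuous hM hw hg hgc, fun n => ?_⟩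
  calc ∫⁻ x, ‖val (w n) x‖ₑ * ‖η x‖ₑ
      ≤ ∫⁻ x, (‖val (w n) x‖ₑ * ‖(η - g) x‖ₑ + ‖val (w n) x‖ₑ * ‖g x‖ₑ) := by
        refine lintegral_mono fun x => ?_
        rw [← mul_add]
        refine mul_le_mul' le_rfl ?_
        refine le_trans (le_of_eq ?_) (enorm_add_le _ _)
        simp
    _ = (∫⁻ x, ‖val (w n) x‖ₑ * ‖(η - g) x‖ₑ) + ∫⁻ x, ‖val (w n) x‖ₑ * ‖g x‖ₑ :=
        lintegral_add_right' _ ((memLp_val _).1.enorm.mul hg2.1.enorm)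
    _ ≤ ε + _ := by
        refine add_le_add ?_ le_rfl
        refine (lintegral_enorm_mul_le (memLp_val _).1 (hη.sub hg2).1).trans ?_
        exact le_trans (mul_le_mul' ((eLpNorm_val_le _).trans (hMe n)) hgd) hδε

end HamSys
end

/-! ### Pointwise structure of the nonlinearity: the key inequality and growth at zero and infinity.
-/

noncomputable section

namespace HamSys

/-- The lattice vector with integer coordinates `k`. -/
def intVec {N : ℕ} (k : Fin N → ℤ) : Rn N := WithLp.toLp 2 fun i => (k i : ℝ)

theorem intVec_eq_sum {N : ℕ} (k : Fin N → ℤ) : intVec k = ∑ i, k i • unitVec i := by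
  ext j
  simp [intVec, Pi.single_apply]

theorem Periodic1.add_intVec {N : ℕ} {α : Type*} {f : Rn N → α} (hf : Periodic1 f)
    (k : Fin N → ℤ) (x : Rn N) : f (x + intVec k) = f x := by
  have : ∀ s : Finset (Fin N), Function.Periodic f (∑ i ∈ s, k i • unitVec i) := by
    intro s
    induction s using Finset.induction_on with
    | empty => simp [Function.Periodic]
    | insert i s hi ih =>
      rw [Finset.sum_insert hi]
      exact Function.Periodic.add_period (Function.Periodic.zsmul (fun x => hf i x) (k i)) ih
  rw [intVec_eq_sum]
  exact this _ x

/-- Subtract integer parts coordinatewise. The radius `N` is crude, but all that matters is a fixed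
compact set containing a fundamental domain. -/
theorem exists_intVec_norm_le {N : ℕ} (x : Rn N) : ∃ k : Fin N → ℤ, ‖x + intVec k‖ ≤ N := by
  refine ⟨fun i => -⌊x i⌋, ?_⟩
  have h1 : ∀ i, ‖(x + intVec fun i => -⌊x i⌋) i‖ ≤ 1 := by
    intro i
    have : (x + intVec fun i => -⌊x i⌋) i = Int.fract (x i) := by
      simp [intVec, ← sub_eq_add_neg]
    rw [this, Real.norm_of_nonneg (Int.fract_nonneg _)]
    exact (Int.fract_lt_one _).le
  have h2 : x + intVec (fun i => -⌊x i⌋)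
      = ∑ i, (x + intVec fun i => -⌊x i⌋) i • unitVec i := by
    ext j; simp [Pi.single_apply]
  rw [h2]
  refine (norm_sum_le _ _).trans ?_
  calc _ ≤ ∑ _i : Fin N, (1 : ℝ) := by
        refine Finset.sum_le_sum fun i _ => ?_
        rw [norm_smul]; simpa using h1 i
    _ = N := by simp

theorem Periodic1.exists_norm_le {N : ℕ} {α : Type*} {f : Rn N → α} (hf : Periodic1 f) (x : Rn N) :
    ∃ y : Rn N, ‖y‖ ≤ N ∧ f y = f x := by
  obtain ⟨k, hk⟩ := exists_intVec_norm_le x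
  exact ⟨_, hk, hf.add_intVec k x⟩

/-- Pointwise hypotheses on a nonlinearity `W` with gradient `(fu, fv)`. -/
structure IsNonlin {N : ℕ} (W fu fv : Rn N → ℝ → ℝ → ℝ) : Prop where
  cont : Continuous fun q : Rn N × ℝ × ℝ => W q.1 q.2.1 q.2.2
  cont_fu : Continuous fun q : Rn N × ℝ × ℝ => fu q.1 q.2.1 q.2.2
  cont_fv : Continuous fun q : Rn N × ℝ × ℝ => fv q.1 q.2.1 q.2.2
  per : Periodic1 W
  per_fu : Periodic1 fu
  per_fv : Periodic1 fv
  nonneg : ∀ x u v, 0 ≤ W x u v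
  zero : ∀ x, W x 0 0 = 0
  key : ∀ x u v u' v' t, 0 ≤ W x u' v' - W x u v
    + (1 + t ^ 2) / 2 * (fu x u v * u + fv x u v * v) - t * (fu x u v * u' + fv x u v * v')
  small : ∀ ε > 0, ∃ δ > 0, ∀ x u v, |u| + |v| ≤ δ → |fu x u v| + |fv x u v| ≤ ε * (|u| + |v|)
  large : ∀ ε > 0, ∃ R > 0, ∀ x u v, R ≤ |u| + |v| →
    |fu x u v| + |fv x u v| ≤ ε * (|u| + |v|) ^ (sStar N - 1)

theorem IsNonlin.zero' {N : ℕ} : IsNonlin (N := N) (fun _ _ _ => 0) (fun _ _ _ => 0)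
    (fun _ _ _ => 0) where
  cont := continuous_const
  cont_fu := continuous_const
  cont_fv := continuous_const
  per := fun _ _ => rfl
  per_fu := fun _ _ => rfl
  per_fv := fun _ _ => rfl
  nonneg := fun _ _ _ => le_rfl
  zero := fun _ => rfl
  key := by intros; simp
  small := fun ε hε => ⟨1, one_pos, fun x u v _ => by simp; positivity⟩
  large := fun ε hε => ⟨1, one_pos, fun x u v _ => by simp; positivity⟩

/-- Every clause is additive in `(W, fu, fv)`; therefore it suffices to verify the hypotheses for a
single term of the sum. -/
theorem IsNonlin.add {N : ℕ} {W fu fv W' fu' fv' : Rn N → ℝ → ℝ → ℝ} (h : IsNonlin W fu fv)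
    (h' : IsNonlin W' fu' fv') : IsNonlin (fun x u v => W x u v + W' x u v)
      (fun x u v => fu x u v + fu' x u v) (fun x u v => fv x u v + fv' x u v) where
  cont := h.cont.add h'.cont
  cont_fu := h.cont_fu.add h'.cont_fu
  cont_fv := h.cont_fv.add h'.cont_fv
  per := fun i x => by ext u v; simp only [h.per i x, h'.per i x]
  per_fu := fun i x => by ext u v; simp only [h.per_fu i x, h'.per_fu i x]
  per_fv := fun i x => by ext u v; simp only [h.per_fv i x, h'.per_fv i x]
  nonneg := fun x u v => add_nonneg (h.nonneg x u v) (h'.nonneg x u v)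
  zero := fun x => by rw [h.zero, h'.zero, add_zero]
  key := fun x u v u' v' t => by
    have h1 := h.key x u v u' v' t
    have h2 := h'.key x u v u' v' t
    calc (0 : ℝ) ≤ _ := add_nonneg h1 h2
      _ = _ := by ring
  small := fun ε hε => by
    obtain ⟨δ, hδ, H⟩ := h.small (ε / 2) (half_pos hε)
    obtain ⟨δ', hδ', H'⟩ := h'.small (ε / 2) (half_pos hε)
    refine ⟨min δ δ', lt_min hδ hδ', fun x u v hr => ?_⟩
    have h1 := H x u v (hr.trans (min_le_left _ _))
    have h2 := H' x u v (hr.trans (min_le_right _ _))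
    linarith [abs_add_le (fu x u v) (fu' x u v), abs_add_le (fv x u v) (fv' x u v)]
  large := fun ε hε => by
    obtain ⟨δ, hδ, H⟩ := h.large (ε / 2) (half_pos hε)
    obtain ⟨δ', hδ', H'⟩ := h'.large (ε / 2) (half_pos hε)
    refine ⟨max δ δ', lt_max_of_lt_left hδ, fun x u v hr => ?_⟩
    have h1 := H x u v ((le_max_left _ _).trans hr)
    have h2 := H' x u v ((le_max_right _ _).trans hr)
    linarith [abs_add_le (fu x u v) (fu' x u v), abs_add_le (fv x u v) (fv' x u v)]

theorem IsNonlin.sum {N : ℕ} {ι : Type*} (s : Finset ι) {W fu fv : ι → Rn N → ℝ → ℝ → ℝ}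
    (h : ∀ i, IsNonlin (W i) (fu i) (fv i)) :
    IsNonlin (fun x u v => ∑ i ∈ s, W i x u v) (fun x u v => ∑ i ∈ s, fu i x u v)
      (fun x u v => ∑ i ∈ s, fv i x u v) := by
  classical
  induction s using Finset.induction_on with
  | empty => simpa using IsNonlin.zero'
  | insert i s hi ih =>
    simp_rw [Finset.sum_insert hi]
    exact (h i).add ih

section Term

variable {N : ℕ} {g : Rn N → ℝ → ℝ}

/-- Only `t ≥ 0` is meaningful for the class; precomposition with `max · 0` gives a function
continuous on the whole space that can be fed to compactness arguments. -/
theorem ClassND.continuous_ext (hg : ClassND g) :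
    Continuous fun q : Rn N × ℝ => g q.1 (max q.2 0) :=
  hg.cont.comp_continuous (continuous_fst.prodMk (continuous_snd.max continuous_const))
    (fun _ => ⟨trivial, Set.mem_Ici.2 (le_max_right _ _)⟩)

theorem ClassND.periodic_ext (hg : ClassND g) : Periodic1 fun x t => g x (max t 0) := by
  intro i x
  ext t
  exact hg.periodic (max t 0) (le_max_right _ _) i x

/-- Periodicity reduces uniformity in `x` to uniform continuity on a compact set, where `g(x,0) =
0`. -/
theorem ClassND.small (hg : ClassND g) {ε : ℝ} (hε : 0 < ε) :
    ∃ δ > 0, ∀ x t, 0 ≤ t → t ≤ δ → g x t ≤ ε := by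
  have hK : IsCompact (Metric.closedBall (0 : Rn N) N ×ˢ Set.Icc (0 : ℝ) 1) :=
    (isCompact_closedBall _ _).prod isCompact_Icc
  have huc := hK.uniformContinuousOn_of_continuous hg.continuous_ext.continuousOn
  rw [Metric.uniformContinuousOn_iff] at huc
  obtain ⟨δ, hδ, H⟩ := huc ε hε
  refine ⟨min (δ / 2) 1, by positivity, fun x t ht htδ => ?_⟩
  obtain ⟨y, hy, hyx⟩ := hg.periodic_ext.exists_norm_le x
  have e := congrFun hyx t
  simp only [max_eq_left ht] at e
  rw [← e]
  have hy' : y ∈ Metric.closedBall (0 : Rn N) N := by simpa using hy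
  have := H (y, t) ⟨hy', ht, htδ.trans (min_le_right _ _)⟩ (y, 0) ⟨hy', le_rfl, zero_le_one⟩ (by
    rw [Prod.dist_eq]
    simp only [dist_self, Real.dist_eq, sub_zero, abs_of_nonneg ht]
    rw [max_eq_right ht]
    linarith [min_le_left (δ / 2) 1])
  simp only [max_eq_left ht, max_self, hg.zero, Real.dist_eq, sub_zero] at this
  exact (le_abs_self _).trans this.le

/-- The primitive inequality `G(ρ') - G(ρ) ≥ g(ρ)(ρ'² - ρ²)/2`. -/
theorem ClassND.primitive_sub_ge (hg : ClassND g) (x : Rn N) {ρ ρ' : ℝ} (h : 0 ≤ ρ) (h' : 0 ≤ ρ') :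
    g x ρ * (ρ' ^ 2 - ρ ^ 2) / 2
      ≤ (∫ s in (0 : ℝ)..ρ', g x s * s) - ∫ s in (0 : ℝ)..ρ, g x s * s := by
  have hcx : ContinuousOn (fun s => g x s * s) (Set.Ici 0) := by
    refine ContinuousOn.mul ?_ continuousOn_id
    exact hg.cont.comp (continuousOn_const.prodMk continuousOn_id) (fun s hs => ⟨trivial, hs⟩)
  have hintg : ∀ c d : ℝ, 0 ≤ c → 0 ≤ d →
      IntervalIntegrable (fun s => g x s * s) volume c d := by
    intro c d hc hd
    refine (hcx.mono fun s hs => ?_).intervalIntegrable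
    exact (le_min hc hd).trans hs.1
  have hconst : ∀ c d : ℝ, IntervalIntegrable (fun s => g x ρ * s) volume c d := fun c d =>
    (continuous_const.mul continuous_id).intervalIntegrable _ _
  rw [intervalIntegral.integral_interval_sub_left (hintg _ _ le_rfl h') (hintg _ _ le_rfl h)]
  have e : g x ρ * (ρ' ^ 2 - ρ ^ 2) / 2 = ∫ s in ρ..ρ', g x ρ * s := by
    rw [intervalIntegral.integral_const_mul, integral_id]; ring
  rw [e]
  rcases le_total ρ ρ' with hle | hle
  · refine intervalIntegral.integral_mono_on hle (hconst _ _) (hintg _ _ h h') fun s hs => ?_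
    have hs0 : 0 ≤ s := h.trans hs.1
    exact mul_le_mul_of_nonneg_right (hg.mono x h hs0 hs.1) hs0
  · rw [intervalIntegral.integral_symm ρ' ρ, intervalIntegral.integral_symm ρ' ρ, neg_le_neg_iff]
    refine intervalIntegral.integral_mono_on hle (hintg _ _ h' h) (hconst _ _) fun s hs => ?_
    have hs0 : 0 ≤ s := h'.trans hs.1
    exact mul_le_mul_of_nonneg_right (hg.mono x hs0 h hs.2) hs0

/-- The radius `√((pu + rv)² + (sv)²)`. -/
def rad (p r s u v : ℝ) : ℝ := √((p * u + r * v) ^ 2 + (s * v) ^ 2)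

theorem continuous_rad (p r s : ℝ) : Continuous fun q : ℝ × ℝ => rad p r s q.1 q.2 := by
  unfold rad; fun_prop

theorem rad_nonneg (p r s u v : ℝ) : 0 ≤ rad p r s u v := Real.sqrt_nonneg _

theorem rad_sq (p r s u v : ℝ) : rad p r s u v ^ 2 = (p * u + r * v) ^ 2 + (s * v) ^ 2 :=
  Real.sq_sqrt (by positivity)

theorem abs_lin_le (p r s u v : ℝ) :
    |p * u + r * v| + |s * v| ≤ (|p| + |r| + |s|) * (|u| + |v|) := by
  have h1 := abs_add_le (p * u) (r * v)
  rw [abs_mul, abs_mul] at h1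
  rw [abs_mul]
  nlinarith [abs_nonneg p, abs_nonneg r, abs_nonneg s, abs_nonneg u, abs_nonneg v,
    mul_nonneg (abs_nonneg p) (abs_nonneg v), mul_nonneg (abs_nonneg r) (abs_nonneg u),
    mul_nonneg (abs_nonneg s) (abs_nonneg u)]

theorem rad_le (p r s u v : ℝ) : rad p r s u v ≤ (|p| + |r| + |s|) * (|u| + |v|) := by
  refine le_trans ?_ (abs_lin_le p r s u v)
  refine Real.sqrt_le_iff.2 ⟨by positivity, ?_⟩
  have := mul_nonneg (abs_nonneg (p * u + r * v)) (abs_nonneg (s * v))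
  nlinarith [sq_abs (p * u + r * v), sq_abs (s * v)]

/-- Both kinds of terms are functions of `|Lz|` with `L z = (pu + rv, sv)`: `s = 0` gives `|αu +
βv|`, and the positive definite quadratic forms arise by completing the square. The gradient of such
a term is `g(x,|Lz|) LᵀLz`. -/
theorem ClassND.isNonlin (hN : 3 ≤ N) (hg : ClassND g) (p r s : ℝ) :
    IsNonlin (fun x u v => ∫ t in (0 : ℝ)..rad p r s u v, g x t * t)
      (fun x u v => g x (rad p r s u v) * ((p * u + r * v) * p))
      (fun x u v => g x (rad p r s u v) * ((p * u + r * v) * r + s * v * s)) := by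
  have hext : ∀ x ρ, 0 ≤ ρ → ∫ t in (0 : ℝ)..ρ, g x t * t = ∫ t in (0 : ℝ)..ρ, g x (max t 0) * t := by
    intro x ρ hρ
    refine intervalIntegral.integral_congr fun t ht => ?_
    rw [Set.uIcc_of_le hρ] at ht
    simp only [max_eq_left ht.1]
  have hgc : Continuous fun q : Rn N × ℝ × ℝ => g q.1 (rad p r s q.2.1 q.2.2) := by
    have := hg.continuous_ext.comp (continuous_fst.prodMk ((continuous_rad p r s).comp
      continuous_snd) : Continuous fun q : Rn N × ℝ × ℝ => (q.1, rad p r s q.2.1 q.2.2))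
    refine this.congr fun q => ?_
    simp only [Function.comp, max_eq_left (rad_nonneg _ _ _ _ _)]
  have hper : ∀ i x t, 0 ≤ t → g (x + unitVec i) t = g x t := fun i x t ht => hg.periodic t ht i x
  set K := |p| + |r| + |s| with hK
  have hK0 : 0 ≤ K := by positivity
  have hfb : ∀ x u v, |g x (rad p r s u v) * ((p * u + r * v) * p)|
      + |g x (rad p r s u v) * ((p * u + r * v) * r + s * v * s)|
      ≤ g x (rad p r s u v) * (K ^ 2 * (|u| + |v|)) := by
    intro x u v
    have hg0 := hg.nonneg x _ (rad_nonneg p r s u v)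
    rw [abs_mul (g x _), abs_mul (g x _), abs_of_nonneg hg0, ← mul_add]
    refine mul_le_mul_of_nonneg_left ?_ hg0
    have h1 := abs_lin_le p r s u v
    have h2 := abs_add_le ((p * u + r * v) * r) (s * v * s)
    rw [abs_mul (p * u + r * v) r, abs_mul (s * v) s] at h2
    rw [abs_mul (p * u + r * v) p]
    have h3 : (|p * u + r * v| + |s * v|) * K ≤ K * (|u| + |v|) * K :=
      mul_le_mul_of_nonneg_right h1 hK0
    have h4 : |p * u + r * v| * |p| + (|p * u + r * v| * |r| + |s * v| * |s|)
        ≤ (|p * u + r * v| + |s * v|) * K := by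
      rw [hK]
      nlinarith [mul_nonneg (abs_nonneg (p * u + r * v)) (abs_nonneg s),
        mul_nonneg (abs_nonneg (s * v)) (abs_nonneg p),
        mul_nonneg (abs_nonneg (s * v)) (abs_nonneg r)]
    nlinarith
  refine ⟨?_, ?_, ?_, ?_, ?_, ?_, ?_, ?_, ?_, ?_, ?_⟩
  · simp_rw [fun x u v => hext x _ (rad_nonneg p r s u v)]
    refine intervalIntegral.continuous_parametric_intervalIntegral_of_continuous
      (f := fun (q : Rn N × ℝ × ℝ) t => g q.1 (max t 0) * t) ?_
      ((continuous_rad p r s).comp continuous_snd)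
    refine Continuous.mul ?_ continuous_snd
    exact hg.continuous_ext.comp ((continuous_fst.comp continuous_fst).prodMk continuous_snd)
  · exact hgc.mul (by fun_prop)
  · exact hgc.mul (by fun_prop)
  · intro i x
    ext u v
    refine intervalIntegral.integral_congr fun t ht => ?_
    rw [Set.uIcc_of_le (rad_nonneg p r s u v)] at ht
    simp only [hper i x t ht.1]
  · intro i x
    ext u v
    simp only [hper i x _ (rad_nonneg p r s u v)]
  · intro i x
    ext u v
    simp only [hper i x _ (rad_nonneg p r s u v)]
  · intro x u v
    refine intervalIntegral.integral_nonneg (rad_nonneg p r s u v) fun t ht => ?_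
    exact mul_nonneg (hg.nonneg x t ht.1) ht.1
  · intro x
    simp [rad]
  · intro x u v u' v' t
    have h1 := hg.primitive_sub_ge x (rad_nonneg p r s u v) (rad_nonneg p r s u' v')
    have hg0 := hg.nonneg x _ (rad_nonneg p r s u v)
    rw [rad_sq, rad_sq] at h1
    -- After the primitive inequality, what is left of the key inequality is the square `½ g(ρ)|Lz'
    -- - tLz|²`.
    have h2 : 0 ≤ g x (rad p r s u v) *
        (((p * u' + r * v') - t * (p * u + r * v)) ^ 2 + (s * v' - t * (s * v)) ^ 2) :=
      mul_nonneg hg0 (by positivity)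
    nlinarith
  · intro ε hε
    obtain ⟨δ, hδ, H⟩ := hg.small (ε := ε / (K ^ 2 + 1)) (by positivity)
    refine ⟨δ / (K + 1), by positivity, fun x u v hr => (hfb x u v).trans ?_⟩
    have h1 : rad p r s u v ≤ δ := by
      refine (rad_le p r s u v).trans ?_
      calc K * (|u| + |v|) ≤ (K + 1) * (δ / (K + 1)) := by gcongr; linarith
        _ = δ := by field_simp
    have h2 := H x _ (rad_nonneg p r s u v) h1
    calc _ ≤ ε / (K ^ 2 + 1) * (K ^ 2 * (|u| + |v|)) := by gcongr
      _ = ε * (|u| + |v|) * (K ^ 2 / (K ^ 2 + 1)) := by ring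
      _ ≤ ε * (|u| + |v|) * 1 := by
        gcongr
        rw [div_le_one (by positivity)]; linarith
      _ = _ := mul_one _
  · intro ε hε
    obtain ⟨m, C, hm2, hm, hC, H⟩ := hg.growth
    have hs := two_lt_sStar hN
    have hm' : m < sStar N := hm
    -- Dividing the growth bound by `ρ^(2*-1)` leaves two negative powers of `ρ`, because `m < 2*`
    -- and `2 < 2*`.
    have hl1 : Tendsto (fun ρ : ℝ => C * K ^ 2 * (ρ ^ (-(sStar N - 2))
        + K ^ (m - 2) * ρ ^ (-(sStar N - m)))) atTop (𝓝 (C * K ^ 2 * (0 + K ^ (m - 2) * 0))) :=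
      ((tendsto_rpow_neg_atTop (by linarith)).add
        ((tendsto_rpow_neg_atTop (by linarith)).const_mul _)).const_mul _
    rw [mul_zero, add_zero, mul_zero] at hl1
    obtain ⟨R, hR⟩ := eventually_atTop.1 ((hl1.eventually (gt_mem_nhds hε)).and
      (eventually_ge_atTop 1))
    refine ⟨max R 1, by positivity, fun x u v hr => (hfb x u v).trans ?_⟩
    set ρ := |u| + |v| with hρ
    obtain ⟨h1, -⟩ := hR ρ ((le_max_left _ _).trans hr)
    have hρ0 : 0 < ρ := lt_of_lt_of_le one_pos ((le_max_right _ _).trans hr)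
    have h2 : g x (rad p r s u v) ≤ C * (1 + (K * ρ) ^ (m - 2)) := by
      refine (le_abs_self _).trans ((H x _ (rad_nonneg p r s u v)).trans ?_)
      gcongr
      · exact rad_nonneg p r s u v
      · exact rad_le p r s u v
    rw [Real.mul_rpow hK0 hρ0.le] at h2
    have e1 : ρ = ρ ^ (-(sStar N - 2)) * ρ ^ (sStar N - 1) := by
      rw [← Real.rpow_add hρ0]
      conv_lhs => rw [← Real.rpow_one ρ]
      congr 1; ring
    have e2 : ρ ^ (m - 2) * ρ = ρ ^ (-(sStar N - m)) * ρ ^ (sStar N - 1) := by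
      rw [← Real.rpow_add hρ0, ← Real.rpow_add_one hρ0.ne']
      congr 1; ring
    calc _ ≤ C * (1 + K ^ (m - 2) * ρ ^ (m - 2)) * (K ^ 2 * ρ) := by gcongr
      _ = C * K ^ 2 * (ρ + K ^ (m - 2) * (ρ ^ (m - 2) * ρ)) := by ring
      _ = C * K ^ 2 * (ρ ^ (-(sStar N - 2)) * ρ ^ (sStar N - 1)
            + K ^ (m - 2) * (ρ ^ (-(sStar N - m)) * ρ ^ (sStar N - 1))) := by rw [e2, ← e1]
      _ = C * K ^ 2 * (ρ ^ (-(sStar N - 2)) + K ^ (m - 2) * ρ ^ (-(sStar N - m)))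
            * ρ ^ (sStar N - 1) := by ring
      _ ≤ ε * ρ ^ (sStar N - 1) := by gcongr

end Term

end HamSys
end

/-! ### Convexity, differentiability and moduli of continuity derived from the pointwise hypotheses.
-/

noncomputable section

namespace HamSys

namespace IsNonlin

variable {N : ℕ} {W fu fv : Rn N → ℝ → ℝ → ℝ}

/-- The key inequality with `t = 0` against the origin. -/
theorem le_half (h : IsNonlin W fu fv) (x : Rn N) (u v : ℝ) :
    W x u v ≤ 1 / 2 * (fu x u v * u + fv x u v * v) := by
  have := h.key x u v 0 0 0
  rw [h.zero] at this
  linarith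

/-- The key inequality with `t = 1` is the gradient inequality of a convex function. -/
theorem convex (h : IsNonlin W fu fv) (x : Rn N) (u v u' v' : ℝ) :
    W x u v + (fu x u v * (u' - u) + fv x u v * (v' - v)) ≤ W x u' v' := by
  have := h.key x u v u' v' 1
  linarith

/-- Convexity at both endpoints traps the first-order remainder between `0` and `(fu(s) - fu(u))(s -
u)`, which is `o(s - u)` by continuity of `fu`. No derivative of the defining integrals is computed.
-/
theorem hasDerivAt_fst (h : IsNonlin W fu fv) (x : Rn N) (u v : ℝ) :
    HasDerivAt (fun s => W x s v) (fu x u v) u := by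
  rw [hasDerivAt_iff_isLittleO]
  have hc : Continuous fun s => fu x s v :=
    h.cont_fu.comp (by fun_prop : Continuous fun s : ℝ => (x, s, v))
  have h1 : (fun s => (fu x s v - fu x u v) * (s - u)) =o[𝓝 u] fun s => s - u := by
    have := (Asymptotics.isLittleO_one_iff ℝ).2
      (show Tendsto (fun s => fu x s v - fu x u v) (𝓝 u) (𝓝 0) by
        have := (hc.tendsto u).sub_const (fu x u v)
        rwa [sub_self] at this)
    simpa using this.mul_isBigO (Asymptotics.isBigO_refl (fun s => s - u) (𝓝 u))
  refine (Asymptotics.IsBigO.of_bound 1 (Eventually.of_forall fun s => ?_)).trans_isLittleO h1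
  have e1 := h.convex x u v s v
  have e2 := h.convex x s v u v
  rw [one_mul, Real.norm_eq_abs, Real.norm_eq_abs, smul_eq_mul, abs_of_nonneg (by linarith),
    abs_of_nonneg (by linarith)]
  linarith

theorem hasDerivAt_snd (h : IsNonlin W fu fv) (x : Rn N) (u v : ℝ) :
    HasDerivAt (fun s => W x u s) (fv x u v) v := by
  rw [hasDerivAt_iff_isLittleO]
  have hc : Continuous fun s => fv x u s :=
    h.cont_fv.comp (by fun_prop : Continuous fun s : ℝ => (x, u, s))
  have h1 : (fun s => (fv x u s - fv x u v) * (s - v)) =o[𝓝 v] fun s => s - v := by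
    have := (Asymptotics.isLittleO_one_iff ℝ).2
      (show Tendsto (fun s => fv x u s - fv x u v) (𝓝 v) (𝓝 0) by
        have := (hc.tendsto v).sub_const (fv x u v)
        rwa [sub_self] at this)
    simpa using this.mul_isBigO (Asymptotics.isBigO_refl (fun s => s - v) (𝓝 v))
  refine (Asymptotics.IsBigO.of_bound 1 (Eventually.of_forall fun s => ?_)).trans_isLittleO h1
  have e1 := h.convex x u v u s
  have e2 := h.convex x u s u v
  rw [one_mul, Real.norm_eq_abs, Real.norm_eq_abs, smul_eq_mul, abs_of_nonneg (by linarith),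
    abs_of_nonneg (by linarith)]
  linarith

/-- By periodicity `x` may be taken in a compact ball. -/
theorem bounded (h : IsNonlin W fu fv) (R : ℝ) :
    ∃ B ≥ 0, ∀ x u v, |u| + |v| ≤ R → |fu x u v| + |fv x u v| ≤ B := by
  have hK : IsCompact (Metric.closedBall (0 : Rn N) N ×ˢ Set.Icc (-R) R ×ˢ Set.Icc (-R) R) :=
    (isCompact_closedBall _ _).prod (isCompact_Icc.prod isCompact_Icc)
  have hc : Continuous fun q : Rn N × ℝ × ℝ => |fu q.1 q.2.1 q.2.2| + |fv q.1 q.2.1 q.2.2| :=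
    h.cont_fu.abs.add h.cont_fv.abs
  obtain ⟨B, hB⟩ := hK.bddAbove_image hc.continuousOn
  refine ⟨max B 0, le_max_right _ _, fun x u v hr => ?_⟩
  have hper : Periodic1 fun x => (fu x, fv x) := fun i x => by
    simp only [h.per_fu i x, h.per_fv i x]
  obtain ⟨y, hy, hyx⟩ := hper.exists_norm_le x
  simp only [Prod.mk.injEq] at hyx
  rw [← hyx.1, ← hyx.2]
  refine le_trans (hB ⟨(y, u, v), ⟨by simpa using hy, ?_, ?_⟩, rfl⟩) (le_max_left _ _)
  · exact abs_le.1 (by linarith [abs_nonneg v])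
  · exact abs_le.1 (by linarith [abs_nonneg u])

theorem uniformly_close (h : IsNonlin W fu fv) (R : ℝ) {ε : ℝ} (hε : 0 < ε) :
    ∃ δ > 0, ∀ x u v u' v', |u| + |v| ≤ R → |u'| + |v'| ≤ R → |u - u'| + |v - v'| < δ →
      |fu x u v - fu x u' v'| + |fv x u v - fv x u' v'| ≤ ε := by
  have hK : IsCompact (Metric.closedBall (0 : Rn N) N ×ˢ Set.Icc (-R) R ×ˢ Set.Icc (-R) R) :=
    (isCompact_closedBall _ _).prod (isCompact_Icc.prod isCompact_Icc)
  have h1 := hK.uniformContinuousOn_of_continuous h.cont_fu.continuousOn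
  have h2 := hK.uniformContinuousOn_of_continuous h.cont_fv.continuousOn
  rw [Metric.uniformContinuousOn_iff] at h1 h2
  obtain ⟨δ₁, hδ₁, H₁⟩ := h1 (ε / 2) (half_pos hε)
  obtain ⟨δ₂, hδ₂, H₂⟩ := h2 (ε / 2) (half_pos hε)
  refine ⟨min δ₁ δ₂, lt_min hδ₁ hδ₂, fun x u v u' v' hr hr' hd => ?_⟩
  have hper : Periodic1 fun x => (fu x, fv x) := fun i x => by
    simp only [h.per_fu i x, h.per_fv i x]
  obtain ⟨y, hy, hyx⟩ := hper.exists_norm_le x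
  simp only [Prod.mk.injEq] at hyx
  rw [← hyx.1, ← hyx.2]
  have hm : ∀ u v : ℝ, |u| + |v| ≤ R → ((y, u, v) : Rn N × ℝ × ℝ) ∈
      Metric.closedBall (0 : Rn N) N ×ˢ Set.Icc (-R) R ×ˢ Set.Icc (-R) R := fun u v hr =>
    ⟨by simpa using hy, abs_le.1 (by linarith [abs_nonneg v]),
      abs_le.1 (by linarith [abs_nonneg u])⟩
  have hdist : dist ((y, u, v) : Rn N × ℝ × ℝ) (y, u', v') ≤ |u - u'| + |v - v'| := by
    simp only [Prod.dist_eq, dist_self, Real.dist_eq]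
    refine max_le (by positivity) (max_le ?_ ?_)
    · linarith [abs_nonneg (v - v')]
    · linarith [abs_nonneg (u - u')]
  have e1 := H₁ _ (hm u v hr) _ (hm u' v' hr')
    (lt_of_le_of_lt hdist (lt_of_lt_of_le hd (min_le_left _ _)))
  have e2 := H₂ _ (hm u v hr) _ (hm u' v' hr')
    (lt_of_le_of_lt hdist (lt_of_lt_of_le hd (min_le_right _ _)))
  rw [Real.dist_eq] at e1 e2
  linarith

/-- The modulus of continuity of the gradient, uniform over the whole space. -/
theorem gradient_sub_le (h : IsNonlin W fu fv) {ε : ℝ} (hε : 0 < ε) :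
    ∃ C ≥ 0, ∀ x u v u' v', |fu x u v - fu x u' v'| + |fv x u v - fv x u' v'|
      ≤ ε * ((|u| + |v|) + (|u'| + |v'|) + (|u| + |v|) ^ (sStar N - 1)
        + (|u'| + |v'|) ^ (sStar N - 1)) + C * (|u - u'| + |v - v'|) := by
  obtain ⟨r, hr, Hs⟩ := h.small ε hε
  obtain ⟨R, hR, Hl⟩ := h.large ε hε
  obtain ⟨B, hB, Hb⟩ := h.bounded R
  -- The tolerance `ε r` is absorbed by `ε(|z| + |z'|)` as soon as the two points are not both in
  -- the ball of radius `r`. The margin `R + 1`, with `δ' ≤ 1`, ensures that for close points, one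
  -- beyond `R + 1` puts the other beyond `R`.
  obtain ⟨δ, hδ, Hu⟩ := h.uniformly_close (R + 1) (ε := ε * r) (by positivity)
  set δ' := min δ 1 with hδ'
  have hδ'0 : 0 < δ' := lt_min hδ one_pos
  have htri : ∀ a b c d : ℝ, |a - b| + |c - d| ≤ (|a| + |c|) + (|b| + |d|) := fun a b c d => by
    linarith [abs_sub a b, abs_sub c d]
  refine ⟨2 * B / δ', by positivity, fun x u v u' v' => ?_⟩
  have hp := Real.rpow_nonneg (show 0 ≤ |u| + |v| by positivity) (sStar N - 1)
  have hp' := Real.rpow_nonneg (show 0 ≤ |u'| + |v'| by positivity) (sStar N - 1)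
  have hn : 0 ≤ |u| + |v| := by positivity
  have hn' : 0 ≤ |u'| + |v'| := by positivity
  have hd0 : 0 ≤ |u - u'| + |v - v'| := by positivity
  have ht := htri (fu x u v) (fu x u' v') (fv x u v) (fv x u' v')
  have htz : |u| + |v| ≤ (|u'| + |v'|) + (|u - u'| + |v - v'|) := by
    linarith [abs_sub_abs_le_abs_sub u u', abs_sub_abs_le_abs_sub v v']
  have htz' : |u'| + |v'| ≤ (|u| + |v|) + (|u - u'| + |v - v'|) := by
    rw [abs_sub_comm u u', abs_sub_comm v v']
    linarith [abs_sub_abs_le_abs_sub u' u, abs_sub_abs_le_abs_sub v' v]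
  have hCd : 0 ≤ 2 * B / δ' * (|u - u'| + |v - v'|) := by positivity
  have m1 := _root_.mul_nonneg hε.le hn
  have m2 := _root_.mul_nonneg hε.le hn'
  have m3 := _root_.mul_nonneg hε.le hp
  have m4 := _root_.mul_nonneg hε.le hp'
  -- Points at distance at least `δ'`: the bounded part is paid for by `C` times the distance. Close
  -- points: both small, both in the intermediate region, or both large, each handled by its own
  -- estimate.
  by_cases hd : δ' ≤ |u - u'| + |v - v'|
  · have hBC : 2 * B ≤ 2 * B / δ' * (|u - u'| + |v - v'|) := by
      rw [div_mul_eq_mul_div, le_div_iff₀ hδ'0]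
      exact mul_le_mul_of_nonneg_left hd (by positivity)
    have hone : ∀ a b : ℝ, |fu x a b| + |fv x a b|
        ≤ ε * (|a| + |b|) ^ (sStar N - 1) + B := by
      intro a b
      rcases le_total R (|a| + |b|) with hab | hab
      · linarith [Hl x a b hab]
      · have : 0 ≤ ε * (|a| + |b|) ^ (sStar N - 1) := by positivity
        linarith [Hb x a b hab]
    linarith [hone u v, hone u' v']
  · push Not at hd
    have hd1 : |u - u'| + |v - v'| < 1 := hd.trans_le (min_le_right _ _)
    by_cases hs : |u| + |v| ≤ r ∧ |u'| + |v'| ≤ r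
    · linarith [Hs x u v hs.1, Hs x u' v' hs.2]
    · by_cases hl : |u| + |v| ≤ R + 1 ∧ |u'| + |v'| ≤ R + 1
      · have e := Hu x u v u' v' hl.1 hl.2 (hd.trans_le (min_le_left _ _))
        have : ε * r ≤ ε * (|u| + |v|) + ε * (|u'| + |v'|) := by
          rw [← mul_add]
          refine mul_le_mul_of_nonneg_left ?_ hε.le
          by_contra hc
          exact hs ⟨by linarith, by linarith⟩
        linarith
      · have hR1 : R ≤ |u| + |v| ∧ R ≤ |u'| + |v'| := by
          by_contra hc
          refine hl ⟨?_, ?_⟩ <;> by_contra hc' <;> exact hc ⟨by linarith, by linarith⟩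
        linarith [Hl x u v hR1.1, Hl x u' v' hR1.2]

/-- Linear near zero, critical power near infinity; on the annulus `r ≤ |z| ≤ R` the bound `B` is at
most `(B/r)|z|`. -/
theorem growth (h : IsNonlin W fu fv) : ∃ C ≥ 0, ∀ x u v,
    |fu x u v| + |fv x u v| ≤ C * ((|u| + |v|) + (|u| + |v|) ^ (sStar N - 1)) := by
  obtain ⟨r, hr, Hs⟩ := h.small 1 one_pos
  obtain ⟨R, hR, Hl⟩ := h.large 1 one_pos
  obtain ⟨B, hB, Hb⟩ := h.bounded R
  refine ⟨1 + B / r, by positivity, fun x u v => ?_⟩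
  have hn : 0 ≤ |u| + |v| := by positivity
  have hp := Real.rpow_nonneg hn (sStar N - 1)
  have hBr : 0 ≤ B / r := by positivity
  rcases le_total (|u| + |v|) r with h1 | h1
  · nlinarith [Hs x u v h1]
  rcases le_total R (|u| + |v|) with h2 | h2
  · nlinarith [Hl x u v h2]
  · have : B ≤ B / r * (|u| + |v|) := by
      rw [div_mul_eq_mul_div, le_div_iff₀ hr]
      exact mul_le_mul_of_nonneg_left h1 hB
    nlinarith [Hb x u v h2]

/-- As in `growth`, but the annulus is charged to the critical power, which leaves an arbitrarily
small linear coefficient for the behaviour at the origin. -/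
theorem small_growth (h : IsNonlin W fu fv) (hN : 3 ≤ N) {ε : ℝ} (hε : 0 < ε) : ∃ C ≥ 0, ∀ x u v,
    |fu x u v| + |fv x u v| ≤ ε * (|u| + |v|) + C * (|u| + |v|) ^ (sStar N - 1) := by
  obtain ⟨r, hr, Hs⟩ := h.small ε hε
  obtain ⟨R, hR, Hl⟩ := h.large 1 one_pos
  obtain ⟨B, hB, Hb⟩ := h.bounded R
  have hs := two_lt_sStar hN
  refine ⟨1 + B / r ^ (sStar N - 1), by positivity, fun x u v => ?_⟩
  have hn : 0 ≤ |u| + |v| := by positivity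
  have hp := Real.rpow_nonneg hn (sStar N - 1)
  have hBr : 0 ≤ B / r ^ (sStar N - 1) := by positivity
  rcases le_total (|u| + |v|) r with h1 | h1
  · nlinarith [Hs x u v h1]
  rcases le_total R (|u| + |v|) with h2 | h2
  · nlinarith [Hl x u v h2]
  · have : B ≤ B / r ^ (sStar N - 1) * (|u| + |v|) ^ (sStar N - 1) := by
      rw [div_mul_eq_mul_div, le_div_iff₀ (by positivity)]
      refine mul_le_mul_of_nonneg_left ?_ hB
      exact Real.rpow_le_rpow hr.le h1 (by linarith)
    nlinarith [Hb x u v h2]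

/-- Subcritical bound used under vanishing. -/
theorem vanishing_growth (h : IsNonlin W fu fv) (q : ℝ) (hq : 0 ≤ q) {ε : ℝ} (hε : 0 < ε) :
    ∃ C ≥ 0, ∀ x u v, |fu x u v| + |fv x u v|
      ≤ ε * ((|u| + |v|) + (|u| + |v|) ^ (sStar N - 1)) + C * (|u| + |v|) ^ q := by
  obtain ⟨r, hr, Hs⟩ := h.small ε hε
  obtain ⟨R, hR, Hl⟩ := h.large ε hε
  obtain ⟨B, hB, Hb⟩ := h.bounded R
  refine ⟨B / r ^ q, by positivity, fun x u v => ?_⟩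
  have hn : 0 ≤ |u| + |v| := by positivity
  have hp := Real.rpow_nonneg hn (sStar N - 1)
  have hpq := Real.rpow_nonneg hn q
  have hBr : 0 ≤ B / r ^ q := by positivity
  rcases le_total (|u| + |v|) r with h1 | h1
  · nlinarith [Hs x u v h1]
  rcases le_total R (|u| + |v|) with h2 | h2
  · nlinarith [Hl x u v h2]
  · have : B ≤ B / r ^ q * (|u| + |v|) ^ q := by
      rw [div_mul_eq_mul_div, le_div_iff₀ (by positivity)]
      refine mul_le_mul_of_nonneg_left ?_ hB
      exact Real.rpow_le_rpow hr.le h1 hq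
    nlinarith [Hb x u v h2]

end IsNonlin

end HamSys
end

/-! ### Embedding constants and Hölder estimates on `E`. -/

noncomputable section

namespace HamSys

open scoped ENNReal NNReal

theorem val_add {N : ℕ} (u w : H1 N) : val (u + w) =ᵐ[volume] fun x => val u x + val w x :=
  Lp.coeFn_add u.1.fst w.1.fst

theorem val_sub {N : ℕ} (u w : H1 N) : val (u - w) =ᵐ[volume] fun x => val u x - val w x :=
  Lp.coeFn_sub u.1.fst w.1.fst

theorem val_smul {N : ℕ} (c : ℝ) (u : H1 N) : val (c • u) =ᵐ[volume] fun x => c * val u x :=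
  Lp.coeFn_smul c u.1.fst

theorem val_zero {N : ℕ} : val (0 : H1 N) =ᵐ[volume] fun _ => 0 :=
  Lp.coeFn_zero _ _ _

/-- The pointwise size `|u| + |v|` of `z = (u,v)`. -/
def zabs {N : ℕ} (z : ESpace N) (x : Rn N) : ℝ := |val z.fst x| + |val z.snd x|

theorem zabs_nonneg {N : ℕ} (z : ESpace N) (x : Rn N) : 0 ≤ zabs z x := by
  unfold zabs; positivity

theorem aestronglyMeasurable_zabs {N : ℕ} (z : ESpace N) :
    AEStronglyMeasurable (zabs z) volume :=
  (memLp_val z.fst).1.norm.add (memLp_val z.snd).1.norm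

theorem zabs_sub {N : ℕ} (z w : ESpace N) : zabs (z - w) =ᵐ[volume] fun x =>
    |val z.fst x - val w.fst x| + |val z.snd x - val w.snd x| := by
  filter_upwards [val_sub z.fst w.fst, val_sub z.snd w.snd] with x h1 h2
  simp only [zabs, WithLp.sub_fst, WithLp.sub_snd, h1, h2]

theorem eLpNorm_zabs_le {N : ℕ} {p : ℝ≥0∞} (hp : 1 ≤ p) {C : ℝ≥0}
    (hC : ∀ u : H1 N, eLpNorm (val u) p volume ≤ C * ‖u‖ₑ) (z : ESpace N) :
    eLpNorm (zabs z) p volume ≤ ENNReal.ofReal (2 * C * ‖z‖) := by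
  have h1 := (memLp_val z.fst).1
  have h2 := (memLp_val z.snd).1
  have hadd : eLpNorm (zabs z) p volume
      ≤ eLpNorm (fun x => |val z.fst x|) p volume + eLpNorm (fun x => |val z.snd x|) p volume :=
    eLpNorm_add_le h1.norm h2.norm hp
  have e : ∀ u : H1 N, eLpNorm (fun x => |val u x|) p volume = eLpNorm (val u) p volume :=
    fun u => eLpNorm_norm (val u)
  rw [e, e] at hadd
  refine hadd.trans ((add_le_add (hC _) (hC _)).trans ?_)
  have f1 : ‖z.fst‖ₑ ≤ ENNReal.ofReal ‖z‖ := by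
    rw [← ofReal_norm]; exact ENNReal.ofReal_le_ofReal (WithLp.norm_fst_le _ z)
  have f2 : ‖z.snd‖ₑ ≤ ENNReal.ofReal ‖z‖ := by
    rw [← ofReal_norm]; exact ENNReal.ofReal_le_ofReal (WithLp.norm_snd_le _ z)
  calc _ ≤ (C : ℝ≥0∞) * ENNReal.ofReal ‖z‖ + C * ENNReal.ofReal ‖z‖ :=
        add_le_add (mul_le_mul' le_rfl f1) (mul_le_mul' le_rfl f2)
    _ = _ := by
        rw [ENNReal.ofReal_mul (by positivity), ENNReal.ofReal_mul (by norm_num),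
          ENNReal.ofReal_coe_nnreal, ENNReal.ofReal_ofNat]
        ring

theorem integral_rpow_le_of_eLpNorm_le {N : ℕ} {f : Rn N → ℝ} {p M : ℝ} (hp : 0 < p)
    (hM : 0 ≤ M) (hf0 : ∀ x, 0 ≤ f x) (hf : AEStronglyMeasurable f volume)
    (h : eLpNorm f (ENNReal.ofReal p) volume ≤ ENNReal.ofReal M) :
    Integrable (fun x => f x ^ p) volume ∧ ∫ x, f x ^ p ≤ M ^ p := by
  have h1 : ∫⁻ x, ‖f x‖ₑ ^ p ≤ ENNReal.ofReal (M ^ p) := by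
    rw [← eLpNorm_ofReal_rpow _ hp, ← ENNReal.ofReal_rpow_of_nonneg hM hp.le]
    exact ENNReal.rpow_le_rpow h hp.le
  have e : ∀ x, ENNReal.ofReal (f x ^ p) = ‖f x‖ₑ ^ p := fun x => by
    rw [Real.enorm_of_nonneg (hf0 x), ENNReal.ofReal_rpow_of_nonneg (hf0 x) hp.le]
  have hm : AEStronglyMeasurable (fun x => f x ^ p) volume :=
    (Real.continuous_rpow_const hp.le).comp_aestronglyMeasurable hf
  have hn : ∀ x, 0 ≤ f x ^ p := fun x => Real.rpow_nonneg (hf0 x) p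
  refine ⟨⟨hm, ?_⟩, ?_⟩
  · rw [hasFiniteIntegral_iff_ofReal (Eventually.of_forall hn)]
    simp_rw [e]
    exact lt_of_le_of_lt h1 ENNReal.ofReal_lt_top
  · rw [integral_eq_lintegral_of_nonneg_ae (Eventually.of_forall hn) hm]
    simp_rw [e]
    exact ENNReal.toReal_le_of_le_ofReal (Real.rpow_nonneg hM p) h1

/-- `K` is a common embedding constant of `E` into `L²` and `L^{2*}`. -/
structure IsEmbConst (N : ℕ) (K : ℝ) : Prop where
  nonneg : 0 ≤ K
  two_lt : 2 < sStar N
  memLp_two : ∀ z : ESpace N, MemLp (zabs z) 2 volume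
  memLp_star : ∀ z : ESpace N, MemLp (zabs z) (ENNReal.ofReal (sStar N)) volume
  int_two : ∀ z : ESpace N, ∫ x, zabs z x ^ (2 : ℝ) ≤ (K * ‖z‖) ^ (2 : ℝ)
  int_star : ∀ z : ESpace N, ∫ x, zabs z x ^ sStar N ≤ (K * ‖z‖) ^ sStar N

theorem exists_isEmbConst {N : ℕ} (hN : 3 ≤ N) : ∃ K, IsEmbConst N K := by
  obtain ⟨C, hC⟩ := exists_sobolev_const hN
  have hs := two_lt_sStar hN
  have h2 : ENNReal.ofReal 2 = 2 := by simp
  have hC2 : ∀ u : H1 N, eLpNorm (val u) 2 volume ≤ (1 : ℝ≥0) * ‖u‖ₑ := fun u => by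
    simpa using eLpNorm_val_le u
  have b2 := fun z : ESpace N => eLpNorm_zabs_le (by norm_num) hC2 z
  have bs := fun z : ESpace N => eLpNorm_zabs_le
    (ENNReal.one_le_ofReal.2 (by linarith)) hC z
  have hb2 : ∀ z : ESpace N, eLpNorm (zabs z) (ENNReal.ofReal 2) volume
      ≤ ENNReal.ofReal (2 * max (C : ℝ) 1 * ‖z‖) := fun z => by
    rw [h2]
    refine (b2 z).trans (ENNReal.ofReal_le_ofReal ?_)
    gcongr
    exact le_max_right _ _
  have hbs : ∀ z : ESpace N, eLpNorm (zabs z) (ENNReal.ofReal (sStar N)) volume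
      ≤ ENNReal.ofReal (2 * max (C : ℝ) 1 * ‖z‖) := fun z => by
    refine (bs z).trans (ENNReal.ofReal_le_ofReal ?_)
    gcongr
    exact le_max_left _ _
  refine ⟨2 * max (C : ℝ) 1, by positivity, hs, fun z => ?_, fun z => ?_, fun z => ?_, fun z => ?_⟩
  · exact ⟨aestronglyMeasurable_zabs z, (b2 z).trans_lt ENNReal.ofReal_lt_top⟩
  · exact ⟨aestronglyMeasurable_zabs z, (bs z).trans_lt ENNReal.ofReal_lt_top⟩
  · exact (integral_rpow_le_of_eLpNorm_le (by norm_num) (by positivity) (zabs_nonneg z)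
      (aestronglyMeasurable_zabs z) (hb2 z)).2
  · exact (integral_rpow_le_of_eLpNorm_le (by linarith) (by positivity) (zabs_nonneg z)
      (aestronglyMeasurable_zabs z) (hbs z)).2

namespace IsEmbConst

variable {N : ℕ} {K : ℝ}

theorem integrable_mul (hK : IsEmbConst N K) (z w : ESpace N) :
    Integrable (fun x => zabs z x * zabs w x) volume :=
  (hK.memLp_two z).integrable_mul (hK.memLp_two w)

theorem integral_mul_le (hK : IsEmbConst N K) (z w : ESpace N) :
    ∫ x, zabs z x * zabs w x ≤ (K * ‖z‖) * (K * ‖w‖) := by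
  have h2 : ENNReal.ofReal 2 = 2 := by simp
  have hz0 : 0 ≤ K * ‖z‖ := mul_nonneg hK.nonneg (norm_nonneg _)
  have hw0 : 0 ≤ K * ‖w‖ := mul_nonneg hK.nonneg (norm_nonneg _)
  refine (integral_mul_le_Lp_mul_Lq_of_nonneg (p := 2) (q := 2) (Real.HolderConjugate.two_two)
    (Eventually.of_forall (zabs_nonneg z)) (Eventually.of_forall (zabs_nonneg w))
    (by rw [h2]; exact hK.memLp_two z) (by rw [h2]; exact hK.memLp_two w)).trans ?_
  have e : ∀ M : ℝ, 0 ≤ M → (M ^ (2 : ℝ)) ^ (1 / 2 : ℝ) = M := fun M hM => by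
    rw [← Real.rpow_mul hM]; norm_num
  refine mul_le_mul ?_ ?_ (Real.rpow_nonneg (integral_nonneg fun x =>
    Real.rpow_nonneg (zabs_nonneg w x) _) _) hz0
  · refine (Real.rpow_le_rpow (integral_nonneg fun x => ?_) (hK.int_two z) (by norm_num)).trans_eq
      (e _ hz0)
    exact Real.rpow_nonneg (zabs_nonneg z x) _
  · refine (Real.rpow_le_rpow (integral_nonneg fun x => ?_) (hK.int_two w) (by norm_num)).trans_eq
      (e _ hw0)
    exact Real.rpow_nonneg (zabs_nonneg w x) _

theorem star_conj (hK : IsEmbConst N K) :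
    (sStar N / (sStar N - 1)).HolderConjugate (sStar N) := by
  have hs := hK.two_lt
  exact (Real.HolderConjugate.conjExponent (by linarith : 1 < sStar N)).symm

/-- The exponent `2*/(2* - 1)` is conjugate to `2*`, so `|z|^(2*-1)` pairs with any element of `E`.
-/
theorem memLp_rpow (hK : IsEmbConst N K) (z : ESpace N) :
    MemLp (fun x => zabs z x ^ (sStar N - 1)) (ENNReal.ofReal (sStar N / (sStar N - 1))) volume := by
  have hs := hK.two_lt
  have := (hK.memLp_star z).norm_rpow_div (ENNReal.ofReal (sStar N - 1))
  rw [ENNReal.toReal_ofReal (by linarith), ← ENNReal.ofReal_div_of_pos (by linarith)] at this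
  refine this.congr_norm ?_ (Eventually.of_forall fun x => ?_)
  · exact (Real.continuous_rpow_const (by linarith)).comp_aestronglyMeasurable
      (aestronglyMeasurable_zabs z)
  · rw [Real.norm_of_nonneg (zabs_nonneg z x)]

theorem integrable_rpow_mul (hK : IsEmbConst N K) (z w : ESpace N) :
    Integrable (fun x => zabs z x ^ (sStar N - 1) * zabs w x) volume := by
  have := hK.star_conj
  have hh : ENNReal.HolderConjugate (ENNReal.ofReal (sStar N / (sStar N - 1)))
      (ENNReal.ofReal (sStar N)) := this.ennrealOfReal
  exact (hK.memLp_rpow z).integrable_mul (hK.memLp_star w)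

theorem integral_rpow_mul_le (hK : IsEmbConst N K) (z w : ESpace N) :
    ∫ x, zabs z x ^ (sStar N - 1) * zabs w x ≤ (K * ‖z‖) ^ (sStar N - 1) * (K * ‖w‖) := by
  have hs := hK.two_lt
  have hz0 : 0 ≤ K * ‖z‖ := mul_nonneg hK.nonneg (norm_nonneg _)
  have hw0 : 0 ≤ K * ‖w‖ := mul_nonneg hK.nonneg (norm_nonneg _)
  refine (integral_mul_le_Lp_mul_Lq_of_nonneg hK.star_conj
    (Eventually.of_forall fun x => Real.rpow_nonneg (zabs_nonneg z x) _)
    (Eventually.of_forall (zabs_nonneg w)) (hK.memLp_rpow z) (hK.memLp_star w)).trans ?_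
  have e1 : ∀ x, (zabs z x ^ (sStar N - 1)) ^ (sStar N / (sStar N - 1)) = zabs z x ^ sStar N := by
    intro x
    rw [← Real.rpow_mul (zabs_nonneg z x)]
    congr 1
    have : sStar N - 1 ≠ 0 := by linarith
    field_simp
  simp_rw [e1]
  refine mul_le_mul ?_ ?_ ?_ (Real.rpow_nonneg hz0 _)
  · refine (Real.rpow_le_rpow (integral_nonneg fun x => ?_) (hK.int_star z) ?_).trans_eq ?_
    · exact Real.rpow_nonneg (zabs_nonneg z x) _
    · have : 0 < sStar N - 1 := by linarith
      positivity
    · rw [← Real.rpow_mul hz0]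
      congr 1
      have : sStar N ≠ 0 := by linarith
      have : sStar N - 1 ≠ 0 := by linarith
      field_simp
  · refine (Real.rpow_le_rpow (integral_nonneg fun x => ?_) (hK.int_star w) (by positivity)).trans_eq ?_
    · exact Real.rpow_nonneg (zabs_nonneg w x) _
    · rw [← Real.rpow_mul hw0]
      have : sStar N ≠ 0 := by linarith
      rw [mul_one_div_cancel this, Real.rpow_one]
  · exact Real.rpow_nonneg (integral_nonneg fun x => Real.rpow_nonneg (zabs_nonneg w x) _) _

end IsEmbConst

end HamSys
end

/-! ### The functional `Ψ`, its derivative and its behaviour on bounded sets and at the origin. -/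

noncomputable section

namespace HamSys

open scoped ENNReal NNReal

/-- The functional `Ψ(z) = ∫ W(x,z)`. -/
def Psi {N : ℕ} (W : Rn N → ℝ → ℝ → ℝ) (z : ESpace N) : ℝ :=
  ∫ x, W x (val z.fst x) (val z.snd x)

/-- The density of `⟨Ψ'(z), η⟩`. -/
def fdot {N : ℕ} (fu fv : Rn N → ℝ → ℝ → ℝ) (z η : ESpace N) (x : Rn N) : ℝ :=
  fu x (val z.fst x) (val z.snd x) * val η.fst x + fv x (val z.fst x) (val z.snd x) * val η.snd x

theorem aestronglyMeasurable_comp {N : ℕ} {F : Rn N → ℝ → ℝ → ℝ}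
    (hF : Continuous fun q : Rn N × ℝ × ℝ => F q.1 q.2.1 q.2.2) (z : ESpace N) :
    AEStronglyMeasurable (fun x => F x (val z.fst x) (val z.snd x)) volume :=
  hF.comp_aestronglyMeasurable (aestronglyMeasurable_id.prodMk
    ((memLp_val z.fst).1.prodMk (memLp_val z.snd).1))

theorem abs_pair_le (p q a b : ℝ) : |p * a + q * b| ≤ (|p| + |q|) * (|a| + |b|) := by
  have := abs_add_le (p * a) (q * b)
  rw [abs_mul, abs_mul] at this
  nlinarith [mul_nonneg (abs_nonneg p) (abs_nonneg b), mul_nonneg (abs_nonneg q) (abs_nonneg a)]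

theorem abs_fdot_le {N : ℕ} (fu fv : Rn N → ℝ → ℝ → ℝ) (z η : ESpace N) (x : Rn N) :
    |fdot fu fv z η x| ≤ (|fu x (val z.fst x) (val z.snd x)| + |fv x (val z.fst x) (val z.snd x)|)
      * zabs η x := abs_pair_le _ _ _ _

namespace IsNonlin

variable {N : ℕ} {W fu fv : Rn N → ℝ → ℝ → ℝ} {K : ℝ}

theorem aestronglyMeasurable_fdot (h : IsNonlin W fu fv) (z η : ESpace N) :
    AEStronglyMeasurable (fdot fu fv z η) volume :=
  ((aestronglyMeasurable_comp h.cont_fu z).mul (memLp_val η.fst).1).add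
    ((aestronglyMeasurable_comp h.cont_fv z).mul (memLp_val η.snd).1)

theorem integrable_fdot (h : IsNonlin W fu fv) (hK : IsEmbConst N K) (z η : ESpace N) :
    Integrable (fdot fu fv z η) volume := by
  obtain ⟨C, hC, H⟩ := h.growth
  refine (((hK.integrable_mul z η).add (hK.integrable_rpow_mul z η)).const_mul C).mono'
    (h.aestronglyMeasurable_fdot z η) (Eventually.of_forall fun x => ?_)
  refine (abs_fdot_le _ _ _ _ _).trans ?_
  refine (mul_le_mul_of_nonneg_right (H x _ _) (zabs_nonneg η x)).trans_eq ?_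
  simp only [Pi.add_apply]
  unfold zabs; ring

/-- Since `0 ≤ W ≤ ½ ∇W·z`, integrability is inherited from the density of `⟨Ψ'(z), z⟩`. -/
theorem integrable (h : IsNonlin W fu fv) (hK : IsEmbConst N K) (z : ESpace N) :
    Integrable (fun x => W x (val z.fst x) (val z.snd x)) volume := by
  refine ((h.integrable_fdot hK z z).const_mul (1 / 2)).mono'
    (aestronglyMeasurable_comp h.cont z) (Eventually.of_forall fun x => ?_)
  rw [Real.norm_of_nonneg (h.nonneg _ _ _)]
  exact h.le_half _ _ _

theorem fdot_add (fu fv : Rn N → ℝ → ℝ → ℝ) (z η ζ : ESpace N) :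
    fdot fu fv z (η + ζ) =ᵐ[volume] fun x => fdot fu fv z η x + fdot fu fv z ζ x := by
  filter_upwards [val_add η.fst ζ.fst, val_add η.snd ζ.snd] with x h1 h2
  simp only [fdot, WithLp.add_fst, WithLp.add_snd, h1, h2]; ring

theorem fdot_smul (fu fv : Rn N → ℝ → ℝ → ℝ) (z η : ESpace N) (c : ℝ) :
    fdot fu fv z (c • η) =ᵐ[volume] fun x => c * fdot fu fv z η x := by
  filter_upwards [val_smul c η.fst, val_smul c η.snd] with x h1 h2
  simp only [fdot, WithLp.smul_fst, WithLp.smul_snd, h1, h2]; ring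

theorem exists_bound_fdot (h : IsNonlin W fu fv) (hK : IsEmbConst N K) (z : ESpace N) :
    ∃ M, ∀ η, |∫ x, fdot fu fv z η x| ≤ M * ‖η‖ := by
  obtain ⟨C, hC, H⟩ := h.growth
  refine ⟨C * ((K * ‖z‖) * K + (K * ‖z‖) ^ (sStar N - 1) * K), fun η => ?_⟩
  have hi := ((hK.integrable_mul z η).add (hK.integrable_rpow_mul z η)).const_mul C
  calc |∫ x, fdot fu fv z η x|
      ≤ ∫ x, C * ((zabs z x * zabs η x) + (zabs z x ^ (sStar N - 1) * zabs η x)) := by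
        rw [← Real.norm_eq_abs]
        refine norm_integral_le_of_norm_le hi (Eventually.of_forall fun x => ?_)
        refine (abs_fdot_le _ _ _ _ _).trans ?_
        refine (mul_le_mul_of_nonneg_right (H x _ _) (zabs_nonneg η x)).trans_eq ?_
        unfold zabs; ring
    _ = C * ((∫ x, zabs z x * zabs η x) + ∫ x, zabs z x ^ (sStar N - 1) * zabs η x) := by
        rw [integral_const_mul, integral_add (hK.integrable_mul z η) (hK.integrable_rpow_mul z η)]
    _ ≤ C * ((K * ‖z‖) * (K * ‖η‖) + (K * ‖z‖) ^ (sStar N - 1) * (K * ‖η‖)) := by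
        gcongr
        · exact hK.integral_mul_le z η
        · exact hK.integral_rpow_mul_le z η
    _ = _ := by ring

end IsNonlin

/-- The derivative of `Ψ` at `z`. -/
def dPsi {N : ℕ} {W fu fv : Rn N → ℝ → ℝ → ℝ} {K : ℝ} (h : IsNonlin W fu fv)
    (hK : IsEmbConst N K) (z : ESpace N) : ESpace N →L[ℝ] ℝ :=
  LinearMap.mkContinuousOfExistsBound
    { toFun := fun η => ∫ x, fdot fu fv z η x
      map_add' := fun η ζ => by
        rw [integral_congr_ae (IsNonlin.fdot_add fu fv z η ζ)]
        exact integral_add (h.integrable_fdot hK z η) (h.integrable_fdot hK z ζ)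
      map_smul' := fun c η => by
        rw [integral_congr_ae (IsNonlin.fdot_smul fu fv z η c), integral_const_mul]
        rfl }
    (h.exists_bound_fdot hK z)

section

variable {N : ℕ} {W fu fv : Rn N → ℝ → ℝ → ℝ} {K : ℝ}

theorem dPsi_apply (h : IsNonlin W fu fv) (hK : IsEmbConst N K) (z η : ESpace N) : dPsi h hK z η = ∫ x, fdot fu fv z η x := rfl

theorem Psi_nonneg {N : ℕ} {W fu fv : Rn N → ℝ → ℝ → ℝ} (h : IsNonlin W fu fv) (z : ESpace N) : 0 ≤ Psi W z := integral_nonneg fun _ => h.nonneg _ _ _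

theorem Psi_zero {N : ℕ} {W fu fv : Rn N → ℝ → ℝ → ℝ} (h : IsNonlin W fu fv) : Psi W (0 : ESpace N) = 0 := by
  unfold Psi
  rw [← integral_zero (Rn N) ℝ]
  refine integral_congr_ae ?_
  filter_upwards [val_zero (N := N)] with x hx
  simp [hx, h.zero]

/-- The pointwise key inequality is linear in its terms, with `t` independent of `x`, so it
integrates unchanged. -/
theorem Psi_key (h : IsNonlin W fu fv) (hK : IsEmbConst N K) (z y : ESpace N) (t : ℝ) :
    0 ≤ Psi W y - Psi W z + (1 + t ^ 2) / 2 * dPsi h hK z z - t * dPsi h hK z y := by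
  have i1 := h.integrable hK y
  have i2 := h.integrable hK z
  have i3 := (h.integrable_fdot hK z z).const_mul ((1 + t ^ 2) / 2)
  have i4 := (h.integrable_fdot hK z y).const_mul t
  have hnn : 0 ≤ ∫ x, (W x (val y.fst x) (val y.snd x) - W x (val z.fst x) (val z.snd x)
      + (1 + t ^ 2) / 2 * fdot fu fv z z x - t * fdot fu fv z y x) :=
    integral_nonneg fun x => h.key x _ _ _ _ t
  refine hnn.trans_eq ?_
  refine (integral_sub ((i1.sub i2).add i3) i4).trans ?_
  rw [integral_const_mul]
  congr 1
  refine (integral_add (i1.sub i2) i3).trans ?_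
  rw [integral_const_mul]
  congr 1
  exact integral_sub i1 i2

theorem integral_combination {N : ℕ} {f₁ f₂ f₃ f₄ f₅ : Rn N → ℝ} (h₁ : Integrable f₁ volume)
    (h₂ : Integrable f₂ volume) (h₃ : Integrable f₃ volume) (h₄ : Integrable f₄ volume)
    (h₅ : Integrable f₅ volume) (ε C : ℝ) :
    Integrable (fun x => ε * (f₁ x + f₂ x + f₃ x + f₄ x) + C * f₅ x) volume ∧
    ∫ x, (ε * (f₁ x + f₂ x + f₃ x + f₄ x) + C * f₅ x)
      = ε * ((∫ x, f₁ x) + (∫ x, f₂ x) + (∫ x, f₃ x) + ∫ x, f₄ x) + C * ∫ x, f₅ x := by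
  have h12 : Integrable (fun x => f₁ x + f₂ x) volume := h₁.add h₂
  have h123 : Integrable (fun x => f₁ x + f₂ x + f₃ x) volume := h12.add h₃
  have h1234 : Integrable (fun x => f₁ x + f₂ x + f₃ x + f₄ x) volume := h123.add h₄
  refine ⟨(h1234.const_mul ε).add (h₅.const_mul C), ?_⟩
  rw [integral_add (h1234.const_mul ε) (h₅.const_mul C), integral_const_mul, integral_const_mul,
    integral_add h123 h₄, integral_add h12 h₃, integral_add h₁ h₂]

/-- Comparison of two values of `Ψ'` under a pointwise modulus of continuity. -/
theorem abs_integral_fdot_sub_le (h : IsNonlin W fu fv) (hK : IsEmbConst N K) {ε C : ℝ}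
    (H : ∀ x u v u' v', |fu x u v - fu x u' v'| + |fv x u v - fv x u' v'|
      ≤ ε * ((|u| + |v|) + (|u'| + |v'|) + (|u| + |v|) ^ (sStar N - 1)
        + (|u'| + |v'|) ^ (sStar N - 1)) + C * (|u - u'| + |v - v'|)) (hε : 0 ≤ ε)
    {R : ℝ} {z y : ESpace N} (hz : ‖z‖ ≤ R) (hy : ‖y‖ ≤ R) (η : ESpace N) :
    |(∫ x, fdot fu fv z η x) - ∫ x, fdot fu fv y η x|
      ≤ ε * ((2 * (K * R) + 2 * (K * R) ^ (sStar N - 1)) * (K * ‖η‖))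
        + C * ∫ x, zabs (z - y) x * zabs η x := by
  have hs := hK.two_lt
  have hK0 := hK.nonneg
  obtain ⟨hi, e⟩ := integral_combination (hK.integrable_mul z η) (hK.integrable_mul y η)
    (hK.integrable_rpow_mul z η) (hK.integrable_rpow_mul y η) (hK.integrable_mul (z - y) η) ε C
  have hpt : ∀ᵐ x, ‖fdot fu fv z η x - fdot fu fv y η x‖
      ≤ ε * (zabs z x * zabs η x + zabs y x * zabs η x + zabs z x ^ (sStar N - 1) * zabs η x
        + zabs y x ^ (sStar N - 1) * zabs η x) + C * (zabs (z - y) x * zabs η x) := by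
    filter_upwards [zabs_sub z y] with x hx
    have e : fdot fu fv z η x - fdot fu fv y η x
        = (fu x (val z.fst x) (val z.snd x) - fu x (val y.fst x) (val y.snd x)) * val η.fst x
        + (fv x (val z.fst x) (val z.snd x) - fv x (val y.fst x) (val y.snd x)) * val η.snd x := by
      unfold fdot; ring
    rw [e, Real.norm_eq_abs]
    refine (abs_pair_le _ _ _ _).trans ?_
    refine (mul_le_mul_of_nonneg_right (H x _ _ _ _) (zabs_nonneg η x)).trans_eq ?_
    rw [hx]; unfold zabs; ring
  have b1 := hK.integral_mul_le z η
  have b2 := hK.integral_mul_le y η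
  have b3 := hK.integral_rpow_mul_le z η
  have b4 := hK.integral_rpow_mul_le y η
  have c1 : K * ‖z‖ * (K * ‖η‖) ≤ K * R * (K * ‖η‖) := by gcongr
  have c2 : K * ‖y‖ * (K * ‖η‖) ≤ K * R * (K * ‖η‖) := by gcongr
  have c3 : (K * ‖z‖) ^ (sStar N - 1) * (K * ‖η‖) ≤ (K * R) ^ (sStar N - 1) * (K * ‖η‖) := by
    gcongr; linarith
  have c4 : (K * ‖y‖) ^ (sStar N - 1) * (K * ‖η‖) ≤ (K * R) ^ (sStar N - 1) * (K * ‖η‖) := by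
    gcongr; linarith
  rw [← integral_sub (h.integrable_fdot hK z η) (h.integrable_fdot hK y η),
    ← Real.norm_eq_abs]
  refine ((norm_integral_le_of_norm_le hi hpt).trans_eq e).trans ?_
  refine add_le_add (mul_le_mul_of_nonneg_left ?_ hε) le_rfl
  linarith

theorem half_add_half_le {A K C ε t : ℝ} (hA : 0 ≤ A) (hK : 0 ≤ K) (hC : 0 ≤ C) (hε : 0 ≤ ε)
    (ht : 0 ≤ t) : ε / (2 * (A * K + 1)) * (A * (K * t))
      + C * (K * (ε / (2 * (C * K * K + 1))) * (K * t)) ≤ ε * t := by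
  have hCK : 0 ≤ C * K * K := by positivity
  have hAK : 0 ≤ A * K := by positivity
  calc _ = ε / 2 * ((A * K) / (A * K + 1)) * t
          + ε / 2 * ((C * K * K) / (C * K * K + 1)) * t := by
        have h1 : A * K + 1 ≠ 0 := by positivity
        have h2 : C * K * K + 1 ≠ 0 := by positivity
        field_simp
    _ ≤ ε / 2 * 1 * t + ε / 2 * 1 * t := by
        have h1 : (A * K) / (A * K + 1) ≤ 1 := by rw [div_le_one (by positivity)]; linarith
        have h2 : (C * K * K) / (C * K * K + 1) ≤ 1 := by
          rw [div_le_one (by positivity)]; linarith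
        gcongr
    _ = ε * t := by ring

/-- In the gradient modulus the `ε`-part is controlled by the norms alone, and the Lipschitz part by
`‖z - y‖` through the `L²` embedding; each receives half of the tolerance. The summands `+ 1` in the
denominators allow vanishing constants. -/
theorem integral_fdot_uniform (h : IsNonlin W fu fv) (hK : IsEmbConst N K) (R ε : ℝ) (hε : 0 < ε) :
    ∃ δ > 0, ∀ z y : ESpace N, ‖z‖ ≤ R → ‖y‖ ≤ R → ‖z - y‖ ≤ δ →
      ∀ η : ESpace N, |(∫ x, fdot fu fv z η x) - ∫ x, fdot fu fv y η x| ≤ ε * ‖η‖ := by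
  have hK0 := hK.nonneg
  obtain ⟨A, hA0, hA⟩ : ∃ A : ℝ, 0 ≤ A ∧
      2 * (K * |R|) + 2 * (K * |R|) ^ (sStar N - 1) = A := by
    refine ⟨_, ?_, rfl⟩
    have h1 : 0 ≤ K * |R| := mul_nonneg hK0 (abs_nonneg R)
    have h2 := Real.rpow_nonneg h1 (sStar N - 1)
    linarith
  have hAK : 0 < 2 * (A * K + 1) := by positivity
  obtain ⟨C, hC, H⟩ := h.gradient_sub_le (div_pos hε hAK)
  have hCK : 0 < 2 * (C * K * K + 1) :=
    mul_pos two_pos (add_pos_of_nonneg_of_pos (mul_nonneg (mul_nonneg hC hK0) hK0) one_pos)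
  refine ⟨ε / (2 * (C * K * K + 1)), div_pos hε hCK, fun z y hz hy hzy η => ?_⟩
  have hmain := abs_integral_fdot_sub_le h hK H (div_pos hε hAK).le (hz.trans (le_abs_self R))
    (hy.trans (le_abs_self R)) η
  rw [hA] at hmain
  have b5 := hK.integral_mul_le (z - y) η
  have c5 : K * ‖z - y‖ * (K * ‖η‖) ≤ K * (ε / (2 * (C * K * K + 1))) * (K * ‖η‖) :=
    mul_le_mul_of_nonneg_right (mul_le_mul_of_nonneg_left hzy hK0)
      (mul_nonneg hK0 (norm_nonneg η))
  have b6 := mul_le_mul_of_nonneg_left (b5.trans c5) hC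
  have b7 := half_add_half_le hA0 hK0 hC hε.le (norm_nonneg η)
  exact hmain.trans ((add_le_add le_rfl b6).trans b7)

/-- The derivative of `Ψ` is uniformly continuous on bounded sets. -/
theorem dPsi_uniform (h : IsNonlin W fu fv) (hK : IsEmbConst N K) (R ε : ℝ) (hε : 0 < ε) :
    ∃ δ > 0, ∀ z y : ESpace N, ‖z‖ ≤ R → ‖y‖ ≤ R → ‖z - y‖ ≤ δ →
      ‖dPsi h hK z - dPsi h hK y‖ ≤ ε := by
  refine Exists.elim (integral_fdot_uniform h hK R ε hε) fun δ Hδ => ?_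
  refine ⟨δ, Hδ.1, fun z y hz hy hzy => ?_⟩
  refine ContinuousLinearMap.opNorm_le_bound _ hε.le fun η => ?_
  rw [sub_apply, Real.norm_eq_abs]
  exact Hδ.2 z y hz hy hzy η

/-- `⟨Ψ'(z), z⟩ = o(‖z‖²)` at the origin. -/
theorem dPsi_small (h : IsNonlin W fu fv) (hK : IsEmbConst N K) (hN : 3 ≤ N) (ε : ℝ) (hε : 0 < ε) :
    ∃ r > 0, ∀ z : ESpace N, ‖z‖ ≤ r → dPsi h hK z z ≤ ε * ‖z‖ ^ 2 := by
  have hK0 := hK.nonneg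
  have hs := hK.two_lt
  obtain ⟨C, hC, H⟩ := h.small_growth hN (ε := ε / (2 * (K * K + 1))) (by positivity)
  have hl : Tendsto (fun r : ℝ => C * K ^ sStar N * r ^ (sStar N - 2)) (𝓝 0)
      (𝓝 (C * K ^ sStar N * 0 ^ (sStar N - 2))) :=
    ((Real.continuous_rpow_const (by linarith)).tendsto 0).const_mul _
  rw [Real.zero_rpow (by linarith), mul_zero] at hl
  obtain ⟨r, hr, Hr⟩ := Metric.eventually_nhds_iff.1 (hl.eventually (gt_mem_nhds (half_pos hε)))
  refine ⟨r / 2, half_pos hr, fun z hz => ?_⟩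
  have j1 := hK.integrable_mul z z
  have j3 := hK.integrable_rpow_mul z z
  have b1 := hK.integral_mul_le z z
  have b3 := hK.integral_rpow_mul_le z z
  have hr' := Hr (y := ‖z‖) (by
    rw [Real.dist_eq, sub_zero, abs_of_nonneg (norm_nonneg z)]; linarith)
  have hz0 : (K * ‖z‖) ^ (sStar N - 1) * (K * ‖z‖) = K ^ sStar N * ‖z‖ ^ (sStar N - 2) * ‖z‖ ^ 2 := by
    have hnz := norm_nonneg z
    rw [Real.mul_rpow hK0 hnz]
    have e1 : K ^ (sStar N - 1) * K = K ^ sStar N := by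
      conv_lhs => rw [← Real.rpow_one K, ← Real.rpow_mul hK0, one_mul]
      rw [← Real.rpow_add' hK0 (by linarith)]; congr 1; ring
    have e2 : ‖z‖ ^ (sStar N - 1) = ‖z‖ ^ (sStar N - 2) * ‖z‖ := by
      conv_rhs => rw [← Real.rpow_one ‖z‖, ← Real.rpow_mul hnz, one_mul]
      rw [← Real.rpow_add' hnz (by linarith)]; congr 1; ring
    rw [e2, ← e1]; ring
  calc dPsi h hK z z ≤ ∫ x, (ε / (2 * (K * K + 1)) * (zabs z x * zabs z x)
        + C * (zabs z x ^ (sStar N - 1) * zabs z x)) := by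
        rw [dPsi_apply]
        refine integral_mono (h.integrable_fdot hK z z)
          ((j1.const_mul _).add (j3.const_mul _)) fun x => ?_
        refine (le_abs_self _).trans ((abs_fdot_le _ _ _ _ _).trans ?_)
        refine (mul_le_mul_of_nonneg_right (H x _ _) (zabs_nonneg z x)).trans_eq ?_
        unfold zabs; ring
    _ = ε / (2 * (K * K + 1)) * (∫ x, zabs z x * zabs z x)
        + C * ∫ x, zabs z x ^ (sStar N - 1) * zabs z x := by
        rw [integral_add (j1.const_mul _) (j3.const_mul _), integral_const_mul, integral_const_mul]
    _ ≤ ε / (2 * (K * K + 1)) * (K * ‖z‖ * (K * ‖z‖))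
        + C * ((K * ‖z‖) ^ (sStar N - 1) * (K * ‖z‖)) := by gcongr
    _ = ε / 2 * (K * K / (K * K + 1)) * ‖z‖ ^ 2
        + C * K ^ sStar N * ‖z‖ ^ (sStar N - 2) * ‖z‖ ^ 2 := by
        rw [hz0]; field_simp
    _ ≤ ε / 2 * 1 * ‖z‖ ^ 2 + ε / 2 * ‖z‖ ^ 2 := by
        gcongr
        rw [div_le_one (by positivity)]; linarith
    _ = ε * ‖z‖ ^ 2 := by ring

end

end HamSys
end

/-! ### Weak continuity of `Ψ'`, Fatou's lemma and the effect of superquadratic growth. -/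

noncomputable section

namespace HamSys

open scoped ENNReal NNReal

/-- The first component as a continuous linear map. -/
def fstE (N : ℕ) : ESpace N →L[ℝ] H1 N := WithLp.fstL 2 ℝ _ _

/-- The second component as a continuous linear map. -/
def sndE (N : ℕ) : ESpace N →L[ℝ] H1 N := WithLp.sndL 2 ℝ _ _

theorem enorm_zabs {N : ℕ} (w : ESpace N) (x : Rn N) :
    ‖zabs w x‖ₑ = ‖val w.fst x‖ₑ + ‖val w.snd x‖ₑ := by
  rw [Real.enorm_of_nonneg (zabs_nonneg w x), zabs, ENNReal.ofReal_add (abs_nonneg _) (abs_nonneg _)]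
  simp [Real.enorm_eq_ofReal_abs]

theorem weakTo_fst_sub {N : ℕ} {z : ℕ → ESpace N} {z₀ : ESpace N} (hz : WeakTo z z₀) :
    WeakTo (fun n => (z n - z₀).fst) 0 := by
  have h := hz.sub_const.map (fstE N)
  rw [map_zero] at h
  exact h

theorem weakTo_snd_sub {N : ℕ} {z : ℕ → ESpace N} {z₀ : ESpace N} (hz : WeakTo z z₀) :
    WeakTo (fun n => (z n - z₀).snd) 0 := by
  have h := hz.sub_const.map (sndE N)
  rw [map_zero] at h
  exact h

theorem lintegral_zabs_mul {N : ℕ} (w : ESpace N) {η : Rn N → ℝ} (hη : MemLp η 2 volume) :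
    ∫⁻ x, ‖zabs w x‖ₑ * ‖η x‖ₑ
      = (∫⁻ x, ‖val w.fst x‖ₑ * ‖η x‖ₑ) + ∫⁻ x, ‖val w.snd x‖ₑ * ‖η x‖ₑ := by
  have hm : AEMeasurable (fun x => ‖val w.fst x‖ₑ * ‖η x‖ₑ) volume :=
    (memLp_val _).1.enorm.mul hη.1.enorm
  refine Eq.trans ?_ (lintegral_add_left' hm _)
  refine lintegral_congr fun x => ?_
  rw [enorm_zabs, add_mul]

theorem rellich_pair {N : ℕ} {z : ℕ → ESpace N} {z₀ : ESpace N} {M : ℝ} (hM : ∀ n, ‖z n‖ ≤ M)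
    (hz : WeakTo z z₀) {η : Rn N → ℝ} (hη : MemLp η 2 volume) :
    Tendsto (fun n => ∫⁻ x, ‖zabs (z n - z₀) x‖ₑ * ‖η x‖ₑ) atTop (𝓝 0) := by
  have hb : ∀ n, ‖z n - z₀‖ ≤ (Real.toNNReal (M + ‖z₀‖) : ℝ) := fun n =>
    ((norm_sub_le _ _).trans (add_le_add (hM n) le_rfl)).trans (Real.le_coe_toNNReal _)
  have h1 := rellich (w := fun n => (z n - z₀).fst)
    (fun n => (WithLp.norm_fst_le _ (z n - z₀)).trans (hb n)) (weakTo_fst_sub hz) hη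
  have h2 := rellich (w := fun n => (z n - z₀).snd)
    (fun n => (WithLp.norm_snd_le _ (z n - z₀)).trans (hb n)) (weakTo_snd_sub hz) hη
  have h := h1.add h2
  rw [add_zero] at h
  exact h.congr fun n => (lintegral_zabs_mul _ hη).symm

/-- Rellich's theorem with the weight `|η| ∈ L²`, which already supplies the decay at infinity. -/
theorem tendsto_integral_zabs {N : ℕ} {K : ℝ} (hK : IsEmbConst N K) {z : ℕ → ESpace N}
    {z₀ : ESpace N} {M : ℝ} (hM : ∀ n, ‖z n‖ ≤ M) (hz : WeakTo z z₀) (η : ESpace N) :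
    Tendsto (fun n => ∫ x, zabs (z n - z₀) x * zabs η x) atTop (𝓝 0) := by
  have h := rellich_pair hM hz (hK.memLp_two η)
  have h2 := (ENNReal.tendsto_toReal ENNReal.zero_ne_top).comp h
  rw [ENNReal.toReal_zero] at h2
  refine h2.congr fun n => ?_
  rw [integral_eq_lintegral_of_nonneg_ae]
  · simp only [Function.comp]
    congr 1
    refine lintegral_congr fun x => ?_
    rw [← enorm_mul, Real.enorm_of_nonneg (mul_nonneg (zabs_nonneg _ x) (zabs_nonneg _ x))]
  · exact Eventually.of_forall fun x => mul_nonneg (zabs_nonneg _ x) (zabs_nonneg _ x)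
  · exact (hK.integrable_mul _ _).1

/-- Weak sequential continuity of `Ψ'`. -/
theorem tendsto_integral_fdot {N : ℕ} {W fu fv : Rn N → ℝ → ℝ → ℝ} {K : ℝ}
    (h : IsNonlin W fu fv) (hK : IsEmbConst N K) {z : ℕ → ESpace N} {z₀ : ESpace N} {M : ℝ}
    (hM : ∀ n, ‖z n‖ ≤ M) (hz : WeakTo z z₀) (η : ESpace N) :
    Tendsto (fun n => ∫ x, fdot fu fv (z n) η x) atTop (𝓝 (∫ x, fdot fu fv z₀ η x)) := by
  have hK0 := hK.nonneg
  rw [Metric.tendsto_atTop']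
  intro ε hε
  obtain ⟨R, hR, hzR, hz₀R⟩ : ∃ R : ℝ, 0 ≤ R ∧ (∀ n, ‖z n‖ ≤ R) ∧ ‖z₀‖ ≤ R :=
    ⟨max M ‖z₀‖, (norm_nonneg z₀).trans (le_max_right _ _), fun n => (hM n).trans (le_max_left _ _),
      le_max_right _ _⟩
  obtain ⟨A, hA0, hA⟩ : ∃ A : ℝ, 0 ≤ A ∧
      (2 * (K * R) + 2 * (K * R) ^ (sStar N - 1)) * (K * ‖η‖) = A := by
    refine ⟨_, ?_, rfl⟩
    have h1 : 0 ≤ K * R := mul_nonneg hK0 hR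
    have h2 := Real.rpow_nonneg h1 (sStar N - 1)
    exact mul_nonneg (by linarith) (mul_nonneg hK0 (norm_nonneg _))
  have hε' : 0 < ε / (2 * (A + 1)) := by positivity
  obtain ⟨C, hC, H⟩ := h.gradient_sub_le hε'
  have hlim := (tendsto_integral_zabs hK hM hz η).const_mul C
  rw [mul_zero] at hlim
  obtain ⟨n₀, hn₀⟩ := eventually_atTop.1 (hlim.eventually (gt_mem_nhds (half_pos hε)))
  refine ⟨n₀, fun n hn => ?_⟩
  have h1 := abs_integral_fdot_sub_le h hK H hε'.le (hzR n) hz₀R η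
  rw [hA] at h1
  rw [Real.dist_eq]
  refine lt_of_le_of_lt h1 ?_
  have h2 := hn₀ n hn.le
  have h3 : ε / (2 * (A + 1)) * A ≤ ε / 2 := by
    rw [div_mul_eq_mul_div, div_le_div_iff₀ (by positivity) (by norm_num)]
    nlinarith
  linarith

/-- A strictly positive function in `L²(ℝ^N)`. -/
theorem exists_pos_memLp_two (N : ℕ) :
    ∃ η : Rn N → ℝ, (∀ x, 0 < η x) ∧ MemLp η 2 volume := by
  obtain ⟨g, hg0, hgm, hg⟩ := exists_pos_lintegral_lt_of_sigmaFinite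
    (volume : Measure (Rn N)) one_ne_zero
  refine ⟨fun x => √(g x), fun x => Real.sqrt_pos.2 (hg0 x), ?_⟩
  have hm : AEStronglyMeasurable (fun x => √(g x : ℝ)) (volume : Measure (Rn N)) :=
    (Real.continuous_sqrt.measurable.comp hgm.coe_nnreal_real).aestronglyMeasurable
  rw [memLp_two_iff_integrable_sq hm]
  simp_rw [Real.sq_sqrt (NNReal.coe_nonneg _)]
  refine ⟨hgm.coe_nnreal_real.aestronglyMeasurable, ?_⟩
  rw [hasFiniteIntegral_iff_ofReal (Eventually.of_forall fun x => NNReal.coe_nonneg _)]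
  simp_rw [ENNReal.ofReal_coe_nnreal]
  exact hg.trans ENNReal.one_lt_top

/-- Weakly convergent sequences converge almost everywhere along a subsequence. -/
theorem exists_subseq_ae_tendsto {N : ℕ} {z : ℕ → ESpace N} {z₀ : ESpace N} {M : ℝ}
    (hM : ∀ n, ‖z n‖ ≤ M) (hz : WeakTo z z₀) :
    ∃ φ : ℕ → ℕ, StrictMono φ ∧ ∀ᵐ x, Tendsto (fun n => val (z (φ n)).fst x) atTop
      (𝓝 (val z₀.fst x)) ∧ Tendsto (fun n => val (z (φ n)).snd x) atTop (𝓝 (val z₀.snd x)) := by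
  obtain ⟨η, hη0, hη⟩ := exists_pos_memLp_two N
  have h := rellich_pair hM hz hη
  -- The weight is positive everywhere, so one extraction yields convergence almost everywhere on
  -- the whole space, without a diagonal argument over balls.
  have hm : TendstoInMeasure volume (fun n x => zabs (z n - z₀) x * η x) atTop (fun _ => 0) := by
    refine tendstoInMeasure_of_tendsto_eLpNorm_of_ne_top (p := 1) one_ne_zero ENNReal.one_ne_top
      (fun n => (aestronglyMeasurable_zabs _).mul hη.1) aestronglyMeasurable_const ?_
    refine h.congr fun n => ?_
    rw [eLpNorm_one_eq_lintegral_enorm]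
    refine lintegral_congr fun x => ?_
    simp [enorm_mul]
  obtain ⟨φ, hφ, hae⟩ := hm.exists_seq_tendsto_ae
  refine ⟨φ, hφ, ?_⟩
  have hall : ∀ᵐ x, ∀ n, zabs (z n - z₀) x
      = |val (z n).fst x - val z₀.fst x| + |val (z n).snd x - val z₀.snd x| :=
    ae_all_iff.2 fun n => zabs_sub (z n) z₀
  filter_upwards [hae, hall] with x hx hx'
  have h1 : Tendsto (fun n => zabs (z (φ n) - z₀) x) atTop (𝓝 0) := by
    have := hx.mul_const (η x)⁻¹
    simpa [mul_assoc, mul_inv_cancel₀ (hη0 x).ne'] using this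
  simp_rw [hx'] at h1
  constructor
  · rw [tendsto_iff_dist_tendsto_zero]
    refine squeeze_zero (fun n => dist_nonneg) (fun n => ?_) h1
    rw [Real.dist_eq]
    linarith [abs_nonneg (val (z (φ n)).snd x - val z₀.snd x)]
  · rw [tendsto_iff_dist_tendsto_zero]
    refine squeeze_zero (fun n => dist_nonneg) (fun n => ?_) h1
    rw [Real.dist_eq]
    linarith [abs_nonneg (val (z (φ n)).fst x - val z₀.fst x)]

/-- Fatou's lemma for nonnegative integrable functions with convergent integrals. -/
theorem integral_le_of_ae_tendsto {α : Type*} [MeasurableSpace α] {μ : Measure α}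
    {F : ℕ → α → ℝ} {F₀ : α → ℝ} (hF0 : ∀ n x, 0 ≤ F n x) (h0 : ∀ x, 0 ≤ F₀ x)
    (hFi : ∀ n, Integrable (F n) μ) (hi : Integrable F₀ μ)
    (hlim : ∀ᵐ x ∂μ, Tendsto (fun n => F n x) atTop (𝓝 (F₀ x))) {c : ℝ}
    (hc : Tendsto (fun n => ∫ x, F n x ∂μ) atTop (𝓝 c)) : ∫ x, F₀ x ∂μ ≤ c := by
  have hc0 : 0 ≤ c := ge_of_tendsto' hc fun n => integral_nonneg (hF0 _)
  rw [← ENNReal.ofReal_le_ofReal_iff hc0,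
    ofReal_integral_eq_lintegral_ofReal hi (Eventually.of_forall h0)]
  calc ∫⁻ x, ENNReal.ofReal (F₀ x) ∂μ
      = ∫⁻ x, liminf (fun n => ENNReal.ofReal (F n x)) atTop ∂μ := by
        refine lintegral_congr_ae ?_
        filter_upwards [hlim] with x hx
        exact (ENNReal.tendsto_ofReal hx).liminf_eq.symm
    _ ≤ liminf (fun n => ∫⁻ x, ENNReal.ofReal (F n x) ∂μ) atTop :=
        lintegral_liminf_le' fun n => (hFi _).1.aemeasurable.ennreal_ofReal
    _ = ENNReal.ofReal c := by
        refine Tendsto.liminf_eq ((ENNReal.tendsto_ofReal hc).congr fun n => ?_)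
        exact ofReal_integral_eq_lintegral_ofReal (hFi n) (Eventually.of_forall (hF0 n))

/-- Nonnegative functions with bounded integrals cannot diverge on a set of positive measure. -/
theorem ae_not_tendsto_atTop {α : Type*} [MeasurableSpace α] {μ : Measure α}
    {G : ℕ → α → ℝ} (hG0 : ∀ n x, 0 ≤ G n x) (hGi : ∀ n, Integrable (G n) μ) {C : ℝ}
    (hGC : ∀ n, ∫ x, G n x ∂μ ≤ C) : ∀ᵐ x ∂μ, ¬ Tendsto (fun n => G n x) atTop atTop := by
  have hm : ∀ n, AEMeasurable (fun x => ENNReal.ofReal (G n x)) μ := fun n =>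
    (hGi n).1.aemeasurable.ennreal_ofReal
  have hfin : ∫⁻ x, liminf (fun n => (hm n).mk _ x) atTop ∂μ ≤ ENNReal.ofReal C := by
    refine (lintegral_liminf_le fun n => (hm n).measurable_mk).trans ?_
    refine liminf_le_of_frequently_le' (Frequently.of_forall fun n => ?_)
    rw [← lintegral_congr_ae (hm n).ae_eq_mk,
      ← ofReal_integral_eq_lintegral_ofReal (hGi n) (Eventually.of_forall (hG0 n))]
    exact ENNReal.ofReal_le_ofReal (hGC n)
  have hlt := ae_lt_top (Measurable.liminf fun n => (hm n).measurable_mk)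
    (hfin.trans_lt ENNReal.ofReal_lt_top).ne
  filter_upwards [hlt, ae_all_iff.2 fun n => (hm n).ae_eq_mk] with x hx hx' hT
  simp_rw [← hx'] at hx
  exact hx.ne (ENNReal.tendsto_ofReal_atTop.comp hT).liminf_eq

/-- The density of `½ ⟨Ψ'(z), z⟩ - Ψ(z)`. -/
def halfSub {N : ℕ} (W fu fv : Rn N → ℝ → ℝ → ℝ) (w : ESpace N) (x : Rn N) : ℝ :=
  1 / 2 * fdot fu fv w w x - W x (val w.fst x) (val w.snd x)

theorem integrable_halfSub {N : ℕ} {W fu fv : Rn N → ℝ → ℝ → ℝ} {K : ℝ}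
    (h : IsNonlin W fu fv) (hK : IsEmbConst N K) (w : ESpace N) :
    Integrable (halfSub W fu fv w) volume :=
  ((h.integrable_fdot hK w w).const_mul _).sub (h.integrable hK w)

theorem integral_halfSub {N : ℕ} {W fu fv : Rn N → ℝ → ℝ → ℝ} {K : ℝ}
    (h : IsNonlin W fu fv) (hK : IsEmbConst N K) (w : ESpace N) :
    ∫ x, halfSub W fu fv w x = 1 / 2 * (∫ x, fdot fu fv w w x) - Psi W w := by
  refine (integral_sub ((h.integrable_fdot hK w w).const_mul _) (h.integrable hK w)).trans ?_
  rw [integral_const_mul]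
  rfl

/-- Fatou's lemma for `½ ⟨Ψ'(z), z⟩ - Ψ(z)` along weakly convergent sequences. -/
theorem fatou_half_sub {N : ℕ} {W fu fv : Rn N → ℝ → ℝ → ℝ} {K : ℝ}
    (h : IsNonlin W fu fv) (hK : IsEmbConst N K) {z : ℕ → ESpace N} {z₀ : ESpace N} {M : ℝ}
    (hM : ∀ n, ‖z n‖ ≤ M) (hz : WeakTo z z₀) {c : ℝ}
    (hc : Tendsto (fun n => 1 / 2 * (∫ x, fdot fu fv (z n) (z n) x) - Psi W (z n)) atTop (𝓝 c)) :
    1 / 2 * (∫ x, fdot fu fv z₀ z₀ x) - Psi W z₀ ≤ c := by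
  refine Exists.elim (exists_subseq_ae_tendsto hM hz) fun φ hφ => ?_
  have hc' : Tendsto (fun n => ∫ x, halfSub W fu fv (z (φ n)) x) atTop (𝓝 c) :=
    (hc.comp hφ.1.tendsto_atTop).congr fun n => (integral_halfSub h hK _).symm
  rw [← integral_halfSub h hK]
  -- `le_half` makes the density nonnegative, as Fatou's lemma requires.
  refine integral_le_of_ae_tendsto (fun n x => sub_nonneg.2 (h.le_half _ _ _))
    (fun x => sub_nonneg.2 (h.le_half _ _ _)) (fun n => integrable_halfSub h hK _)
    (integrable_halfSub h hK _) ?_ hc'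
  filter_upwards [hφ.2] with x hx
  have hp : Tendsto (fun n => ((x, val (z (φ n)).fst x, val (z (φ n)).snd x) : Rn N × ℝ × ℝ))
      atTop (𝓝 (x, val z₀.fst x, val z₀.snd x)) :=
    tendsto_const_nhds.prodMk_nhds (hx.1.prodMk_nhds hx.2)
  have t1 := (h.cont_fu.tendsto _).comp hp
  have t2 := (h.cont_fv.tendsto _).comp hp
  have t3 := (h.cont.tendsto _).comp hp
  exact (((t1.mul hx.1).add (t2.mul hx.2)).const_mul (1 / 2)).sub t3

/-- Quadratic growth of `Ψ` along a ray is only possible in `E⁻`. -/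
theorem ae_eq_zero_of_Psi_le {N : ℕ} {W fu fv : Rn N → ℝ → ℝ → ℝ} {K a b : ℝ}
    (h : IsNonlin W fu fv) (hK : IsEmbConst N K) (hW2 : CondW2 a b W) {z : ESpace N} {C : ℝ}
    (hC : ∀ n : ℕ, Psi W (((n : ℝ) + 1) • z) ≤ C * ((n : ℝ) + 1) ^ 2) :
    ∀ᵐ x, a * val z.fst x + b * val z.snd x = 0 := by
  -- The functions `W(x,(n+1)z)/(n+1)²` have bounded integrals, so they cannot diverge on a set of
  -- positive measure; `CondW2` makes them diverge almost everywhere on `{au + bv ≠ 0}`.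
  set G : ℕ → Rn N → ℝ := fun n x =>
    W x (((n : ℝ) + 1) * val z.fst x) (((n : ℝ) + 1) * val z.snd x) / ((n : ℝ) + 1) ^ 2 with hG
  have hWe : ∀ n : ℕ, (fun x => W x (val (((n : ℝ) + 1) • z).fst x) (val (((n : ℝ) + 1) • z).snd x))
      =ᵐ[volume] fun x => W x (((n : ℝ) + 1) * val z.fst x) (((n : ℝ) + 1) * val z.snd x) := by
    intro n
    filter_upwards [val_smul ((n : ℝ) + 1) z.fst, val_smul ((n : ℝ) + 1) z.snd] with x h1 h2
    simp only [WithLp.smul_fst, WithLp.smul_snd, h1, h2]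
  have hGi : ∀ n, Integrable (G n) volume := fun n =>
    ((h.integrable hK (((n : ℝ) + 1) • z)).congr (hWe n)).div_const _
  have hG0 : ∀ n x, 0 ≤ G n x := fun n x => div_nonneg (h.nonneg _ _ _) (by positivity)
  have hGC : ∀ n, ∫ x, G n x ≤ C := by
    intro n
    rw [hG, integral_div, ← integral_congr_ae (hWe n), div_le_iff₀ (by positivity)]
    exact hC n
  filter_upwards [ae_not_tendsto_atTop hG0 hGi hGC, hW2] with x hx hxW
  by_contra hne
  have hd : 0 < |a * val z.fst x + b * val z.snd x| := abs_pos.2 hne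
  have hn1 : Tendsto (fun n : ℕ => (n : ℝ) + 1) atTop atTop :=
    tendsto_natCast_atTop_atTop.atTop_add tendsto_const_nhds
  have e : ∀ n : ℕ, |a * (((n : ℝ) + 1) * val z.fst x) + b * (((n : ℝ) + 1) * val z.snd x)|
      = ((n : ℝ) + 1) * |a * val z.fst x + b * val z.snd x| := fun n => by
    rw [← abs_of_nonneg (show (0 : ℝ) ≤ (n : ℝ) + 1 by positivity), ← abs_mul]
    congr 1
    rw [abs_of_nonneg (show (0 : ℝ) ≤ (n : ℝ) + 1 by positivity)]; ring
  have ht : Tendsto (fun n : ℕ => ((((n : ℝ) + 1) * val z.fst x, ((n : ℝ) + 1) * val z.snd x) : ℝ × ℝ))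
      atTop (comap (fun z : ℝ × ℝ => |a * z.1 + b * z.2|) atTop) := by
    rw [tendsto_comap_iff]
    simp only [Function.comp_def, e]
    exact hn1.atTop_mul_const hd
  have hT := (hxW.comp ht).atTop_mul_const (pow_pos hd 2)
  have hGT : Tendsto (fun n => G n x) atTop atTop := by
    refine hT.congr fun n => ?_
    simp only [Function.comp, e, hG, abs_of_nonneg (h.nonneg _ _ _)]
    have h1 : ((n : ℝ) + 1) ≠ 0 := by positivity
    have h2 := hd.ne'
    generalize |a * val z.fst x + b * val z.snd x| = d at h2 ⊢
    field_simp
  exact hx hGT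

end HamSys
end

/-! ### The abstract strongly indefinite functional: smoothness and maximization over negative
directions. -/

noncomputable section

namespace HamSys

/-- A strongly indefinite functional `½ B(z,z) - Ψ(z)` on a space split by `iP` and `iM` into a part
on which `B` is positive definite and a part on which it is negative definite, with a convex
perturbation `Ψ` subject to a monotonicity condition of Nehari type. -/
structure Saddle (X E : Type*) [NormedAddCommGroup X] [InnerProductSpace ℝ X]
    [NormedAddCommGroup E] [NormedSpace ℝ E] where
  B : E →L[ℝ] E →L[ℝ] ℝ
  Ψ : E → ℝ
  dΨ : E → E →L[ℝ] ℝ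
  iP : X →L[ℝ] E
  iM : X →L[ℝ] E
  πP : E →L[ℝ] X
  c : ℝ
  c_pos : 0 < c
  symm : ∀ z y, B z y = B y z
  decomp : ∀ z, ∃ m, z = iP (πP z) + iM m
  πP_iP : ∀ p, πP (iP p) = p
  πP_iM : ∀ m, πP (iM m) = 0
  pos : ∀ p, c * ‖p‖ ^ 2 ≤ B (iP p) (iP p)
  neg : ∀ m, B (iM m) (iM m) ≤ -(c * ‖m‖ ^ 2)
  nonneg : ∀ z, 0 ≤ Ψ z
  zero : Ψ 0 = 0
  key : ∀ z y (t : ℝ), 0 ≤ Ψ y - Ψ z + (1 + t ^ 2) / 2 * dΨ z z - t * dΨ z y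
  unif : ∀ R ε : ℝ, 0 < ε → ∃ δ > 0, ∀ z y, ‖z‖ ≤ R → ‖y‖ ≤ R → ‖z - y‖ ≤ δ →
    ‖dΨ z - dΨ y‖ ≤ ε
  small : ∀ ε : ℝ, 0 < ε → ∃ r > 0, ∀ z, ‖z‖ ≤ r → dΨ z z ≤ ε * ‖z‖ ^ 2

namespace Saddle

variable {X E : Type*} [NormedAddCommGroup X] [InnerProductSpace ℝ X]
    [NormedAddCommGroup E] [NormedSpace ℝ E] (S : Saddle X E)

/-- The functional `½ B(z,z) - Ψ(z)`. -/
def Φ (z : E) : ℝ := 1 / 2 * S.B z z - S.Ψ z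

/-- The derivative of the functional. -/
def dΦ (z : E) : E →L[ℝ] ℝ := S.B z - S.dΨ z

theorem dΦ_apply (z y : E) : S.dΦ z y = S.B z y - S.dΨ z y := rfl

theorem Ψ_add_ge (z η : E) : S.Ψ z + S.dΨ z η ≤ S.Ψ (z + η) := by
  have h := S.key z (z + η) 1
  rw [map_add] at h
  linarith

theorem Ψ_le_half (z : E) : S.Ψ z ≤ 1 / 2 * S.dΨ z z := by
  have h := S.key z 0 0
  rw [S.zero, map_zero] at h
  linarith

/-- The key inequality with `y = s z`, `t = s` gives `Ψ(sz) ≥ Ψ(z) + ½(s² - 1)⟨Ψ'(z),z⟩`, and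
`⟨Ψ'(z),z⟩ ≥ 2Ψ(z)`. -/
theorem sq_mul_Ψ_le (z : E) {s : ℝ} (hs : 1 ≤ s) : s ^ 2 * S.Ψ z ≤ S.Ψ (s • z) := by
  have h := S.key z (s • z) s
  rw [map_smul, smul_eq_mul] at h
  have h2 := S.Ψ_le_half z
  nlinarith [mul_nonneg (show 0 ≤ s ^ 2 - 1 by nlinarith) (sub_nonneg.2 h2)]

/-- Convexity bounds the first-order remainder between zero and `⟨Ψ'(z+η) - Ψ'(z), η⟩`; uniform
continuity of `Ψ'` then gives differentiability. -/
theorem hasFDerivAt_Ψ (z : E) : HasFDerivAt S.Ψ (S.dΨ z) z := by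
  rw [hasFDerivAt_iff_isLittleO_nhds_zero, Asymptotics.isLittleO_iff]
  intro ε hε
  obtain ⟨δ, hδ, H⟩ := S.unif (‖z‖ + 1) ε hε
  have hb : Metric.ball (0 : E) (min δ 1) ∈ 𝓝 (0 : E) := Metric.ball_mem_nhds _ (by positivity)
  filter_upwards [hb] with η hη
  rw [mem_ball_zero_iff, lt_min_iff] at hη
  have h1 := S.Ψ_add_ge z η
  have h2 := S.Ψ_add_ge (z + η) (-η)
  rw [add_neg_cancel_right, map_neg] at h2
  have h3 := H (z + η) z ((norm_add_le _ _).trans (by linarith)) (by linarith)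
    (by rw [add_sub_cancel_left]; exact hη.1.le)
  have h4 := (S.dΨ (z + η) - S.dΨ z).le_opNorm η
  rw [sub_apply, Real.norm_eq_abs] at h4
  have h5 := mul_le_mul_of_nonneg_right h3 (norm_nonneg η)
  rw [Real.norm_eq_abs, abs_of_nonneg (by linarith)]
  linarith [le_abs_self (S.dΨ (z + η) η - S.dΨ z η)]

theorem hasFDerivAt_Φ (z : E) : HasFDerivAt S.Φ (S.dΦ z) z := by
  have h1 : HasFDerivAt (fun z => S.B z z) (S.B z + S.B.flip z) z := by
    have := (S.B.hasFDerivAt (x := z)).clm_apply (hasFDerivAt_id z)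
    simpa using this
  have h2 : HasFDerivAt (fun z => 1 / 2 * S.B z z) (S.B z) z := by
    refine (h1.const_mul (1 / 2)).congr_fderiv ?_
    ext y
    simp only [smul_apply, add_apply, ContinuousLinearMap.flip_apply, S.symm y z, smul_eq_mul]
    ring
  exact h2.sub (S.hasFDerivAt_Ψ z)

theorem continuous_Φ : Continuous S.Φ :=
  continuous_iff_continuousAt.2 fun z => (S.hasFDerivAt_Φ z).continuousAt

/-- Uniform continuity on a ball gives boundedness by walking from `0` to `z` in finitely many steps
of length at most `δ`, here via `z ↦ n/(n+1) z`. -/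
theorem exists_norm_dΨ_le (R : ℝ) : ∃ D, ∀ z, ‖z‖ ≤ R → ‖S.dΨ z‖ ≤ D := by
  obtain ⟨δ, hδ, H⟩ := S.unif R 1 one_pos
  have key : ∀ n : ℕ, ∀ z, ‖z‖ ≤ R → ‖z‖ ≤ n * δ → ‖S.dΨ z‖ ≤ ‖S.dΨ 0‖ + n := by
    intro n
    induction n with
    | zero =>
      intro z _ hz
      have : z = 0 := by simpa using hz
      simp [this]
    | succ n ih =>
      intro z hzR hz
      push_cast at hz ⊢
      have hn : (0 : ℝ) < (n : ℝ) + 1 := by positivity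
      set y := ((n : ℝ) / (n + 1)) • z with hy
      have e1 : ‖y‖ = (n : ℝ) / (n + 1) * ‖z‖ := by
        rw [hy, norm_smul, Real.norm_of_nonneg (by positivity)]
      have e2 : ‖z - y‖ = 1 / ((n : ℝ) + 1) * ‖z‖ := by
        have : z - y = (1 / ((n : ℝ) + 1)) • z := by
          have h1 : (1 : ℝ) - n / (n + 1) = 1 / (n + 1) := by field_simp; ring
          rw [hy, ← h1, sub_smul, one_smul]
        rw [this, norm_smul, Real.norm_of_nonneg (by positivity)]
      have b1 : ‖y‖ ≤ ‖z‖ := by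
        rw [e1]
        refine mul_le_of_le_one_left (norm_nonneg z) ?_
        rw [div_le_one hn]; linarith
      have b2 : ‖y‖ ≤ n * δ := by
        rw [e1, div_mul_eq_mul_div, div_le_iff₀ hn, mul_assoc]
        exact mul_le_mul_of_nonneg_left (by linarith) (by positivity)
      have b3 : ‖z - y‖ ≤ δ := by
        rw [e2, div_mul_eq_mul_div, div_le_iff₀ hn]; linarith
      have h1 := ih y (b1.trans hzR) b2
      have h2 := H z y hzR (b1.trans hzR) b3
      have h3 := norm_add_le (S.dΨ z - S.dΨ y) (S.dΨ y)
      rw [sub_add_cancel] at h3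
      linarith
  obtain ⟨n, hn⟩ := exists_nat_ge (R / δ)
  exact ⟨‖S.dΨ 0‖ + n, fun z hz => key n z hz (hz.trans ((div_le_iff₀ hδ).1 hn))⟩

theorem unif_dΦ (R ε : ℝ) (hε : 0 < ε) : ∃ δ > 0, ∀ z y, ‖z‖ ≤ R → ‖y‖ ≤ R → ‖z - y‖ ≤ δ →
    ‖S.dΦ z - S.dΦ y‖ ≤ ε := by
  obtain ⟨δ, hδ, H⟩ := S.unif R (ε / 2) (half_pos hε)
  refine ⟨min δ (ε / (2 * (‖S.B‖ + 1))), by positivity, fun z y hz hy hzy => ?_⟩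
  have h1 := H z y hz hy (hzy.trans (min_le_left _ _))
  have h2 : ‖S.B z - S.B y‖ ≤ ε / 2 := by
    rw [← map_sub]
    refine (S.B.le_opNorm _).trans ?_
    have := hzy.trans (min_le_right _ _)
    rw [le_div_iff₀ (by positivity)] at this
    nlinarith [norm_nonneg (z - y), norm_nonneg S.B]
  have e : S.dΦ z - S.dΦ y = (S.B z - S.B y) - (S.dΨ z - S.dΨ y) := by
    unfold dΦ; abel
  rw [e]
  exact (norm_sub_le _ _).trans (by linarith)

theorem exists_norm_dΦ_le (R : ℝ) : ∃ D, 0 ≤ D ∧ ∀ z, ‖z‖ ≤ R → ‖S.dΦ z‖ ≤ D := by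
  obtain ⟨D, hD⟩ := S.exists_norm_dΨ_le R
  refine ⟨max (‖S.B‖ * R + D) 0, le_max_right _ _, fun z hz => le_trans ?_ (le_max_left _ _)⟩
  refine (norm_sub_le _ _).trans (add_le_add ?_ (hD z hz))
  exact (S.B.le_opNorm z).trans (mul_le_mul_of_nonneg_left hz (norm_nonneg _))

/-- The fundamental inequality comparing `Φ` at `z` and at `t z + m` with `m` in the negative
space. -/
theorem Φ_smul_add_le (z : E) (t : ℝ) (m : X) :
    S.Φ (t • z + S.iM m) + (1 - t ^ 2) / 2 * S.dΦ z z - t * S.dΦ z (S.iM m)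
      + S.c / 2 * ‖m‖ ^ 2 ≤ S.Φ z := by
  have h := S.key z (t • z + S.iM m) t
  have hn := S.neg m
  have hs := S.symm z (S.iM m)
  simp only [Φ, dΦ_apply, map_add, map_smul, smul_eq_mul, add_apply, smul_apply] at h ⊢
  rw [← hs]
  nlinarith

/-- The case `t = 1`: `Φ` is strongly concave in the negative directions. -/
theorem Φ_add_le (z : E) (m : X) :
    S.Φ (z + S.iM m) ≤ S.Φ z + S.dΦ z (S.iM m) - S.c / 2 * ‖m‖ ^ 2 := by
  have h := S.Φ_smul_add_le z 1 m
  rw [one_smul] at h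
  linarith

/-- Strong concavity makes every maximizing sequence Cauchy, through the midpoint inequality. Weak
compactness is not involved. -/
theorem exists_isMax [CompleteSpace X] (p : X) :
    ∃ m, ∀ m', S.Φ (S.iP p + S.iM m') ≤ S.Φ (S.iP p + S.iM m) := by
  have hc := S.c_pos
  set f : X → ℝ := fun m => S.Φ (S.iP p + S.iM m) with hf
  have hfc : Continuous f := S.continuous_Φ.comp (continuous_const.add S.iM.continuous)
  -- Compare the midpoint with itself plus and minus half the difference; the first-order terms
  -- cancel on adding.
  have hmid : ∀ m m', 1 / 2 * (f m + f m') + S.c / 8 * ‖m - m'‖ ^ 2 ≤ f ((1 / 2 : ℝ) • (m + m')) := by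
    intro m m'
    have h1 := S.Φ_add_le (S.iP p + S.iM ((1 / 2 : ℝ) • (m + m'))) ((1 / 2 : ℝ) • (m - m'))
    have h2 := S.Φ_add_le (S.iP p + S.iM ((1 / 2 : ℝ) • (m + m'))) (-((1 / 2 : ℝ) • (m - m')))
    have e1 : S.iP p + S.iM ((1 / 2 : ℝ) • (m + m')) + S.iM ((1 / 2 : ℝ) • (m - m'))
        = S.iP p + S.iM m := by
      rw [add_assoc, ← map_add]; congr 2; module
    have e2 : S.iP p + S.iM ((1 / 2 : ℝ) • (m + m')) + S.iM (-((1 / 2 : ℝ) • (m - m')))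
        = S.iP p + S.iM m' := by
      rw [add_assoc, ← map_add]; congr 2; module
    have e3 : ‖(1 / 2 : ℝ) • (m - m')‖ = 1 / 2 * ‖m - m'‖ := by
      rw [norm_smul]; norm_num
    rw [e1, e3] at h1
    rw [e2, norm_neg, e3, map_neg, map_neg] at h2
    simp only [hf]
    nlinarith
  have hbdd : BddAbove (Set.range f) := by
    refine ⟨f 0 + (‖S.dΦ (S.iP p)‖ * ‖S.iM‖) ^ 2 / (2 * S.c), ?_⟩
    rintro _ ⟨m, rfl⟩
    have h := S.Φ_add_le (S.iP p) m
    have h1 : S.dΦ (S.iP p) (S.iM m) ≤ ‖S.dΦ (S.iP p)‖ * ‖S.iM‖ * ‖m‖ := by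
      refine (le_abs_self _).trans (((S.dΦ (S.iP p)).le_opNorm _).trans ?_)
      rw [mul_assoc]
      exact mul_le_mul_of_nonneg_left (S.iM.le_opNorm m) (norm_nonneg _)
    have h0 : f 0 = S.Φ (S.iP p) := by simp [hf]
    rw [h0]
    refine h.trans ?_
    generalize ‖S.dΦ (S.iP p)‖ * ‖S.iM‖ = A at h1 ⊢
    have : A * ‖m‖ - S.c / 2 * ‖m‖ ^ 2 ≤ A ^ 2 / (2 * S.c) := by
      rw [le_div_iff₀ (by positivity)]
      nlinarith [sq_nonneg (A - S.c * ‖m‖)]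
    linarith
  set s := sSup (Set.range f) with hs
  have hle : ∀ m, f m ≤ s := fun m => le_csSup hbdd ⟨m, rfl⟩
  have hex : ∀ n : ℕ, ∃ m, s - 1 / ((n : ℝ) + 1) < f m := fun n => by
    obtain ⟨_, ⟨m, rfl⟩, hm⟩ := exists_lt_of_lt_csSup (Set.range_nonempty f)
      (show s - 1 / ((n : ℝ) + 1) < s by
        have : (0 : ℝ) < 1 / ((n : ℝ) + 1) := by positivity
        linarith)
    exact ⟨m, hm⟩
  choose m hm using hex
  have hlim : Tendsto (fun n : ℕ => 1 / ((n : ℝ) + 1)) atTop (𝓝 0) :=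
    tendsto_one_div_add_atTop_nhds_zero_nat
  have hcau : CauchySeq m := by
    refine cauchySeq_of_le_tendsto_0 (fun n : ℕ => √(8 / S.c * (1 / ((n : ℝ) + 1)))) ?_ ?_
    · intro n k N hn hk
      rw [dist_eq_norm]
      refine Real.le_sqrt_of_sq_le ?_
      have h1 := hmid (m n) (m k)
      have h2 := hle ((1 / 2 : ℝ) • (m n + m k))
      have h3 : 1 / ((n : ℝ) + 1) ≤ 1 / ((N : ℝ) + 1) := by gcongr
      have h4 : 1 / ((k : ℝ) + 1) ≤ 1 / ((N : ℝ) + 1) := by gcongr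
      rw [div_mul_eq_mul_div, le_div_iff₀ hc]
      linarith [hm n, hm k]
    · have := (hlim.const_mul (8 / S.c)).sqrt
      simpa using this
  obtain ⟨l, hl⟩ := cauchySeq_tendsto_of_complete hcau
  refine ⟨l, fun m' => (hle m').trans ?_⟩
  refine le_of_tendsto_of_tendsto ?_ ((hfc.tendsto l).comp hl) (Eventually.of_forall fun n => (hm n).le)
  simpa using hlim.const_sub s

theorem exists_critical [CompleteSpace X] (p : X) :
    ∃ m, ∀ h, S.dΦ (S.iP p + S.iM m) (S.iM h) = 0 := by
  obtain ⟨m, hm⟩ := S.exists_isMax p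
  refine ⟨m, fun h => ?_⟩
  have hd : HasFDerivAt (fun m => S.Φ (S.iP p + S.iM m))
      ((S.dΦ (S.iP p + S.iM m)).comp S.iM) m :=
    (S.hasFDerivAt_Φ _).comp m ((S.iM.hasFDerivAt (x := m)).const_add (S.iP p))
  have h0 := IsLocalMax.hasFDerivAt_eq_zero (Eventually.of_forall hm) hd
  exact DFunLike.congr_fun h0 h

theorem Φ_zero : S.Φ 0 = 0 := by simp [Φ, S.zero]

theorem abs_B_le (z y : E) : |S.B z y| ≤ ‖S.B‖ * ‖z‖ * ‖y‖ := S.B.le_opNorm₂ z y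

theorem continuous_dΦ : Continuous S.dΦ := by
  rw [Metric.continuous_iff]
  intro z ε hε
  obtain ⟨δ, hδ, H⟩ := S.unif_dΦ (‖z‖ + 1) (ε / 2) (half_pos hε)
  refine ⟨min δ 1, by positivity, fun q hq => ?_⟩
  rw [dist_eq_norm, lt_min_iff] at hq
  rw [dist_eq_norm]
  have h1 : ‖q‖ ≤ ‖z‖ + 1 := by
    have := norm_add_le (q - z) z
    rw [sub_add_cancel] at this
    linarith
  exact (H q z h1 (by linarith) hq.1.le).trans_lt (half_lt_self hε)

/-- Upper bound for the quadratic form in terms of the two components. -/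
theorem exists_B_le : ∃ A, 0 < A ∧ ∀ p m : X,
    1 / 2 * S.B (S.iP p + S.iM m) (S.iP p + S.iM m) ≤ A * ‖p‖ ^ 2 - S.c / 4 * ‖m‖ ^ 2 := by
  have hc := S.c_pos
  set α := ‖S.B‖ * ‖S.iP‖ * ‖S.iP‖ with hα
  set β := ‖S.B‖ * ‖S.iP‖ * ‖S.iM‖ with hβ
  have hα0 : 0 ≤ α := by positivity
  refine ⟨α / 2 + β ^ 2 / S.c + 1, by positivity, fun p m => ?_⟩
  have h1 : S.B (S.iP p) (S.iP p) ≤ α * ‖p‖ ^ 2 := by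
    refine (le_abs_self _).trans ((S.abs_B_le _ _).trans ?_)
    have := S.iP.le_opNorm p
    calc ‖S.B‖ * ‖S.iP p‖ * ‖S.iP p‖ ≤ ‖S.B‖ * (‖S.iP‖ * ‖p‖) * (‖S.iP‖ * ‖p‖) := by gcongr
      _ = _ := by rw [hα]; ring
  have h2 : S.B (S.iP p) (S.iM m) ≤ β * ‖p‖ * ‖m‖ := by
    refine (le_abs_self _).trans ((S.abs_B_le _ _).trans ?_)
    have h3 := S.iP.le_opNorm p
    have h4 := S.iM.le_opNorm m
    calc ‖S.B‖ * ‖S.iP p‖ * ‖S.iM m‖ ≤ ‖S.B‖ * (‖S.iP‖ * ‖p‖) * (‖S.iM‖ * ‖m‖) := by gcongr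
      _ = _ := by rw [hβ]; ring
  have h3 := S.neg m
  -- Young's inequality spends half of the negative term `½ c ‖m‖²` on the cross term and keeps
  -- `c/4`.
  have h4 : β * ‖p‖ * ‖m‖ ≤ β ^ 2 / S.c * ‖p‖ ^ 2 + S.c / 4 * ‖m‖ ^ 2 := by
    have : β ^ 2 / S.c * ‖p‖ ^ 2 + S.c / 4 * ‖m‖ ^ 2 - β * ‖p‖ * ‖m‖
        = (β * ‖p‖ - S.c / 2 * ‖m‖) ^ 2 / S.c := by
      field_simp; ring
    have h5 : 0 ≤ (β * ‖p‖ - S.c / 2 * ‖m‖) ^ 2 / S.c := by positivity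
    linarith
  have h5 := S.symm (S.iM m) (S.iP p)
  simp only [map_add, add_apply]
  rw [h5]
  nlinarith [sq_nonneg ‖p‖]

end Saddle
end HamSys
end

/-! ### The reduced functional `J`: ray inequality, geometry near the origin, continuity of the
maximizer. -/

noncomputable section

namespace HamSys
namespace Saddle

variable {X E : Type*} [NormedAddCommGroup X] [InnerProductSpace ℝ X] [CompleteSpace X]
    [NormedAddCommGroup E] [NormedSpace ℝ E] (S : Saddle X E)

/-- The maximizer of the functional over the negative space through `p`. -/
def mm (p : X) : X := (S.exists_critical p).choose

/-- The point above `p` maximizing the functional over the negative directions. -/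
def zz (p : X) : E := S.iP p + S.iM (S.mm p)

/-- The reduced functional. -/
def J (p : X) : ℝ := S.Φ (S.zz p)

/-- The Nehari function of the reduced functional. -/
def θ (p : X) : ℝ := S.dΦ (S.zz p) (S.zz p)

/-- The derivative of the reduced functional. -/
def dJ (p : X) : X →L[ℝ] ℝ := (S.dΦ (S.zz p)).comp S.iP

theorem dΦ_zz_iM (p h : X) : S.dΦ (S.zz p) (S.iM h) = 0 := (S.exists_critical p).choose_spec h

theorem θ_eq (p : X) : S.θ p = S.dJ p p := by
  have h := S.dΦ_zz_iM p (S.mm p)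
  change S.dΦ (S.zz p) (S.iP p + S.iM (S.mm p)) = S.dΦ (S.zz p) (S.iP p)
  rw [map_add, h, add_zero]

/-- Strong concavity around a critical point of the slice. The quadratic gain yields uniqueness of
the maximizer and its continuity. -/
theorem Φ_le_J (p m : X) : S.Φ (S.iP p + S.iM m) + S.c / 2 * ‖m - S.mm p‖ ^ 2 ≤ S.J p := by
  have h := S.Φ_add_le (S.zz p) (m - S.mm p)
  rw [S.dΦ_zz_iM] at h
  have e : S.zz p + S.iM (m - S.mm p) = S.iP p + S.iM m := by
    rw [zz, map_sub]; abel
  rw [e] at h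
  unfold J
  linarith

theorem Φ_le_J' (p m : X) : S.Φ (S.iP p + S.iM m) ≤ S.J p := by
  have := S.Φ_le_J p m
  have hc := S.c_pos
  nlinarith [sq_nonneg ‖m - S.mm p‖]

/-- The fundamental inequality from `zz p` to `zz (t p)`; the difference of these points from the
ray lies in the negative space, where the derivative vanishes. When `θ p = 0` it says that `p`
maximizes `J` on its line. -/
theorem J_smul_le (p : X) (t : ℝ) : S.J (t • p) + (1 - t ^ 2) / 2 * S.θ p ≤ S.J p := by
  have h := S.Φ_smul_add_le (S.zz p) t (S.mm (t • p) - t • S.mm p)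
  rw [S.dΦ_zz_iM] at h
  have e : t • S.zz p + S.iM (S.mm (t • p) - t • S.mm p) = S.zz (t • p) := by
    simp only [zz, map_sub, map_smul, smul_add]; abel
  rw [e] at h
  have hc := S.c_pos
  unfold J θ
  nlinarith [sq_nonneg ‖S.mm (t • p) - t • S.mm p‖]

/-- Take `t = 0` and use `J 0 ≥ Φ 0 = 0`. In particular negative energy forces `θ < 0`. -/
theorem θ_le (p : X) : S.θ p ≤ 2 * S.J p := by
  have h := S.J_smul_le p 0
  have h1 := S.Φ_le_J' 0 0
  rw [map_zero, map_zero, add_zero, S.Φ_zero] at h1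
  rw [zero_smul] at h
  linarith

/-- A critical point in the negative directions is the maximizer. -/
theorem eq_zz {z : E} (hz : ∀ h, S.dΦ z (S.iM h) = 0) : z = S.zz (S.πP z) := by
  obtain ⟨m, hm⟩ := S.decomp z
  have h1 := S.Φ_le_J (S.πP z) m
  rw [← hm] at h1
  have h2 := S.Φ_add_le z (S.mm (S.πP z) - m)
  rw [hz] at h2
  have e : z + S.iM (S.mm (S.πP z) - m) = S.zz (S.πP z) := by
    calc _ = S.iP (S.πP z) + S.iM m + S.iM (S.mm (S.πP z) - m) := congrArg (· + _) hm
      _ = _ := by rw [zz, map_sub]; abel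
  rw [e] at h2
  change S.J _ ≤ _ at h2
  have hc := S.c_pos
  rw [norm_sub_rev] at h2
  have h3 : ‖m - S.mm (S.πP z)‖ ^ 2 ≤ 0 := by
    by_contra hcon
    push Not at hcon
    nlinarith [mul_pos hc hcon]
  have h4 : m - S.mm (S.πP z) = 0 := by
    rw [← norm_eq_zero]
    exact pow_eq_zero_iff (two_ne_zero) |>.1 (le_antisymm h3 (sq_nonneg _))
  rw [sub_eq_zero] at h4
  rw [zz, ← h4]
  exact hm

/-- Beyond the upper bound on `J`, the terms in `Ψ` and `‖mm p‖²` are retained: they control the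
negative component when `J` is bounded below. -/
theorem exists_J_le : ∃ A, 0 < A ∧ ∀ p : X,
    S.J p + S.Ψ (S.zz p) ≤ A * ‖p‖ ^ 2 - S.c / 4 * ‖S.mm p‖ ^ 2 := by
  obtain ⟨A, hA, H⟩ := S.exists_B_le
  refine ⟨A, hA, fun p => ?_⟩
  have := H p (S.mm p)
  unfold J Φ
  rw [zz]
  linarith

/-- Test the maximum with `m = 0`: on the positive space the quadratic form dominates `Ψ`, which is
`o(‖p‖²)`. -/
theorem exists_le_J : ∃ r > 0, ∀ p : X, ‖p‖ ≤ r → S.c / 4 * ‖p‖ ^ 2 ≤ S.J p := by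
  have hc := S.c_pos
  obtain ⟨r, hr, H⟩ := S.small (S.c / (2 * (‖S.iP‖ ^ 2 + 1))) (by positivity)
  refine ⟨r / (‖S.iP‖ + 1), by positivity, fun p hp => ?_⟩
  have h1 := S.Φ_le_J' p 0
  rw [map_zero, add_zero] at h1
  refine le_trans ?_ h1
  have hip := S.iP.le_opNorm p
  have h2 := H (S.iP p) (by
    rw [le_div_iff₀ (by positivity)] at hp
    nlinarith [norm_nonneg p])
  have h3 := S.Ψ_le_half (S.iP p)
  have h4 := S.pos p
  have h5 : S.c / (2 * (‖S.iP‖ ^ 2 + 1)) * ‖S.iP p‖ ^ 2 ≤ S.c / 2 * ‖p‖ ^ 2 := by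
    rw [div_mul_eq_mul_div, div_le_iff₀ (by positivity)]
    have : ‖S.iP p‖ ^ 2 ≤ (‖S.iP‖ ^ 2 + 1) * ‖p‖ ^ 2 := by
      have := pow_le_pow_left₀ (norm_nonneg _) hip 2
      nlinarith [sq_nonneg ‖p‖]
    nlinarith
  unfold Φ
  linarith

/-- Near the origin the reduced functional is coercive and its Nehari function is positive. -/
theorem exists_small : ∃ r κ : ℝ, 0 < r ∧ 0 < κ ∧ (∀ p : X, ‖p‖ ≤ r → 0 ≤ S.J p) ∧
    (∀ p : X, p ≠ 0 → ‖p‖ ≤ r → 0 < S.θ p) ∧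
    ∀ p : X, p ≠ 0 → S.θ p = 0 → κ ≤ S.J p := by
  have hc := S.c_pos
  obtain ⟨r, hr, H⟩ := S.exists_le_J
  obtain ⟨A, hA, HA⟩ := S.exists_J_le
  have hup : ∀ p : X, S.J p ≤ A * ‖p‖ ^ 2 := fun p => by
    have := HA p
    have := S.nonneg (S.zz p)
    nlinarith [sq_nonneg ‖S.mm p‖]
  have hnorm : ∀ p : X, p ≠ 0 → ‖(r / ‖p‖) • p‖ = r := fun p hp => by
    rw [norm_smul, Real.norm_of_nonneg (by positivity), div_mul_cancel₀ _ (norm_ne_zero_iff.2 hp)]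
  -- The ray inequality, read at the point of the ray through `p` on the sphere of radius `r`, where
  -- `J ≥ c r²/4`.
  have hsc : ∀ p : X, p ≠ 0 → S.c / 4 * r ^ 2 + (1 - (r / ‖p‖) ^ 2) / 2 * S.θ p ≤ S.J p := by
    intro p hp
    have h1 := S.J_smul_le p (r / ‖p‖)
    have h2 := H ((r / ‖p‖) • p) (hnorm p hp).le
    rw [hnorm p hp] at h2
    linarith
  -- If `θ p ≤ 0` inside radius `r`, then `c r²/4 ≤ J p ≤ A‖p‖²`; the second entry of the minimum
  -- makes the right side at most a quarter of the left.
  set r' := min (r / 2) (√(S.c / (4 * A)) * r / 2) with hr'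
  have hr'0 : 0 < r' := by positivity
  refine ⟨r', S.c / 4 * r ^ 2, hr'0, by positivity, fun p hp => ?_, fun p hp hpr => ?_,
    fun p hp hθ => ?_⟩
  · refine le_trans (by positivity) (H p (hp.trans ((min_le_left _ _).trans (by linarith))))
  · by_contra hθ
    push Not at hθ
    have hp0 : 0 < ‖p‖ := norm_pos_iff.2 hp
    have h1 := hsc p hp
    have h2 : 1 ≤ (r / ‖p‖) ^ 2 := by
      refine one_le_pow₀ ?_
      rw [one_le_div hp0]
      exact hpr.trans ((min_le_left _ _).trans (by linarith))
    have h3 : S.c / 4 * r ^ 2 ≤ A * ‖p‖ ^ 2 := by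
      have := hup p
      nlinarith [mul_nonneg (sub_nonneg.2 h2) (neg_nonneg.2 hθ)]
    have h4 : ‖p‖ ^ 2 ≤ (√(S.c / (4 * A)) * r / 2) ^ 2 :=
      pow_le_pow_left₀ hp0.le (hpr.trans (min_le_right _ _)) 2
    have h5 : (√(S.c / (4 * A)) * r / 2) ^ 2 = S.c / (4 * A) * r ^ 2 / 4 := by
      rw [div_pow, mul_pow, Real.sq_sqrt (by positivity)]; norm_num
    rw [h5] at h4
    have h6 : A * ‖p‖ ^ 2 ≤ S.c / 4 * r ^ 2 / 4 := by
      calc A * ‖p‖ ^ 2 ≤ A * (S.c / (4 * A) * r ^ 2 / 4) := by gcongr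
        _ = _ := by field_simp
    have : 0 < S.c / 4 * r ^ 2 := by positivity
    linarith
  · have h1 := hsc p hp
    rw [hθ] at h1
    linarith

/-- Comparing `J p` with `Φ(iP p)` from above and below gives `c‖mm p‖² ≤ ⟨Φ'(iP p), iM (mm p)⟩`. -/
theorem exists_norm_mm_le (R : ℝ) : ∃ R', ∀ p : X, ‖p‖ ≤ R → ‖S.mm p‖ ≤ R' := by
  have hc := S.c_pos
  obtain ⟨D, hD0, hD⟩ := S.exists_norm_dΦ_le (‖S.iP‖ * R)
  refine ⟨D * ‖S.iM‖ / S.c, fun p hp => ?_⟩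
  rw [le_div_iff₀ hc]
  have h1 := S.Φ_le_J p 0
  have h2 := S.Φ_add_le (S.iP p) (S.mm p)
  change S.J p ≤ _ at h2
  rw [map_zero, add_zero, zero_sub, norm_neg] at h1
  have h3 : S.dΦ (S.iP p) (S.iM (S.mm p)) ≤ D * ‖S.iM‖ * ‖S.mm p‖ := by
    refine (le_abs_self _).trans (((S.dΦ (S.iP p)).le_opNorm _).trans ?_)
    rw [mul_assoc]
    refine mul_le_mul (hD _ ((S.iP.le_opNorm p).trans ?_)) (S.iM.le_opNorm _) (norm_nonneg _) hD0
    exact mul_le_mul_of_nonneg_left hp (norm_nonneg _)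
  by_contra hcon
  push Not at hcon
  have h4 : 0 < ‖S.mm p‖ := by
    rcases (norm_nonneg (S.mm p)).eq_or_lt with h | h
    · rw [← h, zero_mul] at hcon
      have := mul_nonneg hD0 (norm_nonneg S.iM)
      linarith
    · exact h
  nlinarith [mul_pos h4 (sub_pos.2 hcon)]

theorem norm_zz_le (p : X) : ‖S.zz p‖ ≤ ‖S.iP‖ * ‖p‖ + ‖S.iM‖ * ‖S.mm p‖ :=
  (norm_add_le _ _).trans (add_le_add (S.iP.le_opNorm _) (S.iM.le_opNorm _))

theorem exists_norm_zz_le (R : ℝ) : ∃ R', ∀ p : X, ‖p‖ ≤ R → ‖S.zz p‖ ≤ R' := by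
  obtain ⟨R', hR'⟩ := S.exists_norm_mm_le R
  refine ⟨‖S.iP‖ * R + ‖S.iM‖ * R', fun p hp => (S.norm_zz_le p).trans ?_⟩
  exact add_le_add (mul_le_mul_of_nonneg_left hp (norm_nonneg _))
    (mul_le_mul_of_nonneg_left (hR' p hp) (norm_nonneg _))

/-- The same two-sided comparison, based at `iP p + iM (mm p')`. This point is close to `zz p'`,
where the derivative kills negative directions. It replaces an implicit function theorem,
unavailable since `Ψ` is only `C¹`. -/
theorem mm_unif (R ε : ℝ) (hε : 0 < ε) : ∃ δ > 0, ∀ p p' : X, ‖p‖ ≤ R → ‖p'‖ ≤ R →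
    ‖p - p'‖ ≤ δ → ‖S.mm p - S.mm p'‖ ≤ ε := by
  have hc := S.c_pos
  obtain ⟨R', hR'⟩ := S.exists_norm_mm_le R
  obtain ⟨δ, hδ, H⟩ := S.unif_dΦ (‖S.iP‖ * R + ‖S.iM‖ * R') (S.c * ε / (‖S.iM‖ + 1))
    (by positivity)
  refine ⟨δ / (‖S.iP‖ + 1), by positivity, fun p p' hp hp' hpp => ?_⟩
  set d := S.mm p - S.mm p' with hd
  set y := S.iP p + S.iM (S.mm p') with hy
  have h1 := S.Φ_le_J p (S.mm p')
  rw [norm_sub_rev, ← hd, ← hy] at h1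
  have h2 := S.Φ_add_le y d
  have e : y + S.iM d = S.zz p := by rw [hy, hd, zz, map_sub]; abel
  rw [e] at h2
  change S.J p ≤ _ at h2
  have h3 : S.dΦ y (S.iM d) ≤ S.c * ε / (‖S.iM‖ + 1) * (‖S.iM‖ * ‖d‖) := by
    have e1 : S.dΦ y (S.iM d) = (S.dΦ y - S.dΦ (S.zz p')) (S.iM d) := by
      rw [sub_apply, S.dΦ_zz_iM, sub_zero]
    rw [e1]
    refine (le_abs_self _).trans (((S.dΦ y - S.dΦ (S.zz p')).le_opNorm _).trans ?_)
    refine mul_le_mul (H _ _ ?_ ?_ ?_) (S.iM.le_opNorm _) (norm_nonneg _) (by positivity)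
    · refine (norm_add_le _ _).trans (add_le_add ((S.iP.le_opNorm _).trans ?_)
        ((S.iM.le_opNorm _).trans ?_))
      · exact mul_le_mul_of_nonneg_left hp (norm_nonneg _)
      · exact mul_le_mul_of_nonneg_left (hR' _ hp') (norm_nonneg _)
    · refine (norm_add_le _ _).trans (add_le_add ((S.iP.le_opNorm _).trans ?_)
        ((S.iM.le_opNorm _).trans ?_))
      · exact mul_le_mul_of_nonneg_left hp' (norm_nonneg _)
      · exact mul_le_mul_of_nonneg_left (hR' _ hp') (norm_nonneg _)
    · have e2 : y - S.zz p' = S.iP (p - p') := by rw [hy, zz, map_sub]; abel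
      rw [e2]
      refine (S.iP.le_opNorm _).trans ?_
      rw [le_div_iff₀ (by positivity)] at hpp
      nlinarith [norm_nonneg (p - p')]
  have h4 : S.c * ε / (‖S.iM‖ + 1) * (‖S.iM‖ * ‖d‖) ≤ S.c * ε * ‖d‖ := by
    rw [div_mul_eq_mul_div, div_le_iff₀ (by positivity)]
    have : 0 ≤ S.c * ε * ‖d‖ := by positivity
    nlinarith
  by_contra hcon
  push Not at hcon
  have h5 : 0 < ‖d‖ := hε.trans hcon
  nlinarith [mul_pos (mul_pos hc h5) (sub_pos.2 hcon)]

theorem continuous_mm : Continuous S.mm := by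
  rw [Metric.continuous_iff]
  intro p ε hε
  obtain ⟨δ, hδ, H⟩ := S.mm_unif (‖p‖ + 1) (ε / 2) (half_pos hε)
  refine ⟨min δ 1, by positivity, fun q hq => ?_⟩
  rw [dist_eq_norm, lt_min_iff] at hq
  rw [dist_eq_norm]
  have h1 : ‖q‖ ≤ ‖p‖ + 1 := by
    have := norm_add_le (q - p) p
    rw [sub_add_cancel] at this
    linarith
  exact (H q p h1 (by linarith) hq.1.le).trans_lt (half_lt_self hε)

theorem continuous_zz : Continuous S.zz :=
  S.iP.continuous.add (S.iM.continuous.comp S.continuous_mm)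

theorem continuous_θ : Continuous S.θ :=
  (S.continuous_dΦ.comp S.continuous_zz).clm_apply S.continuous_zz

theorem continuous_dJ : Continuous S.dJ :=
  (S.continuous_dΦ.comp S.continuous_zz).clm_comp continuous_const

end Saddle
end HamSys
end

/-! ### Superquadratic descent, crossing of the Nehari set, and the deformation of a ray. -/

noncomputable section

namespace HamSys
namespace Saddle

variable {X E : Type*} [NormedAddCommGroup X] [InnerProductSpace ℝ X] [CompleteSpace X]
    [NormedAddCommGroup E] [NormedSpace ℝ E] (S : Saddle X E)

/-- Invariance of the reduced functional under symmetries. -/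
theorem J_symm {σ : E → E} {τ : X → X} (hτ : Function.Surjective τ)
    (hσ : ∀ p m, σ (S.iP p + S.iM m) = S.iP (τ p) + S.iM (τ m)) (hΦ : ∀ z, S.Φ (σ z) = S.Φ z)
    (p : X) : S.J (τ p) = S.J p := by
  refine le_antisymm ?_ ?_
  · obtain ⟨m, hm⟩ := hτ (S.mm (τ p))
    have h := S.Φ_le_J' p m
    rw [← hΦ, hσ, hm] at h
    exact h
  · have h := S.Φ_le_J' (τ p) (τ (S.mm p))
    rw [← hσ, hΦ] at h
    exact h

/-- Superquadratic growth drives the reduced functional to negative values along weakly convergent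
sequences of directions. -/
theorem exists_J_le_neg_one [TopologicalSpace.SeparableSpace X]
    (hsuper : ∀ (z : E) (C : ℝ), (∀ n : ℕ, S.Ψ (((n : ℝ) + 1) • z) ≤ C * ((n : ℝ) + 1) ^ 2) →
      S.πP z = 0) {e : ℕ → X} {e₀ : X} (he₀ : e₀ ≠ 0) (he : ∀ n, ‖e n‖ ≤ 1) (hw : WeakTo e e₀) :
    ∃ T > (0 : ℝ), ∀ k, ∃ n ≥ k, S.J (T • e n) ≤ -1 := by
  by_contra! hcon
  have hc := S.c_pos
  have hex : ∀ k : ℕ, ∃ n ≥ k, -1 < S.J (((k : ℝ) + 1) • e n) := fun k => by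
    obtain ⟨k', hk'⟩ := hcon ((k : ℝ) + 1) (by positivity)
    exact ⟨max k k', le_max_left _ _, hk' _ (le_max_right _ _)⟩
  choose n hn hJ using hex
  obtain ⟨A, hA, HA⟩ := S.exists_J_le
  have hb : ∀ k : ℕ, S.Ψ (S.zz (((k : ℝ) + 1) • e (n k)))
      + S.c / 4 * ‖S.mm (((k : ℝ) + 1) • e (n k))‖ ^ 2 ≤ (A + 1) * ((k : ℝ) + 1) ^ 2 := by
    intro k
    have h1 := HA (((k : ℝ) + 1) • e (n k))
    have h2 : ‖((k : ℝ) + 1) • e (n k)‖ ≤ (k : ℝ) + 1 := by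
      rw [norm_smul, Real.norm_of_nonneg (by positivity)]
      exact mul_le_of_le_one_right (by positivity) (he _)
    have h3 := pow_le_pow_left₀ (norm_nonneg _) h2 2
    have h4 := mul_le_mul_of_nonneg_left h3 hA.le
    have h5 : (1 : ℝ) ≤ ((k : ℝ) + 1) ^ 2 := one_le_pow₀ (by linarith [Nat.cast_nonneg (α := ℝ) k])
    linarith [hJ k]
  -- The rescaled negative components are bounded because `J > -1` limits `‖mm‖²` by a multiple of
  -- `(k+1)²`.
  set ξ : ℕ → X := fun k => ((k : ℝ) + 1)⁻¹ • S.mm (((k : ℝ) + 1) • e (n k)) with hξ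
  have hξb : ∀ k, ‖ξ k‖ ≤ √(4 * (A + 1) / S.c) := by
    intro k
    refine Real.le_sqrt_of_sq_le ?_
    have h1 := hb k
    have h2 := S.nonneg (S.zz (((k : ℝ) + 1) • e (n k)))
    rw [hξ]
    simp only [norm_smul, norm_inv]
    rw [Real.norm_of_nonneg (show (0 : ℝ) ≤ (k : ℝ) + 1 by positivity), mul_pow, inv_pow,
      inv_mul_le_iff₀ (by positivity), mul_div_assoc', le_div_iff₀ hc]
    linarith
  obtain ⟨ξ₀, φ, hφ, hξw⟩ := exists_weakTo_subseq hξb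
  have hne : Tendsto n atTop atTop := tendsto_atTop_mono hn tendsto_id
  have hew : WeakTo (fun k => e (n (φ k))) e₀ := fun D =>
    (hw D).comp (hne.comp hφ.tendsto_atTop)
  set z₀ := S.iP e₀ + S.iM ξ₀ with hz₀
  have hz : WeakTo (fun k => S.iP (e (n (φ k))) + S.iM (ξ (φ k))) z₀ :=
    (hew.map S.iP).add (hξw.map S.iM)
  have hzz : ∀ k : ℕ, ((k : ℝ) + 1) • (S.iP (e (n k)) + S.iM (ξ k))
      = S.zz (((k : ℝ) + 1) • e (n k)) := fun k => by
    have hk : ((k : ℝ) + 1) ≠ 0 := by positivity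
    rw [hξ, zz, smul_add, ← map_smul, ← map_smul, smul_smul, mul_inv_cancel₀ hk, one_smul]
  clear_value ξ
  -- For fixed `l`, convexity gives weak lower semicontinuity of `Ψ` at scale `l + 1`, and
  -- `sq_mul_Ψ_le` compares that scale with the larger scale `φ k + 1`, where `Ψ` is at most
  -- quadratic. Hence the weak limit has quadratic growth on its ray, contradicting `e₀ ≠ 0`.
  have hbound : ∀ l : ℕ, S.Ψ (((l : ℝ) + 1) • z₀) ≤ (A + 1) * ((l : ℝ) + 1) ^ 2 := by
    intro l
    have hlim : Tendsto (fun k => S.Ψ (((l : ℝ) + 1) • z₀) + S.dΨ (((l : ℝ) + 1) • z₀)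
        (((l : ℝ) + 1) • (S.iP (e (n (φ k))) + S.iM (ξ (φ k))) - ((l : ℝ) + 1) • z₀)) atTop
        (𝓝 (S.Ψ (((l : ℝ) + 1) • z₀))) := by
      have := ((hz (S.dΨ (((l : ℝ) + 1) • z₀))).const_mul ((l : ℝ) + 1)).sub_const
        (((l : ℝ) + 1) * S.dΨ (((l : ℝ) + 1) • z₀) z₀) |>.const_add (S.Ψ (((l : ℝ) + 1) • z₀))
      rw [sub_self, add_zero] at this
      refine this.congr fun k => ?_
      rw [map_sub, map_smul, map_smul, smul_eq_mul, smul_eq_mul]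
    refine le_of_tendsto hlim ?_
    filter_upwards [hφ.tendsto_atTop.eventually_ge_atTop l] with k hk
    have h1 := S.Ψ_add_ge (((l : ℝ) + 1) • z₀)
      (((l : ℝ) + 1) • (S.iP (e (n (φ k))) + S.iM (ξ (φ k))) - ((l : ℝ) + 1) • z₀)
    rw [add_sub_cancel] at h1
    refine h1.trans ?_
    have hl0 : (0 : ℝ) < (l : ℝ) + 1 := by positivity
    have hkl : (l : ℝ) ≤ (φ k : ℝ) := by exact_mod_cast hk
    have h2 := S.sq_mul_Ψ_le (((l : ℝ) + 1) • (S.iP (e (n (φ k))) + S.iM (ξ (φ k))))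
      (s := ((φ k : ℝ) + 1) / ((l : ℝ) + 1)) (by rw [one_le_div hl0]; linarith)
    rw [smul_smul, div_mul_cancel₀ _ hl0.ne', hzz, div_pow, div_mul_eq_mul_div,
      div_le_iff₀ (by positivity)] at h2
    have h3 := hb (φ k)
    have h4 : S.Ψ (S.zz (((φ k : ℝ) + 1) • e (n (φ k)))) ≤ (A + 1) * ((φ k : ℝ) + 1) ^ 2 := by
      have : 0 ≤ S.c / 4 * ‖S.mm (((φ k : ℝ) + 1) • e (n (φ k)))‖ ^ 2 := by positivity
      linarith
    have h5 : (0 : ℝ) < ((φ k : ℝ) + 1) ^ 2 := by positivity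
    refine le_of_mul_le_mul_left ?_ h5
    have h6 := mul_le_mul_of_nonneg_right h4 (show (0 : ℝ) ≤ ((l : ℝ) + 1) ^ 2 by positivity)
    linarith
  have h0 := hsuper z₀ (A + 1) hbound
  rw [hz₀, map_add, S.πP_iP, S.πP_iM, add_zero] at h0
  exact he₀ h0

/-- A path from the vicinity of the origin to the region of negative energy meets the Nehari set. -/
theorem exists_θ_eq_zero {r : ℝ} (hr : 0 < r) (hJ : ∀ p : X, ‖p‖ ≤ r → 0 ≤ S.J p)
    (hθ : ∀ p : X, p ≠ 0 → ‖p‖ ≤ r → 0 < S.θ p) {T : ℝ} (hT : 0 ≤ T) {γ : ℝ → X}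
    (hγ : Continuous γ) (h0 : ‖γ 0‖ ≤ r) (h1 : S.J (γ T) < 0) :
    ∃ t ∈ Set.Icc 0 T, γ t ≠ 0 ∧ S.θ (γ t) = 0 := by
  -- `θ` also vanishes at the origin, so the intermediate value theorem is applied to this maximum
  -- instead. At a zero the path is outside the open ball of radius `r`; a zero coming from the
  -- second entry would lie on the sphere, where `θ > 0`.
  have hF : Continuous fun t => max (S.θ (γ t)) (r - ‖γ t‖) :=
    (S.continuous_θ.comp hγ).max (continuous_const.sub hγ.norm)
  have hF0 : 0 ≤ max (S.θ (γ 0)) (r - ‖γ 0‖) := le_max_of_le_right (sub_nonneg.2 h0)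
  have hFT : max (S.θ (γ T)) (r - ‖γ T‖) ≤ 0 := by
    refine max_le ?_ ?_
    · have := S.θ_le (γ T)
      linarith
    · by_contra hcon
      exact absurd (hJ (γ T) (by linarith)) (not_le.2 h1)
  obtain ⟨t, ht, hFt⟩ := intermediate_value_Icc' hT hF.continuousOn ⟨hFT, hF0⟩
  have hnorm : r ≤ ‖γ t‖ := by
    have := (le_max_right (S.θ (γ t)) (r - ‖γ t‖)).trans_eq hFt
    linarith
  have hne : γ t ≠ 0 := fun h => by
    rw [h, norm_zero] at hnorm
    linarith
  refine ⟨t, ht, hne, ?_⟩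
  rcases max_choice (S.θ (γ t)) (r - ‖γ t‖) with h | h
  · rw [← h]; exact hFt
  · exfalso
    have h2 : r - ‖γ t‖ = 0 := h.symm.trans hFt
    have h3 := (le_max_left (S.θ (γ t)) (r - ‖γ t‖)).trans_eq hFt
    exact absurd (hθ (γ t) hne (by linarith)) (not_lt.2 h3)

/-- Put `y = iP u + iM (mm (u+h))`. Then `J(u+h) = Φ(y + iP h)`, `Φ(y) ≤ J(u)` by maximality, and
`Φ'(y)` is close to `Φ'(zz u)` by continuity of `mm`. Only this upper expansion, uniform on bounded
sets, is needed, so differentiability of `J` is never proved. -/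
theorem J_add_le (R ε : ℝ) (hε : 0 < ε) : ∃ δ > 0, ∀ u h : X, ‖u‖ ≤ R → ‖h‖ ≤ δ →
    S.J (u + h) ≤ S.J u + S.dJ u h + ε * ‖h‖ := by
  set q := ‖S.iP‖ + 1 with hq
  have hq0 : 0 < q := by positivity
  obtain ⟨R', hR'⟩ := S.exists_norm_mm_le (R + 1)
  obtain ⟨δ₁, hδ₁, H₁⟩ := S.unif_dΦ (‖S.iP‖ * R + ‖S.iM‖ * R') (ε / (2 * q)) (by positivity)
  obtain ⟨δ₂, hδ₂, H₂⟩ := S.mm_unif (R + 1) (δ₁ / (‖S.iM‖ + 1)) (by positivity)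
  refine ⟨min (min 1 δ₂) (ε / (‖S.B‖ * q ^ 2 + 1)), by positivity, fun u h hu hh => ?_⟩
  have hh1 : ‖h‖ ≤ 1 := hh.trans ((min_le_left _ _).trans (min_le_left _ _))
  have hh2 : ‖h‖ ≤ δ₂ := hh.trans ((min_le_left _ _).trans (min_le_right _ _))
  have hh3 : ‖h‖ ≤ ε / (‖S.B‖ * q ^ 2 + 1) := hh.trans (min_le_right _ _)
  have huh : ‖u + h‖ ≤ R + 1 := (norm_add_le _ _).trans (by linarith)
  set y := S.iP u + S.iM (S.mm (u + h)) with hy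
  have hkq : ‖S.iP h‖ ≤ q * ‖h‖ := (S.iP.le_opNorm h).trans
    (mul_le_mul_of_nonneg_right (by linarith) (norm_nonneg h))
  have e : S.zz (u + h) = y + S.iP h := by rw [hy, zz, map_add]; abel
  have hJe : S.J (u + h) ≤ S.Φ y + S.dΦ y (S.iP h) + 1 / 2 * S.B (S.iP h) (S.iP h) := by
    have h1 := S.Ψ_add_ge y (S.iP h)
    have h2 := S.symm y (S.iP h)
    rw [J, e]
    simp only [Φ, dΦ_apply, map_add, add_apply]
    rw [← h2]
    linarith
  have h1 := S.Φ_le_J' u (S.mm (u + h))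
  have h2 : S.dΦ y (S.iP h) - S.dJ u h ≤ ε / 2 * ‖h‖ := by
    have e1 : S.dΦ y (S.iP h) - S.dJ u h = (S.dΦ y - S.dΦ (S.zz u)) (S.iP h) := rfl
    rw [e1]
    refine (le_abs_self _).trans (((S.dΦ y - S.dΦ (S.zz u)).le_opNorm _).trans ?_)
    have h3 : ‖S.dΦ y - S.dΦ (S.zz u)‖ ≤ ε / (2 * q) := by
      refine H₁ _ _ ?_ ?_ ?_
      · refine (norm_add_le _ _).trans (add_le_add ((S.iP.le_opNorm _).trans ?_)
          ((S.iM.le_opNorm _).trans ?_))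
        · exact mul_le_mul_of_nonneg_left hu (norm_nonneg _)
        · exact mul_le_mul_of_nonneg_left (hR' _ huh) (norm_nonneg _)
      · refine (norm_add_le _ _).trans (add_le_add ((S.iP.le_opNorm _).trans ?_)
          ((S.iM.le_opNorm _).trans ?_))
        · exact mul_le_mul_of_nonneg_left hu (norm_nonneg _)
        · exact mul_le_mul_of_nonneg_left (hR' _ (by linarith)) (norm_nonneg _)
      · have e2 : y - S.zz u = S.iM (S.mm (u + h) - S.mm u) := by rw [hy, zz, map_sub]; abel
        rw [e2]
        have h4 := H₂ (u + h) u huh (by linarith) (by rw [add_sub_cancel_left]; exact hh2)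
        refine (S.iM.le_opNorm _).trans ?_
        rw [le_div_iff₀ (by positivity)] at h4
        nlinarith [norm_nonneg (S.mm (u + h) - S.mm u)]
    calc _ ≤ ε / (2 * q) * (q * ‖h‖) := mul_le_mul h3 hkq (norm_nonneg _) (by positivity)
      _ = _ := by field_simp
  have h3 : 1 / 2 * S.B (S.iP h) (S.iP h) ≤ ε / 2 * ‖h‖ := by
    have h4 : S.B (S.iP h) (S.iP h) ≤ ‖S.B‖ * q ^ 2 * ‖h‖ * ‖h‖ := by
      refine (le_abs_self _).trans ((S.abs_B_le _ _).trans ?_)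
      calc ‖S.B‖ * ‖S.iP h‖ * ‖S.iP h‖ ≤ ‖S.B‖ * (q * ‖h‖) * (q * ‖h‖) := by gcongr
        _ = _ := by ring
    rw [le_div_iff₀ (by positivity)] at hh3
    have h5 : ‖S.B‖ * q ^ 2 * ‖h‖ ≤ ε := by nlinarith [norm_nonneg h]
    have := mul_le_mul_of_nonneg_right h5 (norm_nonneg h)
    linarith
  linarith

theorem exists_norm_dJ_le (R : ℝ) : ∃ D, 0 ≤ D ∧ ∀ p : X, ‖p‖ ≤ R → ‖S.dJ p‖ ≤ D := by
  obtain ⟨R', hR'⟩ := S.exists_norm_zz_le R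
  obtain ⟨D, hD0, hD⟩ := S.exists_norm_dΦ_le R'
  refine ⟨D * ‖S.iP‖, by positivity, fun p hp => ?_⟩
  exact (ContinuousLinearMap.opNorm_comp_le _ _).trans
    (mul_le_mul_of_nonneg_right (hD _ (hR' p hp)) (norm_nonneg _))

theorem apply_toDual_symm (D : X →L[ℝ] ℝ) :
    D ((InnerProductSpace.toDual ℝ X).symm D) = ‖D‖ ^ 2 := by
  rw [← InnerProductSpace.toDual_symm_apply, real_inner_self_eq_norm_sq,
    LinearIsometryEquiv.norm_map]

/-- Deformation of a ray: a ray whose energy barely exceeds the Nehari level contains an almost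
critical point near that level. -/
theorem exists_almost_critical {c₀ : ℝ} (hc₀ : ∀ p : X, p ≠ 0 → S.θ p = 0 → c₀ ≤ S.J p)
    {δ : ℝ} (hδ : 0 < δ) (hδ1 : δ < 1) {T : ℝ} (hT : 0 < T) :
    ∃ ε > 0, ∀ e : X, ‖e‖ ≤ 1 → (∀ s : ℝ, S.J (s • e) ≤ c₀ + ε) → S.J (T • e) ≤ -1 →
      ∃ t ∈ Set.Icc 0 T, c₀ - δ ≤ S.J (t • e) ∧ ‖S.dJ (t • e)‖ ≤ δ := by
  obtain ⟨r, κ, hr, -, hJr, hθr, -⟩ := S.exists_small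
  obtain ⟨D, hD0, hD⟩ := S.exists_norm_dJ_le T
  obtain ⟨δ₁, hδ₁, H₁⟩ := S.J_add_le T (δ / 2) (half_pos hδ)
  -- The step size keeps the displacement within the range `δ₁` of the expansion of `J` and the
  -- displaced starting point within the ball of radius `r`.
  obtain ⟨ρ, hρ0, hρ1, hρδ, hρr⟩ : ∃ ρ : ℝ, 0 < ρ ∧ ρ ≤ 1 ∧ ρ * D ≤ δ₁ ∧ ρ * D ≤ r := by
    refine ⟨min 1 (min (δ₁ / (D + 1)) (r / (D + 1))), by positivity, min_le_left _ _, ?_, ?_⟩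
    · have h1 : min 1 (min (δ₁ / (D + 1)) (r / (D + 1))) ≤ δ₁ / (D + 1) :=
        (min_le_right _ _).trans (min_le_left _ _)
      have h2 := mul_le_mul_of_nonneg_right h1 hD0
      refine h2.trans ?_
      rw [div_mul_eq_mul_div, div_le_iff₀ (by positivity)]
      nlinarith
    · have h1 : min 1 (min (δ₁ / (D + 1)) (r / (D + 1))) ≤ r / (D + 1) :=
        (min_le_right _ _).trans (min_le_right _ _)
      have h2 := mul_le_mul_of_nonneg_right h1 hD0
      refine h2.trans ?_
      rw [div_mul_eq_mul_div, div_le_iff₀ (by positivity)]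
      nlinarith
  refine ⟨ρ * δ ^ 2 / 4, by positivity, fun e he hs hTe => ?_⟩
  by_contra! hcon
  -- A single explicit gradient step applied to the segment, in place of a pseudo-gradient flow.
  set γ : ℝ → X := fun t => t • e + -(ρ • (InnerProductSpace.toDual ℝ X).symm (S.dJ (t • e)))
    with hγ
  have hγc : Continuous γ := by
    have h1 : Continuous fun t : ℝ => t • e := continuous_id.smul continuous_const
    exact h1.add (((InnerProductSpace.toDual ℝ X).symm.continuous.comp
      (S.continuous_dJ.comp h1)).const_smul ρ).neg
  have hnt : ∀ t ∈ Set.Icc 0 T, ‖t • e‖ ≤ T := fun t ht => by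
    rw [norm_smul, Real.norm_of_nonneg ht.1]
    nlinarith [ht.1, ht.2, norm_nonneg e]
  have hstep : ∀ t ∈ Set.Icc 0 T, S.J (γ t) ≤ S.J (t • e) - ρ * ‖S.dJ (t • e)‖ ^ 2
      + δ / 2 * (ρ * ‖S.dJ (t • e)‖) := by
    intro t ht
    have hn : ‖-(ρ • (InnerProductSpace.toDual ℝ X).symm (S.dJ (t • e)))‖
        = ρ * ‖S.dJ (t • e)‖ := by
      rw [norm_neg, norm_smul, Real.norm_of_nonneg hρ0.le, LinearIsometryEquiv.norm_map]
    have h1 := H₁ (t • e) (-(ρ • (InnerProductSpace.toDual ℝ X).symm (S.dJ (t • e))))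
      (hnt t ht) (by
        rw [hn]
        exact (mul_le_mul_of_nonneg_left (hD _ (hnt t ht)) hρ0.le).trans hρδ)
    rw [hn, map_neg, map_smul, apply_toDual_symm, smul_eq_mul] at h1
    simp only [hγ]
    linarith
  -- Where the gradient is small the step may raise the energy, but `-x² + δx/2 ≤ δ²/4` bounds the
  -- rise.
  have hup : ∀ t ∈ Set.Icc 0 T, S.J (γ t) ≤ S.J (t • e) + ρ * δ ^ 2 / 4 := fun t ht => by
    have h1 := hstep t ht
    nlinarith [mul_nonneg hρ0.le (sq_nonneg (‖S.dJ (t • e)‖ - δ / 4)), mul_pos hρ0 (pow_pos hδ 2)]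
  have hρδ2 : ρ * δ ^ 2 / 4 ≤ δ / 4 := by
    have : ρ * δ ^ 2 ≤ 1 * δ := mul_le_mul hρ1 (by nlinarith) (by positivity) one_pos.le
    linarith
  have h0 : ‖γ 0‖ ≤ r := by
    simp only [hγ, zero_smul, zero_add]
    rw [norm_neg, norm_smul, Real.norm_of_nonneg hρ0.le, LinearIsometryEquiv.norm_map]
    exact (mul_le_mul_of_nonneg_left (hD 0 (by rw [norm_zero]; exact hT.le)) hρ0.le).trans hρr
  have h1 : S.J (γ T) < 0 := by
    have := hup T ⟨hT.le, le_rfl⟩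
    linarith
  obtain ⟨t, ht, hne, hθ⟩ := S.exists_θ_eq_zero hr hJr hθr hT.le hγc h0 h1
  have hc := hc₀ _ hne hθ
  -- At the Nehari crossing: near level `c₀` the gradient exceeds `δ` and the step lowers the energy
  -- by more than `ρδ²/2 > ε`; below `c₀ - δ` the possible rise is at most `δ/4`. Both give energy
  -- below `c₀`.
  by_cases hlow : c₀ - δ ≤ S.J (t • e)
  · have hg := hcon t ht hlow
    have h2 := hstep t ht
    have h3 := hs t
    have h4 : δ * δ < ‖S.dJ (t • e)‖ * ‖S.dJ (t • e)‖ := mul_self_lt_mul_self hδ.le hg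
    have h5 : ρ * (δ ^ 2 / 2) < ρ * (‖S.dJ (t • e)‖ ^ 2 - δ / 2 * ‖S.dJ (t • e)‖) := by
      refine mul_lt_mul_of_pos_left ?_ hρ0
      nlinarith [mul_pos (sub_pos.2 hg) (hδ.trans hg)]
    nlinarith [mul_pos hρ0 (pow_pos hδ 2)]
  · have h2 := hup t ht
    push Not at hlow
    linarith

end Saddle
end HamSys
end

/-! ### Existence of a least energy critical point in the abstract setting. -/

noncomputable section

namespace HamSys
namespace Saddle

variable {X E : Type*} [NormedAddCommGroup X] [InnerProductSpace ℝ X] [CompleteSpace X]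
    [NormedAddCommGroup E] [NormedSpace ℝ E] (S : Saddle X E)

/-- Superquadratic growth off the negative space. -/
def IsSuper : Prop := ∀ (z : E) (C : ℝ),
  (∀ n : ℕ, S.Ψ (((n : ℝ) + 1) • z) ≤ C * ((n : ℝ) + 1) ^ 2) → S.πP z = 0

/-- The concentration-compactness alternative for unit vectors of the positive space. -/
def IsLions : Prop := ∀ e : ℕ → X, (∀ n, ‖e n‖ = 1) →
  (∃ φ : ℕ → ℕ, StrictMono φ ∧ ∀ s : ℝ, Tendsto (fun n => S.Ψ (s • S.iP (e (φ n)))) atTop (𝓝 0)) ∨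
  ∃ φ : ℕ → ℕ, StrictMono φ ∧ ∃ (e' : ℕ → X) (e₀ : X), e₀ ≠ 0 ∧ (∀ n, ‖e' n‖ = 1) ∧
    WeakTo e' e₀ ∧ ∀ (n : ℕ) (s : ℝ), S.J (s • e' n) = S.J (s • e (φ n))

/-- Weak sequential continuity of the derivative of `Ψ`. -/
def IsWeakCont : Prop := ∀ (z : ℕ → E) (z₀ : E) (M : ℝ), (∀ n, ‖z n‖ ≤ M) → WeakTo z z₀ →
  ∀ η, Tendsto (fun n => S.dΨ (z n) η) atTop (𝓝 (S.dΨ z₀ η))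

/-- Weak lower semicontinuity of `½ ⟨Ψ'(z), z⟩ - Ψ(z)`. -/
def IsFatou : Prop := ∀ (z : ℕ → E) (z₀ : E) (M c : ℝ), (∀ n, ‖z n‖ ≤ M) → WeakTo z z₀ →
  Tendsto (fun n => 1 / 2 * S.dΨ (z n) (z n) - S.Ψ (z n)) atTop (𝓝 c) →
  1 / 2 * S.dΨ z₀ z₀ - S.Ψ z₀ ≤ c

/-- The descent lemma for a constant sequence of directions, followed by the crossing argument along
the ray. -/
theorem exists_nehari [TopologicalSpace.SeparableSpace X] [Nontrivial X] (hsuper : S.IsSuper) :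
    ∃ p : X, p ≠ 0 ∧ S.θ p = 0 := by
  obtain ⟨e, he⟩ := exists_norm_eq X (zero_le_one' ℝ)
  have he0 : e ≠ 0 := fun h => by simp [h] at he
  obtain ⟨r, κ, hr, -, hJr, hθr, -⟩ := S.exists_small
  obtain ⟨T, hT, H⟩ := S.exists_J_le_neg_one hsuper (e := fun _ => e) he0 (fun _ => he.le)
    (fun D => tendsto_const_nhds)
  obtain ⟨n, -, hn⟩ := H 0
  obtain ⟨t, -, h1, h2⟩ := S.exists_θ_eq_zero hr hJr hθr hT.le (γ := fun t : ℝ => t • e)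
    (continuous_id.smul continuous_const) (by simpa using hr.le)
    (lt_of_le_of_lt hn (by norm_num))
  exact ⟨_, h1, h2⟩

/-- Nonvanishing directions of a minimizing sequence for the Nehari level. -/
theorem exists_minimizing_directions (hlions : S.IsLions) (hne : ∃ p : X, p ≠ 0 ∧ S.θ p = 0) :
    ∃ c₀ : ℝ, 0 < c₀ ∧ (∀ p : X, p ≠ 0 → S.θ p = 0 → c₀ ≤ S.J p) ∧
      ∃ (e : ℕ → X) (e₀ : X), e₀ ≠ 0 ∧ (∀ n, ‖e n‖ = 1) ∧ WeakTo e e₀ ∧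
        ∀ (n : ℕ) (s : ℝ), S.J (s • e n) ≤ c₀ + 1 / ((n : ℝ) + 1) := by
  have hc := S.c_pos
  obtain ⟨r, κ, hr, hκ, -, -, hκJ⟩ := S.exists_small
  set A : Set ℝ := {x | ∃ p : X, p ≠ 0 ∧ S.θ p = 0 ∧ S.J p = x} with hA
  have hAne : A.Nonempty := by
    obtain ⟨p, h1, h2⟩ := hne
    exact ⟨_, p, h1, h2, rfl⟩
  have hAκ : ∀ x ∈ A, κ ≤ x := by
    rintro _ ⟨p, h1, h2, rfl⟩
    exact hκJ p h1 h2
  have hAb : BddBelow A := ⟨κ, hAκ⟩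
  set c₀ := sInf A with hc₀
  have hex : ∀ n : ℕ, ∃ p : X, p ≠ 0 ∧ S.θ p = 0 ∧ S.J p < c₀ + 1 / ((n : ℝ) + 1) := fun n => by
    obtain ⟨_, ⟨p, h1, h2, rfl⟩, h3⟩ := exists_lt_of_csInf_lt hAne
      (show c₀ < c₀ + 1 / ((n : ℝ) + 1) by
        have : (0 : ℝ) < 1 / ((n : ℝ) + 1) := by positivity
        linarith)
    exact ⟨p, h1, h2, h3⟩
  choose u hu0 huθ huJ using hex
  refine ⟨c₀, hκ.trans_le (le_csInf hAne hAκ), fun p h1 h2 => csInf_le hAb ⟨p, h1, h2, rfl⟩, ?_⟩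
  have hunit : ∀ n, ‖‖u n‖⁻¹ • u n‖ = 1 := fun n => by
    rw [norm_smul, norm_inv, norm_norm, inv_mul_cancel₀ (norm_ne_zero_iff.2 (hu0 n))]
  -- A Nehari point maximizes `J` on its ray, so the near-minimality of `u n` controls the entire
  -- ray.
  have hJs : ∀ (n : ℕ) (s : ℝ), S.J (s • (‖u n‖⁻¹ • u n)) ≤ c₀ + 1 / ((n : ℝ) + 1) := fun n s => by
    have h := S.J_smul_le (u n) (s * ‖u n‖⁻¹)
    rw [huθ, mul_zero, add_zero] at h
    rw [smul_smul]
    exact h.trans (huJ n).le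
  have hlim : Tendsto (fun n : ℕ => c₀ + 1 / ((n : ℝ) + 1)) atTop (𝓝 (c₀ + 0)) :=
    tendsto_one_div_add_atTop_nhds_zero_nat.const_add _
  rcases hlions _ hunit with ⟨φ, hφ, hv⟩ | ⟨φ, hφ, e', e₀, he₀, he', hw, hJ'⟩
  · exfalso
    -- Under vanishing, `Ψ` disappears in the limit and the positive quadratic form alone is bounded
    -- by `c₀` at every `s`, which is absurd; the value of `s` chosen afterwards makes the left side
    -- `c₀ + 1`.
    have hs : ∀ s : ℝ, S.c / 2 * s ^ 2 ≤ c₀ + 0 := by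
      intro s
      refine le_of_tendsto_of_tendsto (b := atTop) (f := fun n =>
        S.c / 2 * s ^ 2 - S.Ψ (s • S.iP (‖u (φ n)‖⁻¹ • u (φ n)))) ?_ (hlim.comp hφ.tendsto_atTop)
        (Eventually.of_forall fun n => ?_)
      · simpa using (hv s).const_sub (S.c / 2 * s ^ 2)
      · refine le_trans ?_ (hJs (φ n) s)
        have h1 := S.Φ_le_J' (s • (‖u (φ n)‖⁻¹ • u (φ n))) 0
        rw [map_zero, add_zero] at h1
        refine le_trans ?_ h1
        have h2 := S.pos (s • (‖u (φ n)‖⁻¹ • u (φ n)))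
        rw [norm_smul s, hunit, mul_one, Real.norm_eq_abs, sq_abs] at h2
        rw [Φ, map_smul S.iP s]
        rw [map_smul S.iP s] at h2
        linarith
    have h1 := hs (√(2 * (c₀ + 1) / S.c))
    have hc0 : 0 ≤ c₀ := hκ.le.trans (le_csInf hAne hAκ)
    rw [Real.sq_sqrt (by positivity)] at h1
    have e : S.c / 2 * (2 * (c₀ + 1) / S.c) = c₀ + 1 := by field_simp
    linarith
  · refine ⟨e', e₀, he₀, he', hw, fun n s => ?_⟩
    rw [hJ']
    refine (hJs (φ n) s).trans ?_
    have : (n : ℝ) ≤ φ n := by exact_mod_cast hφ.id_le n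
    gcongr

/-- Almost critical sequences of the reduced functional along weakly convergent directions produce
critical points. -/
theorem exists_critical_of_seq [TopologicalSpace.SeparableSpace X] (hweak : S.IsWeakCont)
    (hfatou : S.IsFatou) {c₀ : ℝ} (hc₀ : 0 < c₀) {e : ℕ → X} {e₀ : X} (he₀ : e₀ ≠ 0)
    (he : ∀ n, ‖e n‖ = 1) (hw : WeakTo e e₀) {T : ℝ} {t : ℕ → ℝ} (ht : ∀ n, t n ∈ Set.Icc 0 T)
    (hJ : Tendsto (fun n => S.J (t n • e n)) atTop (𝓝 c₀))
    (hdJ : Tendsto (fun n => ‖S.dJ (t n • e n)‖) atTop (𝓝 0)) :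
    ∃ z : E, S.dΦ z = 0 ∧ S.πP z ≠ 0 ∧ S.Φ z ≤ c₀ := by
  have hc := S.c_pos
  have hnt : ∀ n, ‖t n • e n‖ ≤ T := fun n => by
    rw [norm_smul, he, mul_one, Real.norm_of_nonneg (ht n).1]
    exact (ht n).2
  obtain ⟨R, hR⟩ := S.exists_norm_mm_le T
  obtain ⟨R', hR'⟩ := S.exists_norm_zz_le T
  obtain ⟨t₀, ht₀, φ, hφ, htφ⟩ := isCompact_Icc.tendsto_subseq ht
  obtain ⟨m₀, ψ, hψ, hm⟩ := exists_weakTo_subseq (u := fun n => S.mm (t (φ n) • e (φ n)))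
    (fun n => hR _ (hnt _))
  have hχ : StrictMono (φ ∘ ψ) := hφ.comp hψ
  set p : ℕ → X := fun n => t (φ (ψ n)) • e (φ (ψ n)) with hp
  have hpw : WeakTo p (t₀ • e₀) := (hw.comp hχ).smul (htφ.comp hψ.tendsto_atTop)
  set z := S.iP (t₀ • e₀) + S.iM m₀ with hz
  have hzw : WeakTo (fun n => S.zz (p n)) z := (hpw.map S.iP).add (hm.map S.iM)
  have hpT : ∀ n, ‖p n‖ ≤ T := fun n => hnt _
  have hJp : Tendsto (fun n => S.J (p n)) atTop (𝓝 c₀) := hJ.comp hχ.tendsto_atTop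
  have hdJp : Tendsto (fun n => ‖S.dJ (p n)‖) atTop (𝓝 0) := hdJ.comp hχ.tendsto_atTop
  have hlim : ∀ η, Tendsto (fun n => S.dΦ (S.zz (p n)) η) atTop (𝓝 (S.dΦ z η)) := fun η =>
    (hzw (S.B.flip η)).sub (hweak _ z R' (fun n => hR' _ (hpT n)) hzw η)
  have hdJ0 : ∀ h : ℕ → X, (∀ n, ‖h n‖ ≤ T) → Tendsto (fun n => S.dJ (p n) (h n)) atTop (𝓝 0) := by
    intro h hh
    have := hdJp.mul_const T
    rw [zero_mul] at this
    refine squeeze_zero_norm (fun n => ((S.dJ (p n)).le_opNorm _).trans ?_) this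
    exact mul_le_mul_of_nonneg_left (hh n) (norm_nonneg _)
  have hT0 : 0 ≤ T := (ht 0).1.trans (ht 0).2
  have hdz : S.dΦ z = 0 := by
    ext η
    obtain ⟨m, hm⟩ := S.decomp η
    have hM : S.dΦ z (S.iM m) = 0 :=
      tendsto_nhds_unique (hlim _) (by simp only [S.dΦ_zz_iM]; exact tendsto_const_nhds)
    have hP : S.dΦ z (S.iP (S.πP η)) = 0 := by
      refine tendsto_nhds_unique (hlim _) ?_
      have := hdJp.mul_const ‖S.πP η‖
      rw [zero_mul] at this
      exact squeeze_zero_norm (fun n => (S.dJ (p n)).le_opNorm _) this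
    rw [hm, map_add, hM, hP, add_zero, zero_apply]
  refine ⟨z, hdz, ?_, ?_⟩
  · rw [hz, map_add, S.πP_iP, S.πP_iM, add_zero]
    -- If `t₀ = 0` then `J(p n) ≤ A‖p n‖² → 0`, against `J(p n) → c₀ > 0`.
    refine smul_ne_zero (fun h0 => ?_) he₀
    obtain ⟨A, hA, HA⟩ := S.exists_J_le
    have h1 : Tendsto (fun n => A * ‖p n‖ ^ 2) atTop (𝓝 (A * |t₀| ^ 2)) := by
      have := (((htφ.comp hψ.tendsto_atTop).abs).pow 2).const_mul A
      refine this.congr fun n => ?_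
      simp [hp, norm_smul, he]
    have h2 := le_of_tendsto_of_tendsto hJp h1 (Eventually.of_forall fun n => by
      have h3 := HA (p n)
      have h4 := S.nonneg (S.zz (p n))
      have h5 : 0 ≤ S.c / 4 * ‖S.mm (p n)‖ ^ 2 := by positivity
      change S.J (p n) ≤ A * ‖p n‖ ^ 2
      linarith)
    rw [h0] at h2
    simp at h2
    linarith
  -- The quantity equals `J(p) - ½ J'(p)p`: the quadratic part cancels, leaving what Fatou's lemma
  -- can treat.
  · have h1 : Tendsto (fun n => 1 / 2 * S.dΨ (S.zz (p n)) (S.zz (p n)) - S.Ψ (S.zz (p n))) atTop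
        (𝓝 c₀) := by
      have := hJp.sub ((hdJ0 p hpT).const_mul (1 / 2))
      rw [mul_zero, sub_zero] at this
      refine this.congr fun n => ?_
      rw [← S.θ_eq, θ, J, Φ, dΦ_apply]
      ring
    have h2 := hfatou _ z R' c₀ (fun n => hR' _ (hpT n)) hzw h1
    have h3 : S.dΦ z z = 0 := by rw [hdz, zero_apply]
    rw [dΦ_apply] at h3
    rw [Φ]
    linarith

/-- Existence of a critical point of least energy on the Nehari–Pankov set. -/
theorem exists_ground_state [TopologicalSpace.SeparableSpace X] [Nontrivial X]
    (hsuper : S.IsSuper) (hlions : S.IsLions) (hweak : S.IsWeakCont) (hfatou : S.IsFatou) :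
    ∃ z : E, S.dΦ z = 0 ∧ S.πP z ≠ 0 ∧ 0 < S.Φ z ∧
      ∀ y, S.πP y ≠ 0 → S.dΦ y y = 0 → (∀ h, S.dΦ y (S.iM h) = 0) → S.Φ z ≤ S.Φ y := by
  obtain ⟨c₀, hc₀, hmin, e, e₀, he₀, he, hw, hJ⟩ :=
    S.exists_minimizing_directions hlions (S.exists_nehari hsuper)
  -- `T` is fixed before the tolerance, so the admissible energy excess given by the deformation
  -- lemma depends on the tolerance alone and not on the direction.
  obtain ⟨T, hT, HT⟩ := S.exists_J_le_neg_one hsuper he₀ (fun n => (he n).le) hw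
  have hlim : Tendsto (fun n : ℕ => 1 / ((n : ℝ) + 1)) atTop (𝓝 0) :=
    tendsto_one_div_add_atTop_nhds_zero_nat
  have hex : ∀ k : ℕ, ∃ n ≥ k, ∃ t ∈ Set.Icc 0 T,
      c₀ - 1 / ((k : ℝ) + 2) ≤ S.J (t • e n) ∧ ‖S.dJ (t • e n)‖ ≤ 1 / ((k : ℝ) + 2) := by
    intro k
    -- The deformation lemma requires a tolerance below one, hence `1/(k+2)` and not `1/(k+1)`.
    obtain ⟨ε, hε, H⟩ := S.exists_almost_critical hmin (δ := 1 / ((k : ℝ) + 2)) (by positivity)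
      (by rw [div_lt_one (by positivity)]; linarith [Nat.cast_nonneg (α := ℝ) k]) hT
    obtain ⟨n₀, hn₀⟩ := eventually_atTop.1 (hlim.eventually (gt_mem_nhds hε))
    obtain ⟨n, hn, hnJ⟩ := HT (max k n₀)
    refine ⟨n, (le_max_left _ _).trans hn, H (e n) (he n).le (fun s => (hJ n s).trans ?_) hnJ⟩
    have := hn₀ n ((le_max_right _ _).trans hn)
    linarith
  choose n hn t ht hJt hdJt using hex
  have hnlim : Tendsto n atTop atTop := tendsto_atTop_mono hn tendsto_id
  have h2 : Tendsto (fun k : ℕ => 1 / ((k : ℝ) + 2)) atTop (𝓝 0) :=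
    squeeze_zero (fun k => by positivity) (fun k => by gcongr; norm_num) hlim
  obtain ⟨z, hz, hzP, hzΦ⟩ := S.exists_critical_of_seq hweak hfatou hc₀ he₀ (fun k => he (n k))
    (fun D => (hw D).comp hnlim) ht (tendsto_of_tendsto_of_tendsto_of_le_of_le
      (by simpa using h2.const_sub c₀) (by simpa using (hlim.comp hnlim).const_add c₀) hJt
      (fun k => hJ (n k) (t k)))
    (squeeze_zero (fun k => norm_nonneg _) hdJt h2)
  have hlow : ∀ y, S.πP y ≠ 0 → S.dΦ y y = 0 → (∀ h, S.dΦ y (S.iM h) = 0) → c₀ ≤ S.Φ y := by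
    intro y h1 h2 h3
    have e := S.eq_zz h3
    have h4 := hmin (S.πP y) h1 (by rw [θ, ← e]; exact h2)
    rw [J, ← e] at h4
    exact h4
  have hge := hlow z hzP (by rw [hz, zero_apply]) (fun h => by rw [hz, zero_apply])
  exact ⟨z, hz, hzP, hc₀.trans_le hge, fun y h1 h2 h3 => hzΦ.trans (hlow y h1 h2 h3)⟩

end Saddle
end HamSys
end

/-! ### Translations on `H¹` and `E`. -/

noncomputable section

namespace HamSys

open scoped ENNReal NNReal

/-- Translation of `Lᵖ` functions by `w`. -/
def shiftLp {N : ℕ} (F : Type*) [NormedAddCommGroup F] [NormedSpace ℝ F] (w : Rn N) :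
    Lp F 2 (volume : Measure (Rn N)) →ₗᵢ[ℝ] Lp F 2 (volume : Measure (Rn N)) :=
  Lp.compMeasurePreservingₗᵢ ℝ (fun x => x + w) (measurePreserving_add_right volume w)

theorem shiftLp_apply {N : ℕ} {F : Type*} [NormedAddCommGroup F] [NormedSpace ℝ F] (w : Rn N)
    (f : Lp F 2 (volume : Measure (Rn N))) : shiftLp F w f =ᵐ[volume] fun x => f (x + w) :=
  Lp.coeFn_compMeasurePreserving f (measurePreserving_add_right volume w)

theorem isWeakGrad_shiftLp {N : ℕ} (w : Rn N) (u : H1 N) :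
    IsWeakGrad (shiftLp ℝ w u.1.fst) (shiftLp (Rn N) w u.1.snd) := by
  intro φ hφ i
  have h := u.2 _ (hφ.comp_add_right (-w)) i
  have e1 : ∫ x, shiftLp ℝ w u.1.fst x * partialD i φ x
      = ∫ x, u.1.fst x * partialD i (fun t => φ (t + -w)) x := by
    refine Eq.trans ?_ (integral_add_right_eq_self _ w)
    refine integral_congr_ae ?_
    filter_upwards [shiftLp_apply w u.1.fst] with x hx
    rw [hx, partialD_comp_add_right, add_neg_cancel_right]
  have e2 : ∫ x, shiftLp (Rn N) w u.1.snd x i * φ x = ∫ x, u.1.snd x i * φ (x + -w) := by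
    refine Eq.trans ?_ (integral_add_right_eq_self _ w)
    refine integral_congr_ae ?_
    filter_upwards [shiftLp_apply w u.1.snd] with x hx
    rw [hx, add_neg_cancel_right]
  rw [e1, e2]
  exact h

/-- Translation of `H¹` functions by `w`. -/
def shift {N : ℕ} (w : Rn N) (u : H1 N) : H1 N :=
  ⟨WithLp.toLp 2 (shiftLp ℝ w u.1.fst, shiftLp (Rn N) w u.1.snd), isWeakGrad_shiftLp w u⟩

theorem val_shift {N : ℕ} (w : Rn N) (u : H1 N) :
    val (shift w u) =ᵐ[volume] fun x => val u (x + w) := shiftLp_apply w u.1.fst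

theorem grad_shift {N : ℕ} (w : Rn N) (u : H1 N) :
    grad (shift w u) =ᵐ[volume] fun x => grad u (x + w) := shiftLp_apply w u.1.snd

theorem H1_ext {N : ℕ} {u v : H1 N} (h1 : u.1.fst = v.1.fst) (h2 : u.1.snd = v.1.snd) : u = v := by
  refine Subtype.ext ?_
  refine (WithLp.ofLp_injective 2) (Prod.ext h1 h2)

theorem shift_add {N : ℕ} (w : Rn N) (u v : H1 N) : shift w (u + v) = shift w u + shift w v :=
  H1_ext (map_add (shiftLp ℝ w) u.1.fst v.1.fst) (map_add (shiftLp (Rn N) w) u.1.snd v.1.snd)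

theorem shift_smul {N : ℕ} (w : Rn N) (c : ℝ) (u : H1 N) : shift w (c • u) = c • shift w u :=
  H1_ext (map_smul (shiftLp ℝ w) c u.1.fst) (map_smul (shiftLp (Rn N) w) c u.1.snd)

theorem norm_shift {N : ℕ} (w : Rn N) (u : H1 N) : ‖shift w u‖ = ‖u‖ := by
  refine (pow_left_inj₀ (norm_nonneg _) (norm_nonneg _) two_ne_zero).1 ?_
  rw [norm_sq_eq, norm_sq_eq]
  have h1 := (shiftLp ℝ w).norm_map u.1.fst
  have h2 := (shiftLp (Rn N) w).norm_map u.1.snd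
  exact congrArg₂ (fun s t : ℝ => s ^ 2 + t ^ 2) h1 h2

theorem shiftLp_shiftLp_neg {N : ℕ} {F : Type*} [NormedAddCommGroup F] [NormedSpace ℝ F] (w : Rn N)
    (f : Lp F 2 (volume : Measure (Rn N))) : shiftLp F w (shiftLp F (-w) f) = f := by
  refine Lp.ext ?_
  have h2 := (measurePreserving_add_right volume w).quasiMeasurePreserving.ae
    (shiftLp_apply (-w) f)
  filter_upwards [shiftLp_apply w (shiftLp F (-w) f), h2] with x hx hx2
  rw [hx, hx2, add_neg_cancel_right]

theorem shift_surjective {N : ℕ} (w : Rn N) : Function.Surjective (shift w) := fun u =>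
  ⟨shift (-w) u, H1_ext (shiftLp_shiftLp_neg w u.1.fst) (shiftLp_shiftLp_neg w u.1.snd)⟩

/-- Translation on the product space. -/
def shiftE {N : ℕ} (w : Rn N) (z : ESpace N) : ESpace N :=
  WithLp.toLp 2 (shift w z.fst, shift w z.snd)

theorem Psi_shiftE {N : ℕ} {W fu fv : Rn N → ℝ → ℝ → ℝ} (h : IsNonlin W fu fv) (k : Fin N → ℤ)
    (z : ESpace N) : Psi W (shiftE (intVec k) z) = Psi W z := by
  unfold Psi
  refine Eq.trans ?_ (integral_add_right_eq_self
    (fun x => W x (val z.fst x) (val z.snd x)) (intVec k))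
  refine integral_congr_ae ?_
  filter_upwards [val_shift (intVec k) z.fst, val_shift (intVec k) z.snd] with x h1 h2
  change W x (val (shift (intVec k) z.fst) x) (val (shift (intVec k) z.snd) x) = _
  rw [h1, h2, h.per.add_intVec]

end HamSys
end

/-! ### The quadratic part of the energy as a bounded symmetric bilinear form. -/

noncomputable section

namespace HamSys

open scoped ENNReal NNReal

/-- A bounded bilinear form as a continuous bilinear map. -/
def bilinMk {X : Type*} [NormedAddCommGroup X] [NormedSpace ℝ X] (f : X → X → ℝ)
    (h₁ : ∀ u u' v, f (u + u') v = f u v + f u' v) (h₂ : ∀ (c : ℝ) u v, f (c • u) v = c * f u v)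
    (h₃ : ∀ u v, f u v = f v u) (C : ℝ) (hC : ∀ u v, |f u v| ≤ C * ‖u‖ * ‖v‖) :
    X →L[ℝ] X →L[ℝ] ℝ :=
  LinearMap.mkContinuous₂ (LinearMap.mk₂ ℝ f h₁ h₂
    (fun u v v' => by rw [h₃, h₁, h₃ v, h₃ v']) (fun c u v => by rw [h₃, h₂, h₃ v, smul_eq_mul]))
    C hC

theorem abs_inner_snd_le {N : ℕ} (u v : H1 N) :
    |inner ℝ u.1.snd v.1.snd| ≤ 1 * ‖u‖ * ‖v‖ := by
  rw [one_mul]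
  exact (abs_real_inner_le_norm u.1.snd v.1.snd).trans
    (mul_le_mul (norm_snd_le u) (norm_snd_le v) (norm_nonneg _) (norm_nonneg _))

/-- `∫ ∇u·∇v` as a continuous bilinear form. -/
def gradForm (N : ℕ) : H1 N →L[ℝ] H1 N →L[ℝ] ℝ :=
  bilinMk (fun u v : H1 N => inner ℝ u.1.snd v.1.snd)
    (fun u u' v => inner_add_left u.1.snd u'.1.snd v.1.snd)
    (fun c u v => real_inner_smul_left u.1.snd v.1.snd c)
    (fun u v => (real_inner_comm u.1.snd v.1.snd).symm) 1 abs_inner_snd_le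

theorem gradForm_apply {N : ℕ} (u v : H1 N) :
    gradForm N u v = ∫ x, inner ℝ (grad u x) (grad v x) := L2.inner_def u.1.snd v.1.snd

theorem gradForm_self {N : ℕ} (u : H1 N) : gradForm N u u = ‖u.1.snd‖ ^ 2 :=
  real_inner_self_eq_norm_sq u.1.snd

theorem integrable_inner_grad {N : ℕ} (u v : H1 N) :
    Integrable (fun x => inner ℝ (grad u x) (grad v x)) volume :=
  L2.integrable_inner u.1.snd v.1.snd

theorem integrable_mul_val {N : ℕ} {V : Rn N → ℝ} (hV : Continuous V) {M : ℝ}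
    (hM : ∀ x, |V x| ≤ M) (u v : H1 N) :
    Integrable (fun x => V x * (val u x * val v x)) volume :=
  ((memLp_val u).integrable_mul (memLp_val v)).bdd_mul hV.aestronglyMeasurable
    (Eventually.of_forall hM)

theorem integral_val_sq {N : ℕ} (u : H1 N) : ∫ x, val u x * val u x = ‖u.1.fst‖ ^ 2 := by
  rw [← real_inner_self_eq_norm_sq, L2.inner_def]
  rfl

theorem integral_abs_val_mul_le {N : ℕ} (u v : H1 N) :
    ∫ x, |val u x * val v x| ≤ ‖u‖ * ‖v‖ := by
  have h2 : ENNReal.ofReal 2 = 2 := by simp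
  have hu : MemLp (fun x => |val u x|) (ENNReal.ofReal 2) volume := by
    rw [h2]; exact (memLp_val u).norm
  have hv : MemLp (fun x => |val v x|) (ENNReal.ofReal 2) volume := by
    rw [h2]; exact (memLp_val v).norm
  have h := integral_mul_le_Lp_mul_Lq_of_nonneg (p := 2) (q := 2) (Real.HolderConjugate.two_two)
    (Eventually.of_forall fun x => abs_nonneg (val u x))
    (Eventually.of_forall fun x => abs_nonneg (val v x)) hu hv
  have e : ∀ w : H1 N, (∫ x, |val w x| ^ (2 : ℝ)) ^ (1 / (2 : ℝ)) = ‖w.1.fst‖ := fun w => by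
    have : ∫ x, |val w x| ^ (2 : ℝ) = ‖w.1.fst‖ ^ (2 : ℝ) := by
      rw [Real.rpow_two, ← integral_val_sq]
      refine integral_congr_ae (Eventually.of_forall fun x => ?_)
      change |val w x| ^ (2 : ℝ) = _
      rw [Real.rpow_two, sq_abs, sq]
    rw [this, ← Real.rpow_mul (norm_nonneg _)]
    norm_num
  rw [e, e] at h
  simp_rw [abs_mul]
  exact h.trans (mul_le_mul (norm_fst_le u) (norm_fst_le v) (norm_nonneg _) (norm_nonneg _))

theorem integral_pot_add {N : ℕ} {V : Rn N → ℝ} (hV : Continuous V) {M : ℝ}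
    (hM : ∀ x, |V x| ≤ M) (u u' v : H1 N) : ∫ x, V x * (val (u + u') x * val v x)
      = (∫ x, V x * (val u x * val v x)) + ∫ x, V x * (val u' x * val v x) := by
  rw [← integral_add (integrable_mul_val hV hM u v) (integrable_mul_val hV hM u' v)]
  refine integral_congr_ae ?_
  filter_upwards [val_add u u'] with x hx
  rw [hx]; ring

theorem integral_pot_smul {N : ℕ} (V : Rn N → ℝ) (c : ℝ) (u v : H1 N) :
    ∫ x, V x * (val (c • u) x * val v x) = c * ∫ x, V x * (val u x * val v x) := by
  rw [← integral_const_mul]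
  refine integral_congr_ae ?_
  filter_upwards [val_smul c u] with x hx
  rw [hx]; ring

theorem integral_pot_comm {N : ℕ} (V : Rn N → ℝ) (u v : H1 N) :
    ∫ x, V x * (val u x * val v x) = ∫ x, V x * (val v x * val u x) := by
  simp_rw [mul_comm (val u _)]

theorem abs_integral_pot_le {N : ℕ} {V : Rn N → ℝ} {M : ℝ} (hM : ∀ x, |V x| ≤ M) (u v : H1 N) :
    |∫ x, V x * (val u x * val v x)| ≤ M * ‖u‖ * ‖v‖ := by
  have hM0 : 0 ≤ M := (abs_nonneg _).trans (hM 0)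
  have hi : Integrable (fun x => |val u x * val v x|) volume :=
    ((memLp_val u).integrable_mul (memLp_val v)).norm
  have h := norm_integral_le_of_norm_le (f := fun x => V x * (val u x * val v x)) (hi.const_mul M)
    (Eventually.of_forall fun x => by
      rw [norm_mul]
      exact mul_le_mul_of_nonneg_right (hM x) (norm_nonneg _))
  rw [integral_const_mul] at h
  have h2 := mul_le_mul_of_nonneg_left (integral_abs_val_mul_le u v) hM0
  rw [← mul_assoc] at h2
  exact h.trans h2

/-- `∫ V u v` as a continuous bilinear form, for a bounded continuous potential `V`. -/
def potForm {N : ℕ} {V : Rn N → ℝ} (hV : Continuous V) {M : ℝ} (hM : ∀ x, |V x| ≤ M) :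
    H1 N →L[ℝ] H1 N →L[ℝ] ℝ :=
  bilinMk (fun u v : H1 N => ∫ x, V x * (val u x * val v x)) (integral_pot_add hV hM)
    (integral_pot_smul V) (integral_pot_comm V) M (abs_integral_pot_le hM)

theorem potForm_apply {N : ℕ} {V : Rn N → ℝ} (hV : Continuous V) {M : ℝ} (hM : ∀ x, |V x| ≤ M)
    (u v : H1 N) : potForm hV hM u v = ∫ x, V x * (val u x * val v x) := rfl

theorem gradForm_comm {N : ℕ} (u v : H1 N) : gradForm N u v = gradForm N v u :=
  (real_inner_comm u.1.snd v.1.snd).symm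

theorem potForm_comm {N : ℕ} {V : Rn N → ℝ} (hV : Continuous V) {M : ℝ} (hM : ∀ x, |V x| ≤ M)
    (u v : H1 N) : potForm hV hM u v = potForm hV hM v u := integral_pot_comm V u v

theorem gradForm_shift {N : ℕ} (w : Rn N) (u v : H1 N) :
    gradForm N (shift w u) (shift w v) = gradForm N u v := by
  rw [gradForm_apply, gradForm_apply]
  refine Eq.trans ?_ (integral_add_right_eq_self _ w)
  refine integral_congr_ae ?_
  filter_upwards [grad_shift w u, grad_shift w v] with x h1 h2
  rw [h1, h2]

theorem potForm_shift {N : ℕ} {V : Rn N → ℝ} (hV : Continuous V) {M : ℝ} (hM : ∀ x, |V x| ≤ M)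
    (hp : Periodic1 V) (k : Fin N → ℤ) (u v : H1 N) :
    potForm hV hM (shift (intVec k) u) (shift (intVec k) v) = potForm hV hM u v := by
  rw [potForm_apply, potForm_apply]
  refine Eq.trans ?_ (integral_add_right_eq_self _ (intVec k))
  refine integral_congr_ae ?_
  filter_upwards [val_shift (intVec k) u, val_shift (intVec k) v] with x h1 h2
  rw [h1, h2, hp.add_intVec]

/-- The map `u ↦ (αu, βu)`. -/
def pairL (N : ℕ) (α β : ℝ) : H1 N →L[ℝ] ESpace N :=
  ((WithLp.prodContinuousLinearEquiv 2 ℝ (H1 N) (H1 N)).symm :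
    (H1 N × H1 N) →L[ℝ] ESpace N).comp
    ((α • ContinuousLinearMap.id ℝ (H1 N)).prod (β • ContinuousLinearMap.id ℝ (H1 N)))

section

variable {X E : Type*} [NormedAddCommGroup X] [NormedSpace ℝ X] [NormedAddCommGroup E]
  [NormedSpace ℝ E]

/-- The symmetric form `A(u,v') + A(v,u') + B(u,u') + B(v,v')` on pairs, where `f` and `s` are the
two components. -/
def pairForm (f s : E →L[ℝ] X) (A B : X →L[ℝ] X →L[ℝ] ℝ) : E →L[ℝ] E →L[ℝ] ℝ :=
  A.bilinearComp f s + A.bilinearComp s f + (B.bilinearComp f f + B.bilinearComp s s)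

theorem pairForm_apply (f s : E →L[ℝ] X) (A B : X →L[ℝ] X →L[ℝ] ℝ) (z y : E) :
    pairForm f s A B z y = A (f z) (s y) + A (s z) (f y) + (B (f z) (f y) + B (s z) (s y)) := rfl

theorem pairForm_comm (f s : E →L[ℝ] X) {A B : X →L[ℝ] X →L[ℝ] ℝ} (hA : ∀ u v, A u v = A v u)
    (hB : ∀ u v, B u v = B v u) (z y : E) : pairForm f s A B z y = pairForm f s A B y z := by
  rw [pairForm_apply, pairForm_apply, hA (f z), hA (s z), hB (f z), hB (s z)]
  ring

theorem pairForm_congr (f s : E →L[ℝ] X) (A B : X →L[ℝ] X →L[ℝ] ℝ) {z y : E}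
    (h₁ : A (f z) (s z) = A (f y) (s y)) (h₂ : A (s z) (f z) = A (s y) (f y))
    (h₃ : B (f z) (f z) = B (f y) (f y)) (h₄ : B (s z) (s z) = B (s y) (s y)) :
    pairForm f s A B z z = pairForm f s A B y y := by
  rw [pairForm_apply, pairForm_apply, h₁, h₂, h₃, h₄]

theorem pairForm_of_smul {f s : E →L[ℝ] X} (A B : X →L[ℝ] X →L[ℝ] ℝ) {α β : ℝ} {u : X} {z : E}
    (hf : f z = α • u) (hs : s z = β • u) :
    pairForm f s A B z z = 2 * (α * β) * A u u + (α ^ 2 + β ^ 2) * B u u := by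
  rw [pairForm_apply, hf, hs]
  simp only [map_smul, smul_apply, smul_eq_mul]
  ring

theorem pairForm_of_zero_fst {f s : E →L[ℝ] X} (A B : X →L[ℝ] X →L[ℝ] ℝ) (z : E) {y : E}
    (hf : f y = 0) : pairForm f s A B z y = A (f z) (s y) + B (s z) (s y) := by
  rw [pairForm_apply, hf, map_zero, map_zero, add_zero, zero_add]

theorem pairForm_of_zero_snd {f s : E →L[ℝ] X} (A B : X →L[ℝ] X →L[ℝ] ℝ) (z : E) {y : E}
    (hs : s y = 0) : pairForm f s A B z y = A (s z) (f y) + B (f z) (f y) := by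
  rw [pairForm_apply, hs, map_zero, map_zero, add_zero, zero_add]

/-- On a pair `(αu, βu)` the form is `2αβ A(u,u)` plus a `B`-term. The hypothesis lets the first
dominate the `B`-term whatever its sign, so it also serves for `(-αu, βu)` in `pairForm_upper`. -/
theorem pairForm_lower {f s : E →L[ℝ] X} (A B : X →L[ℝ] X →L[ℝ] ℝ) {α β c : ℝ} {u : X} {z : E}
    (hf : f z = α • u) (hs : s z = β • u)
    (hc : c ≤ 2 * (α * β) * A u u - (α ^ 2 + β ^ 2) * |B u u|) : c ≤ pairForm f s A B z z := by
  rw [pairForm_of_smul A B hf hs]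
  have h := mul_le_mul_of_nonneg_left (neg_abs_le (B u u)) (show 0 ≤ α ^ 2 + β ^ 2 by positivity)
  linarith

theorem pairForm_upper {f s : E →L[ℝ] X} (A B : X →L[ℝ] X →L[ℝ] ℝ) {α β c : ℝ} {u : X} {z : E}
    (hf : f z = (-α) • u) (hs : s z = β • u)
    (hc : c ≤ 2 * (α * β) * A u u - (α ^ 2 + β ^ 2) * |B u u|) : pairForm f s A B z z ≤ -c := by
  rw [pairForm_of_smul A B hf hs, neg_sq]
  have h := mul_le_mul_of_nonneg_left (le_abs_self (B u u)) (show 0 ≤ α ^ 2 + β ^ 2 by positivity)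
  linarith

end

end HamSys
end

/-! ### Concentration compactness for unit sequences and vanishing of `Ψ`. -/

noncomputable section

namespace HamSys

open scoped ENNReal NNReal

/-- The largest mass of `u` seen through translates of the cutoff function. -/
def localMass {N : ℕ} (u : H1 N) : ℝ≥0∞ := ⨆ y, ∫⁻ x, ‖cutoff N (x + y) * val u x‖ₑ

/-- A lattice translation moves the centre into the ball of radius `N`; with the outer radius `2` of
the cutoff, its support lies in the fixed ball of radius `N + 2`. -/
theorem lintegral_cutoff_le {N : ℕ} (u : H1 N) (y : Rn N) : ∃ k : Fin N → ℤ,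
    ∫⁻ x, ‖cutoff N (x + y) * val u x‖ₑ
      ≤ ∫⁻ x, ‖val (shift (intVec k) u) x‖ₑ
        * ‖(Metric.closedBall (0 : Rn N) (N + 2)).indicator (fun _ => (1 : ℝ)) x‖ₑ := by
  obtain ⟨k, hk⟩ := exists_intVec_norm_le y
  refine ⟨k, ?_⟩
  rw [← lintegral_add_right_eq_self (fun x => ‖cutoff N (x + y) * val u x‖ₑ) (intVec k)]
  refine lintegral_mono_ae ?_
  filter_upwards [val_shift (intVec k) u] with x hx
  rw [hx, enorm_mul, mul_comm]
  refine mul_le_mul' le_rfl ?_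
  by_cases hxB : x ∈ Metric.closedBall (0 : Rn N) (N + 2)
  · rw [Set.indicator_of_mem hxB, enorm_le_iff_norm_le, norm_one,
      Real.norm_of_nonneg (cutoff N).nonneg]
    exact (cutoff N).le_one
  · have : cutoff N (x + intVec k + y) = 0 := by
      refine (cutoff N).zero_of_le_dist ?_
      rw [dist_zero_right]
      rw [mem_closedBall_zero_iff, not_le] at hxB
      have h1 : x = (x + intVec k + y) - (y + intVec k) := by abel
      have h2 := norm_sub_le (x + intVec k + y) (y + intVec k)
      rw [← h1] at h2
      change (2 : ℝ) ≤ _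
      linarith
    rw [this]
    simp

theorem memLp_indicator_ball (N : ℕ) (r : ℝ) : MemLp
    ((Metric.closedBall (0 : Rn N) r).indicator (fun _ => (1 : ℝ))) 2 volume :=
  memLp_indicator_const 2 Metric.isClosed_closedBall.measurableSet 1
    (Or.inr (isCompact_closedBall (0 : Rn N) r).measure_lt_top.ne)

/-- Nonvanishing sequences have nonzero weak limits up to integer translations. -/
theorem exists_shift_weakTo {N : ℕ} {e : ℕ → H1 N} (he : ∀ n, ‖e n‖ = 1) {ε : ℝ≥0∞} (hε : ε ≠ 0)
    (h : ∀ n, ε < localMass (e n)) : ∃ (φ : ℕ → ℕ) (k : ℕ → Fin N → ℤ) (e₀ : H1 N),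
      StrictMono φ ∧ e₀ ≠ 0 ∧ WeakTo (fun n => shift (intVec (k n)) (e (φ n))) e₀ := by
  have := separableSpace_H1 (N := N)
  have hex : ∀ n, ∃ k : Fin N → ℤ, ε < ∫⁻ x, ‖val (shift (intVec k) (e n)) x‖ₑ
        * ‖(Metric.closedBall (0 : Rn N) (N + 2)).indicator (fun _ => (1 : ℝ)) x‖ₑ := fun n => by
    obtain ⟨y, hy⟩ := lt_iSup_iff.1 (h n)
    obtain ⟨k, hk⟩ := lintegral_cutoff_le (e n) y
    exact ⟨k, hy.trans_le hk⟩
  choose k hk using hex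
  obtain ⟨e₀, φ, hφ, hw⟩ := exists_weakTo_subseq (u := fun n => shift (intVec (k n)) (e n)) (R := 1)
    (fun n => by rw [norm_shift, he])
  refine ⟨φ, k ∘ φ, e₀, hφ, ?_, hw⟩
  -- A zero weak limit would, by Rellich's theorem on the fixed ball, send to zero the masses that
  -- stay above `ε`.
  rintro rfl
  have hr := rellich (M := 1) (fun n => by
    change ‖shift (intVec (k (φ n))) (e (φ n))‖ ≤ _
    rw [norm_shift, he]; simp) hw (memLp_indicator_ball N (N + 2))
  have := ge_of_tendsto' hr fun n => (hk (φ n)).le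
  exact hε (le_antisymm this bot_le)

/-- Either the largest local mass tends to zero along a subsequence, and the quantitative vanishing
lemma applies, or it is eventually bounded below, and lattice translations keep the mass in a fixed
ball. -/
theorem lions_alternative {N : ℕ} (hN : 3 ≤ N) {e : ℕ → H1 N} (he : ∀ n, ‖e n‖ = 1) :
    (∃ φ : ℕ → ℕ, StrictMono φ ∧
      Tendsto (fun n => ∫⁻ x, ‖val (e (φ n)) x‖ₑ ^ (2 / (N : ℝ) + 2)) atTop (𝓝 0)) ∨
    ∃ (φ : ℕ → ℕ) (k : ℕ → Fin N → ℤ) (e₀ : H1 N), StrictMono φ ∧ e₀ ≠ 0 ∧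
      WeakTo (fun n => shift (intVec (k n)) (e (φ n))) e₀ := by
  by_cases hv : ∀ n : ℕ, ∃ᶠ m in atTop, localMass (e m) ≤ ((n : ℝ≥0∞) + 1)⁻¹
  · left
    obtain ⟨φ, hφ, H⟩ := extraction_forall_of_frequently hv
    refine ⟨φ, hφ, ?_⟩
    obtain ⟨C, hC, HC⟩ := exists_vanishing_const hN
    have hq : 0 < 2 / (N : ℝ) := by
      have : (0 : ℝ) < N := by exact_mod_cast (by omega : 0 < N)
      positivity
    have hb : ∀ n, ∫⁻ x, ‖val (e (φ n)) x‖ₑ ^ (2 / (N : ℝ) + 2)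
        ≤ C * (((n : ℝ≥0∞) + 1)⁻¹ ^ (2 / (N : ℝ))) := fun n => by
      have h1 : ‖e (φ n)‖ₑ = 1 := by rw [← ofReal_norm, he, ENNReal.ofReal_one]
      have h2 := HC (e (φ n)) (((n : ℝ≥0∞) + 1)⁻¹) fun y =>
        (le_iSup (fun y => ∫⁻ x, ‖cutoff N (x + y) * val (e (φ n)) x‖ₑ) y).trans (H n)
      rwa [h1, ENNReal.one_rpow, mul_one] at h2
    have hl : Tendsto (fun n : ℕ => C * (((n : ℝ≥0∞) + 1)⁻¹ ^ (2 / (N : ℝ)))) atTop (𝓝 0) := by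
      have h1 : Tendsto (fun n : ℕ => ((n : ℝ≥0∞) + 1)⁻¹) atTop (𝓝 0) := by
        have := (tendsto_add_atTop_iff_nat 1).2 ENNReal.tendsto_inv_nat_nhds_zero
        simpa using this
      have h2 := (ENNReal.continuous_rpow_const (y := 2 / (N : ℝ))).tendsto 0 |>.comp h1
      rw [ENNReal.zero_rpow_of_pos hq] at h2
      have h3 := ENNReal.Tendsto.const_mul h2 (Or.inr hC)
      rwa [mul_zero] at h3
    exact tendsto_of_tendsto_of_tendsto_of_le_of_le tendsto_const_nhds hl (fun _ => bot_le) hb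
  · right
    push Not at hv
    obtain ⟨n, hn⟩ := hv
    obtain ⟨m₀, hm₀⟩ := eventually_atTop.1 hn
    obtain ⟨φ, k, e₀, hφ, h0, hw⟩ := exists_shift_weakTo (e := fun m => e (m + m₀))
      (fun m => he _) (ε := ((n : ℝ≥0∞) + 1)⁻¹) (by simp)
      (fun m => hm₀ _ (Nat.le_add_left _ _))
    exact ⟨fun m => φ m + m₀, k, e₀, fun i j hij => Nat.add_lt_add_right (hφ hij) _, h0, hw⟩

/-- Vanishing of `Ψ` along sequences vanishing in a subcritical Lebesgue space. -/
theorem ofReal_Psi_le {N : ℕ} {W fu fv : Rn N → ℝ → ℝ → ℝ} {K : ℝ}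
    (h : IsNonlin W fu fv) (hK : IsEmbConst N K) {q ε C : ℝ} (hq : 0 ≤ q) (hε : 0 ≤ ε) (hC : 0 ≤ C)
    (H : ∀ x u v, |fu x u v| + |fv x u v|
      ≤ ε * ((|u| + |v|) + (|u| + |v|) ^ (sStar N - 1)) + C * (|u| + |v|) ^ q) (z : ESpace N)
    {M : ℝ} (hM : K * ‖z‖ ≤ M) :
    ENNReal.ofReal (Psi W z) ≤ ENNReal.ofReal (ε * (M * M + M ^ (sStar N - 1) * M))
      + ENNReal.ofReal C * ∫⁻ x, ‖zabs z x‖ₑ ^ (q + 1) := by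
  have hs := hK.two_lt
  have hM0 : 0 ≤ K * ‖z‖ := mul_nonneg hK.nonneg (norm_nonneg _)
  have hi1 := (hK.integrable_mul z z)
  have hi2 := (hK.integrable_rpow_mul z z)
  have hi : Integrable (fun x => ε * (zabs z x * zabs z x + zabs z x ^ (sStar N - 1) * zabs z x))
      volume := (hi1.add hi2).const_mul ε
  have hnn : ∀ x, 0 ≤ ε * (zabs z x * zabs z x + zabs z x ^ (sStar N - 1) * zabs z x) := fun x => by
    have := zabs_nonneg z x
    positivity
  have hintg : ∫ x, ε * (zabs z x * zabs z x + zabs z x ^ (sStar N - 1) * zabs z x)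
      ≤ ε * (M * M + M ^ (sStar N - 1) * M) := by
    rw [integral_const_mul, integral_add hi1 hi2]
    refine mul_le_mul_of_nonneg_left (add_le_add ((hK.integral_mul_le z z).trans ?_)
      ((hK.integral_rpow_mul_le z z).trans ?_)) hε
    · exact mul_le_mul hM hM hM0 (hM0.trans hM)
    · exact mul_le_mul (Real.rpow_le_rpow hM0 hM (by linarith)) hM hM0
        (Real.rpow_nonneg (hM0.trans hM) _)
  unfold Psi
  rw [ofReal_integral_eq_lintegral_ofReal (h.integrable hK z)
    (Eventually.of_forall fun x => h.nonneg _ _ _)]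
  refine le_trans ?_ (add_le_add (ENNReal.ofReal_le_ofReal hintg) le_rfl)
  rw [ofReal_integral_eq_lintegral_ofReal hi (Eventually.of_forall hnn),
    ← lintegral_const_mul' _ _ ENNReal.ofReal_ne_top,
    ← lintegral_add_left' hi.1.aemeasurable.ennreal_ofReal]
  refine lintegral_mono fun x => ?_
  have hz := zabs_nonneg z x
  have e : ENNReal.ofReal C * ‖zabs z x‖ₑ ^ (q + 1) = ENNReal.ofReal (C * zabs z x ^ (q + 1)) := by
    rw [Real.enorm_of_nonneg hz, ENNReal.ofReal_rpow_of_nonneg hz (by linarith),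
      ENNReal.ofReal_mul hC]
  rw [e, ← ENNReal.ofReal_add (hnn x) (by positivity)]
  refine ENNReal.ofReal_le_ofReal ?_
  have h1 : W x (val z.fst x) (val z.snd x) ≤ 1 / 2 * fdot fu fv z z x := h.le_half _ _ _
  have h2 := (le_abs_self _).trans (abs_fdot_le fu fv z z x)
  have h3 := mul_le_mul_of_nonneg_right (H x (val z.fst x) (val z.snd x)) hz
  have h4 : zabs z x ^ (q + 1) = zabs z x ^ q * zabs z x := Real.rpow_add_one' hz (by linarith)
  have h5 : 0 ≤ C * zabs z x ^ q * zabs z x := by positivity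
  rw [h4]
  have h6 : (ε * ((|val z.fst x| + |val z.snd x|) + (|val z.fst x| + |val z.snd x|) ^ (sStar N - 1))
      + C * (|val z.fst x| + |val z.snd x|) ^ q) * zabs z x
      = ε * (zabs z x * zabs z x + zabs z x ^ (sStar N - 1) * zabs z x)
        + C * zabs z x ^ q * zabs z x := by
    unfold zabs; ring
  rw [h6] at h3
  have h7 := hnn x
  linarith

/-- The `L²` and critical parts carry an arbitrarily small coefficient and are bounded; the rest is
one subcritical power, which vanishes by hypothesis. Hence one exponent suffices. -/
theorem tendsto_Psi_zero {N : ℕ} {W fu fv : Rn N → ℝ → ℝ → ℝ} {K : ℝ}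
    (h : IsNonlin W fu fv) (hK : IsEmbConst N K) {z : ℕ → ESpace N} {M : ℝ} (hM : ∀ n, ‖z n‖ ≤ M)
    {q : ℝ} (hq : 0 ≤ q) (hz : Tendsto (fun n => ∫⁻ x, ‖zabs (z n) x‖ₑ ^ (q + 1)) atTop (𝓝 0)) :
    Tendsto (fun n => Psi W (z n)) atTop (𝓝 0) := by
  have hK0 := hK.nonneg
  have hM0 : 0 ≤ K * M := mul_nonneg hK0 ((norm_nonneg _).trans (hM 0))
  set A := K * M * (K * M) + (K * M) ^ (sStar N - 1) * (K * M) with hA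
  have hA0 : 0 ≤ A := by
    have := Real.rpow_nonneg hM0 (sStar N - 1)
    positivity
  have key : Tendsto (fun n => ENNReal.ofReal (Psi W (z n))) atTop (𝓝 0) := by
    rw [ENNReal.tendsto_nhds_zero]
    intro δ hδ
    obtain ⟨δ', hδ', hδδ⟩ : ∃ δ' : ℝ, 0 < δ' ∧ ENNReal.ofReal δ' ≤ δ := by
      obtain ⟨r, hr0, hr⟩ := ENNReal.lt_iff_exists_nnreal_btwn.1 hδ
      refine ⟨r, by exact_mod_cast hr0, ?_⟩
      rw [ENNReal.ofReal_coe_nnreal]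
      exact hr.le
    obtain ⟨C, hC, H⟩ := h.vanishing_growth q hq (ε := δ' / 2 / (A + 1)) (by positivity)
    have hl := ENNReal.Tendsto.const_mul (a := ENNReal.ofReal C) hz (Or.inr ENNReal.ofReal_ne_top)
    rw [mul_zero] at hl
    filter_upwards [(ENNReal.tendsto_nhds_zero.1 hl) (ENNReal.ofReal (δ' / 2)) (by simpa using hδ')]
      with n hn
    refine (ofReal_Psi_le h hK hq (by positivity) hC H (z n)
      (mul_le_mul_of_nonneg_left (hM n) hK0)).trans ((add_le_add (b := ENNReal.ofReal (δ' / 2)) ?_ hn).trans ?_)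
    · refine ENNReal.ofReal_le_ofReal ?_
      rw [← hA, div_mul_eq_mul_div, div_le_iff₀ (by positivity)]
      nlinarith
    · rw [← ENNReal.ofReal_add (by positivity) (by positivity), add_halves]
      exact hδδ
  have h2 := (ENNReal.tendsto_toReal ENNReal.zero_ne_top).comp key
  rw [ENNReal.toReal_zero] at h2
  refine h2.congr fun n => ?_
  exact ENNReal.toReal_ofReal (Psi_nonneg h _)

theorem zabs_pairL {N : ℕ} (α β s : ℝ) (u : H1 N) :
    zabs (s • pairL N α β u) =ᵐ[volume] fun x => (|s * α| + |s * β|) * |val u x| := by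
  filter_upwards [val_smul (s * α) u, val_smul (s * β) u] with x h1 h2
  have e1 : (s • pairL N α β u).fst = (s * α) • u := smul_smul s α u
  have e2 : (s • pairL N α β u).snd = (s * β) • u := smul_smul s β u
  rw [zabs, e1, e2, h1, h2, abs_mul (s * α), abs_mul (s * β)]
  ring

theorem norm_smul_apply_le {X E : Type*} [NormedAddCommGroup X] [NormedSpace ℝ X]
    [NormedAddCommGroup E] [NormedSpace ℝ E] (T : X →L[ℝ] E) (s : ℝ) {u : X} (hu : ‖u‖ = 1) :
    ‖s • T u‖ ≤ |s| * ‖T‖ := by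
  rw [norm_smul, Real.norm_eq_abs]
  refine mul_le_mul_of_nonneg_left ?_ (abs_nonneg s)
  have := T.le_opNorm u
  rwa [hu, mul_one] at this

theorem tendsto_Psi_pairL {N : ℕ} {W fu fv : Rn N → ℝ → ℝ → ℝ} {K : ℝ}
    (h : IsNonlin W fu fv) (hK : IsEmbConst N K) {e : ℕ → H1 N} (he : ∀ n, ‖e n‖ = 1)
    (hv : Tendsto (fun n => ∫⁻ x, ‖val (e n) x‖ₑ ^ (2 / (N : ℝ) + 2)) atTop (𝓝 0)) (α β s : ℝ) :
    Tendsto (fun n => Psi W (s • pairL N α β (e n))) atTop (𝓝 0) := by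
  have hp : 0 ≤ 2 / (N : ℝ) := by positivity
  refine tendsto_Psi_zero h hK (M := |s| * ‖pairL N α β‖) (fun n => ?_) (q := 2 / (N : ℝ) + 1)
    (by positivity) ?_
  · exact norm_smul_apply_le _ s (he n)
  · set c := |s * α| + |s * β| with hc
    have hl := ENNReal.Tendsto.const_mul (a := ‖c‖ₑ ^ (2 / (N : ℝ) + 2)) hv
      (Or.inr (ENNReal.rpow_ne_top_of_nonneg (by positivity) enorm_ne_top))
    rw [mul_zero] at hl
    refine hl.congr fun n => ?_
    rw [← lintegral_const_mul' _ _ (ENNReal.rpow_ne_top_of_nonneg (by positivity) enorm_ne_top)]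
    refine lintegral_congr_ae ?_
    filter_upwards [zabs_pairL α β s (e n)] with x hx
    rw [hx, ← hc, enorm_mul, ENNReal.mul_rpow_of_nonneg _ _ (by positivity),
      show 2 / (N : ℝ) + 1 + 1 = 2 / (N : ℝ) + 2 by ring]
    simp [Real.enorm_eq_ofReal_abs]

end HamSys
end

/-! ### Test functions in `H¹`, and the given nonlinearity as an instance of `IsNonlin`. -/

noncomputable section

namespace HamSys

open scoped ENNReal NNReal

theorem IsTest.memLp_gradC {N : ℕ} {φ : Rn N → ℝ} (hφ : IsTest φ) : MemLp (gradC φ) 2 volume :=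
  hφ.continuous_gradC.memLp_of_hasCompactSupport hφ.hasCompactSupport_gradC

theorem IsTest.isWeakGrad {N : ℕ} {φ : Rn N → ℝ} (hφ : IsTest φ) :
    IsWeakGrad (hφ.memLp.toLp φ) (hφ.memLp_gradC.toLp (gradC φ)) := by
  intro ψ hψ i
  have e1 : ∫ x, hφ.memLp.toLp φ x * partialD i ψ x = ∫ x, φ x * partialD i ψ x := by
    refine integral_congr_ae ?_
    filter_upwards [hφ.memLp.coeFn_toLp] with x hx
    rw [hx]
  have e2 : ∫ x, hφ.memLp_gradC.toLp (gradC φ) x i * ψ x = ∫ x, partialD i φ x * ψ x := by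
    refine integral_congr_ae ?_
    filter_upwards [hφ.memLp_gradC.coeFn_toLp] with x hx
    rw [hx]
    rfl
  rw [e1, e2]
  exact integral_mul_fderiv_eq_neg_fderiv_mul_of_integrable
    ((hφ.memLp_partialD i).integrable_mul hψ.memLp) (hφ.memLp.integrable_mul (hψ.memLp_partialD i))
    (hφ.memLp.integrable_mul hψ.memLp) (fun x _ => hφ.smooth.differentiable (by simp) x)
    (fun x _ => hψ.smooth.differentiable (by simp) x)

/-- A test function as an element of `H¹`. -/
def IsTest.toH1 {N : ℕ} {φ : Rn N → ℝ} (hφ : IsTest φ) : H1 N :=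
  ⟨WithLp.toLp 2 (hφ.memLp.toLp φ, hφ.memLp_gradC.toLp (gradC φ)), hφ.isWeakGrad⟩

theorem IsTest.val_toH1 {N : ℕ} {φ : Rn N → ℝ} (hφ : IsTest φ) : val hφ.toH1 =ᵐ[volume] φ :=
  hφ.memLp.coeFn_toLp

theorem IsTest.grad_toH1 {N : ℕ} {φ : Rn N → ℝ} (hφ : IsTest φ) :
    grad hφ.toH1 =ᵐ[volume] gradC φ := hφ.memLp_gradC.coeFn_toLp

/-- Uniqueness of the weak gradient. -/
theorem eq_zero_of_val_ae_eq {N : ℕ} {u : H1 N} (h : ∀ᵐ x, val u x = 0) : u = 0 := by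
  have h1 : u.1.fst = 0 := by
    refine Lp.ext ?_
    filter_upwards [h, Lp.coeFn_zero ℝ 2 (volume : Measure (Rn N))] with x hx h0
    rw [h0]
    exact hx
  have hi : ∀ i, ∀ᵐ x, grad u x i = 0 := by
    intro i
    refine ae_eq_zero_of_integral_contDiff_smul_eq_zero
      ((memLp_coord u.1.snd i).locallyIntegrable (by norm_num)) fun φ hφ hc => ?_
    have hw := isWeakGradFun_val u φ ⟨hφ, hc⟩ i
    have h0 : ∫ x, val u x * partialD i φ x = 0 := by
      rw [← integral_zero (Rn N) ℝ]
      refine integral_congr_ae ?_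
      filter_upwards [h] with x hx
      rw [hx, zero_mul]
    rw [h0, eq_comm, neg_eq_zero] at hw
    rw [← hw]
    exact integral_congr_ae (Eventually.of_forall fun x => mul_comm _ _)
  have h2 : u.1.snd = 0 := by
    refine Lp.ext ?_
    filter_upwards [ae_all_iff.2 hi, Lp.coeFn_zero (Rn N) 2 (volume : Measure (Rn N))] with x hx h0
    rw [h0]
    ext i
    exact hx i
  exact H1_ext h1 h2

/-- Supplies the unit vector from which the nonemptiness of the Nehari set starts. -/
theorem nontrivial_H1 (N : ℕ) : Nontrivial (H1 N) := by
  refine ⟨⟨(isTest_cutoff N).toH1, 0, fun h => ?_⟩⟩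
  have h1 := (isTest_cutoff N).val_toH1
  rw [h] at h1
  have h2 : (cutoff N : Rn N → ℝ) =ᵐ[volume] fun _ => 0 := h1.symm.trans val_zero
  have h3 := (Continuous.ae_eq_iff_eq volume (isTest_cutoff N).smooth.continuous
    continuous_const).1 h2
  have h4 : cutoff N 0 = 1 :=
    (cutoff N).one_of_mem_closedBall (Metric.mem_closedBall_self (cutoff N).rIn_pos.le)
  rw [congrFun h3 0] at h4
  exact zero_ne_one h4

theorem IsNonlin.Wu_eq {N : ℕ} {W fu fv : Rn N → ℝ → ℝ → ℝ} (h : IsNonlin W fu fv) (x : Rn N)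
    (u v : ℝ) : Wu W x u v = fu x u v := (h.hasDerivAt_fst x u v).deriv

theorem IsNonlin.Wv_eq {N : ℕ} {W fu fv : Rn N → ℝ → ℝ → ℝ} (h : IsNonlin W fu fv) (x : Rn N)
    (u v : ℝ) : Wv W x u v = fv x u v := (h.hasDerivAt_snd x u v).deriv

theorem locallyIntegrable_of_growth {N : ℕ} {K : ℝ} (hK : IsEmbConst N K)
    {F : Rn N → ℝ → ℝ → ℝ} (hF : Continuous fun q : Rn N × ℝ × ℝ => F q.1 q.2.1 q.2.2) {C : ℝ}
    (H : ∀ x u v, |F x u v| ≤ C * ((|u| + |v|) + (|u| + |v|) ^ (sStar N - 1))) (z : ESpace N) :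
    LocallyIntegrable (fun x => F x (val z.fst x) (val z.snd x)) volume := by
  have hs := hK.two_lt
  have h1 : LocallyIntegrable (zabs z) volume := (hK.memLp_two z).locallyIntegrable (by norm_num)
  have h2 : LocallyIntegrable (fun x => zabs z x ^ (sStar N - 1)) volume :=
    (hK.memLp_rpow z).locallyIntegrable (by
      rw [ENNReal.one_le_ofReal, one_le_div (by linarith)]; linarith)
  refine ((h1.add h2).smul C).mono (aestronglyMeasurable_comp hF z)
    (Eventually.of_forall fun x => ?_)
  exact (H x _ _).trans (le_abs_self _)

/-- The nonlinearities of the theorem satisfy the pointwise hypotheses. -/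
theorem exists_isNonlin {N : ℕ} (hN : 3 ≤ N) {k l : ℕ} (α β : Fin k → ℝ) (α' β' : Fin l → ℝ)
    {g : Fin k → Rn N → ℝ → ℝ} {h : Fin l → Rn N → ℝ → ℝ} (hαβ' : ∀ j, β' j ^ 2 < α' j)
    (hg : ∀ i, ClassND (g i)) (hh : ∀ j, ClassND (h j)) {W : Rn N → ℝ → ℝ → ℝ}
    (hW : ∀ x u v, W x u v =
      (∑ i, ∫ s in (0 : ℝ)..|α i * u + β i * v|, g i x s * s)
        + ∑ j, ∫ s in (0 : ℝ)..√(u ^ 2 + 2 * β' j * u * v + α' j * v ^ 2), h j x s * s) :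
    ∃ fu fv, IsNonlin W fu fv := by
  -- The parameter `s = 0` produces `|αu + βv|`; below, `α' > β'²` allows `u² + 2β'uv + α'v² = (u +
  -- β'v)² + (α' - β'²)v²`.
  have h1 := IsNonlin.sum Finset.univ fun i => (hg i).isNonlin hN (α i) (β i) 0
  have h2 := IsNonlin.sum Finset.univ fun j => (hh j).isNonlin hN 1 (β' j) (√(α' j - β' j ^ 2))
  have e : W = fun x u v =>
      (∑ i, ∫ t in (0 : ℝ)..rad (α i) (β i) 0 u v, g i x t * t)
      + ∑ j, ∫ t in (0 : ℝ)..rad 1 (β' j) (√(α' j - β' j ^ 2)) u v, h j x t * t := by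
    funext x u v
    rw [hW]
    congr 1
    · refine Finset.sum_congr rfl fun i _ => ?_
      rw [rad, zero_mul, zero_pow two_ne_zero, add_zero, Real.sqrt_sq_eq_abs]
    · refine Finset.sum_congr rfl fun j _ => ?_
      have : (1 * u + β' j * v) ^ 2 + (√(α' j - β' j ^ 2) * v) ^ 2
          = u ^ 2 + 2 * β' j * u * v + α' j * v ^ 2 := by
        rw [mul_pow, Real.sq_sqrt (sub_nonneg.2 (hαβ' j).le)]; ring
      rw [rad, this]
  rw [e]
  exact ⟨_, _, h1.add h2⟩

end HamSys
end

/-! ### The energy of the system as a `Saddle`, and verification of the abstract hypotheses. -/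

noncomputable section

namespace HamSys

open scoped ENNReal NNReal

/-- The coercivity constant of the quadratic form. -/
def coercivity (a b η m : ℝ) : ℝ := 2 * (a⁻¹ * b⁻¹) * min 1 ((1 - η) * m)

theorem coercivity_pos {a b η m : ℝ} (ha : 0 < a) (hb : 0 < b) (hη : η < 1) (hm : 0 < m) :
    0 < coercivity a b η m := by
  have : 0 < 1 - η := by linarith
  unfold coercivity
  positivity

/-- Here `F = ∫u²`, `G = ∫|∇u|²`, `P = ∫V₁u²`, `Q = ∫V₂u²`. The identity `(a⁻² + b⁻²)·2ηab/(a² + b²)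
= 2η/(ab)` shows that the `V₂`-term consumes only the fraction `η` of `P`; the bound on `V₂` is
shaped for exactly this. -/
theorem coercivity_le {a b η m F G P Q n A : ℝ} (ha : 0 < a) (hb : 0 < b) (hη : η < 1)
    (hG : 0 ≤ G) (hF : 0 ≤ F) (hP : m * F ≤ P) (hn : n = F + G) (hA : A = G + P)
    (hQ : |Q| ≤ 2 * η * a * b / (a ^ 2 + b ^ 2) * P) :
    coercivity a b η m * n ≤ 2 * (a⁻¹ * b⁻¹) * A - (a⁻¹ ^ 2 + b⁻¹ ^ 2) * |Q| := by
  subst hn hA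
  have h1 : (a⁻¹ ^ 2 + b⁻¹ ^ 2) * |Q| ≤ 2 * (a⁻¹ * b⁻¹) * (η * P) := by
    calc (a⁻¹ ^ 2 + b⁻¹ ^ 2) * |Q|
        ≤ (a⁻¹ ^ 2 + b⁻¹ ^ 2) * (2 * η * a * b / (a ^ 2 + b ^ 2) * P) := by gcongr
      _ = 2 * (a⁻¹ * b⁻¹) * (η * P) := by
        field_simp
        ring
  have h2 : min 1 ((1 - η) * m) * (F + G) ≤ G + (1 - η) * P := by
    have h3 : min 1 ((1 - η) * m) * F ≤ (1 - η) * m * F :=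
      mul_le_mul_of_nonneg_right (min_le_right _ _) hF
    have h4 : min 1 ((1 - η) * m) * G ≤ 1 * G := mul_le_mul_of_nonneg_right (min_le_left _ _) hG
    have h5 : (1 - η) * (m * F) ≤ (1 - η) * P := mul_le_mul_of_nonneg_left hP (by linarith)
    linarith
  have h3 : 0 < 2 * (a⁻¹ * b⁻¹) := by positivity
  have h4 := mul_le_mul_of_nonneg_left h2 h3.le
  unfold coercivity
  linarith

theorem le_potForm {N : ℕ} {V : Rn N → ℝ} (hV : Continuous V) {M : ℝ} (hM : ∀ x, |V x| ≤ M)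
    {m : ℝ} (hm : ∀ x, m ≤ V x) (u : H1 N) : m * ‖u.1.fst‖ ^ 2 ≤ potForm hV hM u u := by
  rw [potForm_apply, ← integral_val_sq, ← integral_const_mul]
  refine integral_mono (((memLp_val u).integrable_mul (memLp_val u)).const_mul m)
    (integrable_mul_val hV hM u u) fun x => ?_
  exact mul_le_mul_of_nonneg_right (hm x) (mul_self_nonneg _)

theorem abs_potForm_le {N : ℕ} {V V' : Rn N → ℝ} (hV : Continuous V) {M : ℝ} (hM : ∀ x, |V x| ≤ M)
    (hV' : Continuous V') {M' : ℝ} (hM' : ∀ x, |V' x| ≤ M') {κ : ℝ} (h : ∀ x, |V' x| ≤ κ * V x)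
    (u : H1 N) : |potForm hV' hM' u u| ≤ κ * potForm hV hM u u := by
  rw [potForm_apply, potForm_apply, ← integral_const_mul]
  refine norm_integral_le_of_norm_le (f := fun x => V' x * (val u x * val u x))
    ((integrable_mul_val hV hM u u).const_mul κ) (Eventually.of_forall fun x => ?_)
  rw [norm_mul, Real.norm_of_nonneg (mul_self_nonneg (val u x)), ← mul_assoc κ]
  exact mul_le_mul_of_nonneg_right (h x) (mul_self_nonneg (val u x))

/-- The projection `z ↦ (au + bv)/2` onto the positive component. -/
def projP (N : ℕ) (a b : ℝ) : ESpace N →L[ℝ] H1 N := (a / 2) • fstE N + (b / 2) • sndE N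

theorem ESpace_ext {N : ℕ} {z y : ESpace N} (h1 : z.fst = y.fst) (h2 : z.snd = y.snd) : z = y :=
  WithLp.ofLp_injective 2 (Prod.ext h1 h2)

section

variable {X : Type*} [AddCommGroup X] [Module ℝ X] {a b : ℝ}

theorem split_fst (ha : a ≠ 0) (u v : X) :
    u = a⁻¹ • ((a / 2) • u + (b / 2) • v) + (-a⁻¹) • ((b / 2) • v - (a / 2) • u) := by
  have : a⁻¹ • ((a / 2) • u + (b / 2) • v) + (-a⁻¹) • ((b / 2) • v - (a / 2) • u)
      = (a⁻¹ * a) • u := by module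
  rw [this, inv_mul_cancel₀ ha, one_smul]

theorem split_snd (hb : b ≠ 0) (u v : X) :
    v = b⁻¹ • ((a / 2) • u + (b / 2) • v) + b⁻¹ • ((b / 2) • v - (a / 2) • u) := by
  have : b⁻¹ • ((a / 2) • u + (b / 2) • v) + b⁻¹ • ((b / 2) • v - (a / 2) • u)
      = (b⁻¹ * b) • v := by module
  rw [this, inv_mul_cancel₀ hb, one_smul]

theorem join_pos (ha : a ≠ 0) (hb : b ≠ 0) (p : X) :
    (a / 2) • (a⁻¹ • p) + (b / 2) • (b⁻¹ • p) = p := by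
  rw [smul_smul, smul_smul, ← add_smul]
  have : a / 2 * a⁻¹ + b / 2 * b⁻¹ = 1 := by field_simp; norm_num
  rw [this, one_smul]

theorem join_neg (ha : a ≠ 0) (hb : b ≠ 0) (p : X) :
    (a / 2) • ((-a⁻¹) • p) + (b / 2) • (b⁻¹ • p) = 0 := by
  rw [smul_smul, smul_smul, ← add_smul]
  have : a / 2 * -a⁻¹ + b / 2 * b⁻¹ = 0 := by field_simp; norm_num
  rw [this, zero_smul]

end

/-- Bounds for the potentials, collected for the construction of the quadratic form. -/
structure PotBounds {N : ℕ} (a b η : ℝ) (V₁ V₂ : Rn N → ℝ) (m M₁ M₂ : ℝ) : Prop where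
  a_pos : 0 < a
  b_pos : 0 < b
  η_lt : η < 1
  m_pos : 0 < m
  cont₁ : Continuous V₁
  cont₂ : Continuous V₂
  bound : ∀ x, |V₂ x| ≤ 2 * η * a * b / (a ^ 2 + b ^ 2) * V₁ x
  lower : ∀ x, m ≤ V₁ x
  upper₁ : ∀ x, |V₁ x| ≤ M₁
  upper₂ : ∀ x, |V₂ x| ≤ M₂

theorem CondV0.exists_potBounds {N : ℕ} {a b η : ℝ} {V₁ V₂ : Rn N → ℝ} (h : CondV0 a b η V₁ V₂)
    (ha : 0 < a) (hb : 0 < b) (hη₀ : 0 < η) (hη₁ : η < 1) :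
    ∃ m M₁ M₂, PotBounds a b η V₁ V₂ m M₁ M₂ := by
  obtain ⟨m, hm, hmV⟩ := h.inf_pos
  obtain ⟨M, hM⟩ := h.sup_lt
  refine ⟨m, M, 2 * η * a * b / (a ^ 2 + b ^ 2) * M, ha, hb, hη₁, hm, h.cont₁, h.cont₂, h.bound,
    hmV, fun x => ?_, fun x => (h.bound x).trans ?_⟩
  · rw [abs_of_nonneg (hm.le.trans (hmV x))]
    exact hM x
  · exact mul_le_mul_of_nonneg_left (hM x) (by positivity)

section

variable {N : ℕ} {a b η : ℝ} {V₁ V₂ : Rn N → ℝ} {m M₁ M₂ : ℝ}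

/-- The form `∫ ∇u·∇v + V₁ u v`. -/
def PotBounds.formA (h : PotBounds a b η V₁ V₂ m M₁ M₂) : H1 N →L[ℝ] H1 N →L[ℝ] ℝ :=
  gradForm N + potForm h.cont₁ h.upper₁

theorem PotBounds.formA_comm (h : PotBounds a b η V₁ V₂ m M₁ M₂) (u v : H1 N) :
    h.formA u v = h.formA v u := by
  exact congrArg₂ (· + ·) (gradForm_comm u v) (potForm_comm h.cont₁ h.upper₁ u v)

/-- The form `∫ V₂ u v`. -/
def PotBounds.formB (h : PotBounds a b η V₁ V₂ m M₁ M₂) : H1 N →L[ℝ] H1 N →L[ℝ] ℝ :=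
  potForm h.cont₂ h.upper₂

theorem PotBounds.formB_apply (h : PotBounds a b η V₁ V₂ m M₁ M₂) (u v : H1 N) :
    h.formB u v = ∫ x, V₂ x * (val u x * val v x) := rfl

theorem PotBounds.coercive (h : PotBounds a b η V₁ V₂ m M₁ M₂) (u : H1 N) :
    coercivity a b η m * ‖u‖ ^ 2
      ≤ 2 * (a⁻¹ * b⁻¹) * h.formA u u - (a⁻¹ ^ 2 + b⁻¹ ^ 2) * |h.formB u u| := by
  exact coercivity_le h.a_pos h.b_pos h.η_lt (sq_nonneg _) (sq_nonneg _)
    (le_potForm h.cont₁ h.upper₁ h.lower u) (norm_sq_eq u)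
    (congrArg (· + potForm h.cont₁ h.upper₁ u u) (gradForm_self u))
    (abs_potForm_le h.cont₁ h.upper₁ h.cont₂ h.upper₂ h.bound u)

/-- The quadratic part of the energy as a bilinear form. -/
def PotBounds.form (h : PotBounds a b η V₁ V₂ m M₁ M₂) : ESpace N →L[ℝ] ESpace N →L[ℝ] ℝ :=
  pairForm (fstE N) (sndE N) h.formA h.formB

theorem PotBounds.form_comm (h : PotBounds a b η V₁ V₂ m M₁ M₂) (z y : ESpace N) :
    h.form z y = h.form y z :=
  pairForm_comm (fstE N) (sndE N) h.formA_comm (potForm_comm h.cont₂ h.upper₂) z y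

theorem fstE_pairL (α β : ℝ) (u : H1 N) : fstE N (pairL N α β u) = α • u := rfl

theorem sndE_pairL (α β : ℝ) (u : H1 N) : sndE N (pairL N α β u) = β • u := rfl

theorem PotBounds.form_pos (h : PotBounds a b η V₁ V₂ m M₁ M₂) (u : H1 N) :
    coercivity a b η m * ‖u‖ ^ 2 ≤ h.form (pairL N a⁻¹ b⁻¹ u) (pairL N a⁻¹ b⁻¹ u) :=
  pairForm_lower h.formA h.formB (fstE_pairL _ _ u) (sndE_pairL _ _ u) (h.coercive u)

theorem PotBounds.form_neg (h : PotBounds a b η V₁ V₂ m M₁ M₂) (u : H1 N) :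
    h.form (pairL N (-a⁻¹) b⁻¹ u) (pairL N (-a⁻¹) b⁻¹ u) ≤ -(coercivity a b η m * ‖u‖ ^ 2) :=
  pairForm_upper h.formA h.formB (fstE_pairL _ _ u) (sndE_pairL _ _ u) (h.coercive u)

/-- The components are `p = (au + bv)/2` and `w = (bv - au)/2`, so `E⁻` is where `au + bv = 0`. -/
theorem decomp_ESpace (ha : a ≠ 0) (hb : b ≠ 0) (z : ESpace N) :
    ∃ w, z = pairL N a⁻¹ b⁻¹ (projP N a b z) + pairL N (-a⁻¹) b⁻¹ w :=
  ⟨(b / 2) • z.snd - (a / 2) • z.fst,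
    ESpace_ext (split_fst ha z.fst z.snd) (split_snd hb z.fst z.snd)⟩

theorem projP_pairL_pos (ha : a ≠ 0) (hb : b ≠ 0) (p : H1 N) :
    projP N a b (pairL N a⁻¹ b⁻¹ p) = p := join_pos ha hb p

theorem projP_pairL_neg (ha : a ≠ 0) (hb : b ≠ 0) (p : H1 N) :
    projP N a b (pairL N (-a⁻¹) b⁻¹ p) = 0 := join_neg ha hb p

variable {W fu fv : Rn N → ℝ → ℝ → ℝ} {K : ℝ}

/-- The energy functional of the system as a strongly indefinite functional. -/
def energySaddle (hN : 3 ≤ N) (h : PotBounds a b η V₁ V₂ m M₁ M₂) (hW : IsNonlin W fu fv)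
    (hK : IsEmbConst N K) : Saddle (H1 N) (ESpace N) where
  B := h.form
  Ψ := Psi W
  dΨ := dPsi hW hK
  iP := pairL N a⁻¹ b⁻¹
  iM := pairL N (-a⁻¹) b⁻¹
  πP := projP N a b
  c := coercivity a b η m
  c_pos := coercivity_pos h.a_pos h.b_pos h.η_lt h.m_pos
  symm := h.form_comm
  decomp := decomp_ESpace h.a_pos.ne' h.b_pos.ne'
  πP_iP := projP_pairL_pos h.a_pos.ne' h.b_pos.ne'
  πP_iM := projP_pairL_neg h.a_pos.ne' h.b_pos.ne'
  pos := h.form_pos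
  neg := h.form_neg
  nonneg := Psi_nonneg hW
  zero := Psi_zero hW
  key := Psi_key hW hK
  unif := dPsi_uniform hW hK
  small := dPsi_small hW hK hN

theorem PotBounds.form_shiftE (h : PotBounds a b η V₁ V₂ m M₁ M₂) (hp₁ : Periodic1 V₁)
    (hp₂ : Periodic1 V₂) (k : Fin N → ℤ) (z : ESpace N) :
    h.form (shiftE (intVec k) z) (shiftE (intVec k) z) = h.form z z := by
  have hA : ∀ u v, h.formA (shift (intVec k) u) (shift (intVec k) v) = h.formA u v := fun u v =>
    congrArg₂ (· + ·) (gradForm_shift (intVec k) u v) (potForm_shift h.cont₁ h.upper₁ hp₁ k u v)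
  have hB : ∀ u v, h.formB (shift (intVec k) u) (shift (intVec k) v) = h.formB u v := fun u v =>
    potForm_shift h.cont₂ h.upper₂ hp₂ k u v
  exact pairForm_congr (fstE N) (sndE N) h.formA h.formB (hA z.fst z.snd) (hA z.snd z.fst)
    (hB z.fst z.fst) (hB z.snd z.snd)

theorem energySaddle_Φ_shiftE (hN : 3 ≤ N) (h : PotBounds a b η V₁ V₂ m M₁ M₂)
    (hW : IsNonlin W fu fv) (hK : IsEmbConst N K) (hp₁ : Periodic1 V₁) (hp₂ : Periodic1 V₂)
    (k : Fin N → ℤ) (z : ESpace N) : (energySaddle hN h hW hK).Φ (shiftE (intVec k) z)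
      = (energySaddle hN h hW hK).Φ z := by
  have h1 := h.form_shiftE hp₁ hp₂ k z
  have h2 := Psi_shiftE hW k z
  exact congrArg₂ (fun s t : ℝ => 1 / 2 * s - t) h1 h2

theorem shiftE_pairL_add (w : Rn N) (α β α' β' : ℝ) (p q : H1 N) :
    shiftE w (pairL N α β p + pairL N α' β' q)
      = pairL N α β (shift w p) + pairL N α' β' (shift w q) := by
  refine ESpace_ext ?_ ?_
  · exact (shift_add w (α • p) (α' • q)).trans
      (congrArg₂ (· + ·) (shift_smul w α p) (shift_smul w α' q))
  · exact (shift_add w (β • p) (β' • q)).trans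
      (congrArg₂ (· + ·) (shift_smul w β p) (shift_smul w β' q))

theorem energySaddle_J_shift (hN : 3 ≤ N) (h : PotBounds a b η V₁ V₂ m M₁ M₂)
    (hW : IsNonlin W fu fv) (hK : IsEmbConst N K) (hp₁ : Periodic1 V₁) (hp₂ : Periodic1 V₂)
    (k : Fin N → ℤ) (p : H1 N) : (energySaddle hN h hW hK).J (shift (intVec k) p)
      = (energySaddle hN h hW hK).J p :=
  (energySaddle hN h hW hK).J_symm (shift_surjective (intVec k))
    (fun p q => shiftE_pairL_add (intVec k) _ _ _ _ p q)
    (energySaddle_Φ_shiftE hN h hW hK hp₁ hp₂ k) p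

/-- In the nonvanishing case the translated directions are admissible because periodicity makes `J`
invariant under lattice shifts. -/
theorem energySaddle_isLions (hN : 3 ≤ N) (h : PotBounds a b η V₁ V₂ m M₁ M₂)
    (hW : IsNonlin W fu fv) (hK : IsEmbConst N K) (hp₁ : Periodic1 V₁) (hp₂ : Periodic1 V₂) :
    (energySaddle hN h hW hK).IsLions := by
  intro e he
  refine Or.imp ?_ ?_ (lions_alternative hN he)
  · exact Exists.imp fun φ H =>
      ⟨H.1, fun s => tendsto_Psi_pairL hW hK (fun n => he (φ n)) H.2 a⁻¹ b⁻¹ s⟩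
  · exact fun H => H.elim fun φ H => H.elim fun k H => H.elim fun e₀ H =>
      ⟨φ, H.1, _, e₀, H.2.1, fun n => (norm_shift _ _).trans (he _), H.2.2, fun n s =>
        (congrArg (energySaddle hN h hW hK).J (shift_smul (intVec (k n)) s (e (φ n))).symm).trans
          (energySaddle_J_shift hN h hW hK hp₁ hp₂ (k n) _)⟩

theorem val_smul_add_smul (α β : ℝ) (u v : H1 N) :
    val (α • u + β • v) =ᵐ[volume] fun x => α * val u x + β * val v x := by
  filter_upwards [val_add (α • u) (β • v), val_smul α u, val_smul β v] with x h1 h2 h3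
  exact h1.trans (congrArg₂ (· + ·) h2 h3)

theorem projP_eq_zero {z : ESpace N} (h : ∀ᵐ x, a * val z.fst x + b * val z.snd x = 0) :
    projP N a b z = 0 := by
  have h0 : ∀ᵐ x, val ((a / 2) • z.fst + (b / 2) • z.snd) x = 0 := by
    filter_upwards [h, val_smul_add_smul (a / 2) (b / 2) z.fst z.snd] with x hx h1
    refine h1.trans ?_
    linarith
  exact eq_zero_of_val_ae_eq h0

/-- Quadratic growth on a ray forces `au + bv = 0` almost everywhere, which is the vanishing of the
positive component. -/
theorem energySaddle_isSuper (hN : 3 ≤ N) (h : PotBounds a b η V₁ V₂ m M₁ M₂)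
    (hW : IsNonlin W fu fv) (hK : IsEmbConst N K) (hW2 : CondW2 a b W) :
    (energySaddle hN h hW hK).IsSuper := fun _ _ hC =>
  projP_eq_zero (ae_eq_zero_of_Psi_le hW hK hW2 hC)

theorem energySaddle_isWeakCont (hN : 3 ≤ N) (h : PotBounds a b η V₁ V₂ m M₁ M₂)
    (hW : IsNonlin W fu fv) (hK : IsEmbConst N K) :
    (energySaddle hN h hW hK).IsWeakCont := fun _ _ _ hM hz η =>
  tendsto_integral_fdot hW hK hM hz η

theorem energySaddle_isFatou (hN : 3 ≤ N) (h : PotBounds a b η V₁ V₂ m M₁ M₂)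
    (hW : IsNonlin W fu fv) (hK : IsEmbConst N K) :
    (energySaddle hN h hW hK).IsFatou := fun _ _ _ _ hM hz hc =>
  fatou_half_sub hW hK hM hz hc

end

end HamSys
end

/-! ### Translation back: the Nehari–Pankov set, weak solutions and the ground state. -/

noncomputable section

namespace HamSys

open scoped ENNReal NNReal

section

variable {N : ℕ} {a b η : ℝ} {V₁ V₂ : Rn N → ℝ} {m M₁ M₂ : ℝ} {W fu fv : Rn N → ℝ → ℝ → ℝ} {K : ℝ}

theorem integral_add_add_half {f₁ f₂ f₃ f₄ : Rn N → ℝ} (h₁ : Integrable f₁ volume)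
    (h₂ : Integrable f₂ volume) (h₃ : Integrable f₃ volume) (h₄ : Integrable f₄ volume) :
    ∫ x, (f₁ x + f₂ x + 1 / 2 * (f₃ x + f₄ x))
      = (∫ x, f₁ x) + (∫ x, f₂ x) + 1 / 2 * ((∫ x, f₃ x) + ∫ x, f₄ x) := by
  rw [← integral_add h₃ h₄, ← integral_const_mul, ← integral_add h₁ h₂]
  exact integral_add (h₁.add h₂) ((h₃.add h₄).const_mul (1 / 2))

theorem integral_add_add {f₁ f₂ f₃ : Rn N → ℝ} (h₁ : Integrable f₁ volume)
    (h₂ : Integrable f₂ volume) (h₃ : Integrable f₃ volume) :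
    ∫ x, (f₁ x + f₂ x + f₃ x) = (∫ x, f₁ x) + (∫ x, f₂ x) + ∫ x, f₃ x := by
  rw [← integral_add h₁ h₂]
  exact integral_add (h₁.add h₂) h₃

theorem integral_quadratic (h : PotBounds a b η V₁ V₂ m M₁ M₂) (u v : H1 N) :
    ∫ x, (inner ℝ (grad u x) (grad v x) + V₁ x * (val u x * val v x)
      + 1 / 2 * V₂ x * (val u x ^ 2 + val v x ^ 2))
      = (∫ x, inner ℝ (grad u x) (grad v x)) + (∫ x, V₁ x * (val u x * val v x))
        + 1 / 2 * ((∫ x, V₂ x * (val u x * val u x)) + ∫ x, V₂ x * (val v x * val v x)) := by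
  refine Eq.trans ?_ (integral_add_add_half (integrable_inner_grad u v)
    (integrable_mul_val h.cont₁ h.upper₁ u v) (integrable_mul_val h.cont₂ h.upper₂ u u)
    (integrable_mul_val h.cont₂ h.upper₂ v v))
  refine integral_congr_ae (Eventually.of_forall fun x => ?_)
  change inner ℝ (grad u x) (grad v x) + V₁ x * (val u x * val v x)
    + 1 / 2 * V₂ x * (val u x ^ 2 + val v x ^ 2)
    = inner ℝ (grad u x) (grad v x) + V₁ x * (val u x * val v x)
    + 1 / 2 * (V₂ x * (val u x * val u x) + V₂ x * (val v x * val v x))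
  generalize inner ℝ (grad u x) (grad v x) = s
  ring

theorem PotBounds.formA_eq_integral (h : PotBounds a b η V₁ V₂ m M₁ M₂) (u v : H1 N) :
    h.formA u v = (∫ x, inner ℝ (grad u x) (grad v x)) + ∫ x, V₁ x * (val u x * val v x) :=
  congrArg (· + ∫ x, V₁ x * (val u x * val v x)) (gradForm_apply u v)

theorem half_form_eq {α β γ δ P Q R T : ℝ} (h₁ : P = α + β) (h₂ : Q = P) (h₃ : R = γ)
    (h₄ : T = δ) : 1 / 2 * (P + Q + (R + T)) = α + β + 1 / 2 * (γ + δ) := by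
  subst h₂ h₃ h₄ h₁
  ring

/-- The energy functional is the abstract functional. -/
theorem Phi_eq (hN : 3 ≤ N) (h : PotBounds a b η V₁ V₂ m M₁ M₂)
    (hW : IsNonlin W fu fv) (hK : IsEmbConst N K) :
    Phi V₁ V₂ W = (energySaddle hN h hW hK).Φ := by
  funext z
  have h1 := integral_quadratic h z.fst z.snd
  have h2 := half_form_eq (h.formA_eq_integral z.fst z.snd) (h.formA_comm z.snd z.fst)
    (h.formB_apply z.fst z.fst) (h.formB_apply z.snd z.snd)
  exact congrArg (· - Psi W z) (h1.trans h2.symm)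

theorem mem_EMinus_iff_exists (z : ESpace N) :
    z ∈ EMinus N a b ↔ ∃ w, z = pairL N (-a⁻¹) b⁻¹ w := by
  refine exists_congr fun w => ⟨fun H => ESpace_ext (H.1.trans (neg_smul a⁻¹ w).symm) H.2, ?_⟩
  rintro rfl
  exact ⟨neg_smul a⁻¹ w, rfl⟩

theorem map_add_of_eq_zero {X E : Type*} [NormedAddCommGroup X] [NormedSpace ℝ X]
    [NormedAddCommGroup E] [NormedSpace ℝ E] (T : X →L[ℝ] E) {p : X} (hp : p = 0) (y : E) :
    T p + y = y := by
  rw [hp, map_zero, zero_add]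

theorem mem_EMinus_iff (ha : a ≠ 0) (hb : b ≠ 0) (z : ESpace N) :
    z ∈ EMinus N a b ↔ projP N a b z = 0 := by
  rw [mem_EMinus_iff_exists]
  constructor
  · rintro ⟨w, rfl⟩
    exact projP_pairL_neg ha hb w
  · exact fun h => (decomp_ESpace ha hb z).imp fun w hw =>
      hw.trans (map_add_of_eq_zero (pairL N a⁻¹ b⁻¹) h _)

/-- The derivative is existentially quantified in `NMinus`; uniqueness of the Fréchet derivative
identifies it with `dΦ`. -/
theorem mem_NMinus_iff (hN : 3 ≤ N) (h : PotBounds a b η V₁ V₂ m M₁ M₂)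
    (hW : IsNonlin W fu fv) (hK : IsEmbConst N K) (z : ESpace N) :
    z ∈ NMinus a b V₁ V₂ W ↔ projP N a b z ≠ 0 ∧ (energySaddle hN h hW hK).dΦ z z = 0 ∧
      ∀ w, (energySaddle hN h hW hK).dΦ z (pairL N (-a⁻¹) b⁻¹ w) = 0 := by
  have hd := (energySaddle hN h hW hK).hasFDerivAt_Φ z
  rw [← Phi_eq hN h hW hK] at hd
  have hE : z ∉ EMinus N a b ↔ projP N a b z ≠ 0 :=
    not_congr (mem_EMinus_iff h.a_pos.ne' h.b_pos.ne' z)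
  refine and_congr hE ⟨fun H => ?_, fun H => ⟨_, hd, H.1, fun ζ hζ => ?_⟩⟩
  · refine H.elim fun D HD => ?_
    have e := HD.1.unique hd
    rw [e] at HD
    exact ⟨HD.2.1, fun w => HD.2.2 _ ((mem_EMinus_iff_exists _).2 ⟨w, rfl⟩)⟩
  · refine ((mem_EMinus_iff_exists ζ).1 hζ).elim fun w hw => ?_
    rw [hw]
    exact H.2 w

theorem inner_gradC (ξ : Rn N) (φ : Rn N → ℝ) (x : Rn N) :
    inner ℝ ξ (gradC φ x) = ∑ i, ξ i * partialD i φ x := by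
  rw [PiLp.inner_apply]
  refine Finset.sum_congr rfl fun i _ => ?_
  simp [gradC, mul_comm]

/-- The weak form of the linear part, tested with a smooth function. -/
theorem form_test_eq (h : PotBounds a b η V₁ V₂ m M₁ M₂) (u v : H1 N) {φ : Rn N → ℝ}
    (hφ : IsTest φ) : h.formA u hφ.toH1 + h.formB v hφ.toH1
      = ∫ x, ((∑ i, grad u x i * partialD i φ x) + (V₁ x * val u x + V₂ x * val v x) * φ x) := by
  refine (congrArg (· + h.formB v hφ.toH1) (h.formA_eq_integral u hφ.toH1)).trans ?_
  refine (integral_add_add (integrable_inner_grad u hφ.toH1)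
    (integrable_mul_val h.cont₁ h.upper₁ u hφ.toH1)
    (integrable_mul_val h.cont₂ h.upper₂ v hφ.toH1)).symm.trans ?_
  refine integral_congr_ae ?_
  filter_upwards [hφ.val_toH1, hφ.grad_toH1] with x h1 h2
  rw [h1, h2, inner_gradC]
  generalize ∑ i, grad u x i * partialD i φ x = s
  ring

theorem PotBounds.form_inr (h : PotBounds a b η V₁ V₂ m M₁ M₂) (z : ESpace N) (w : H1 N) :
    h.form z (WithLp.toLp 2 (0, w)) = h.formA z.fst w + h.formB z.snd w :=
  pairForm_of_zero_fst (f := fstE N) (s := sndE N) h.formA h.formB z rfl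

theorem PotBounds.form_inl (h : PotBounds a b η V₁ V₂ m M₁ M₂) (z : ESpace N) (w : H1 N) :
    h.form z (WithLp.toLp 2 (w, 0)) = h.formA z.snd w + h.formB z.fst w :=
  pairForm_of_zero_snd (f := fstE N) (s := sndE N) h.formA h.formB z rfl

theorem integral_fdot_inr (fu fv : Rn N → ℝ → ℝ → ℝ) (z : ESpace N) {φ : Rn N → ℝ}
    (hφ : IsTest φ) : ∫ x, fdot fu fv z (WithLp.toLp 2 (0, hφ.toH1)) x
      = ∫ x, fv x (val z.fst x) (val z.snd x) * φ x := by
  refine integral_congr_ae ?_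
  filter_upwards [hφ.val_toH1, val_zero (N := N)] with x h1 h2
  change fu x (val z.fst x) (val z.snd x) * val (0 : H1 N) x
    + fv x (val z.fst x) (val z.snd x) * val hφ.toH1 x = _
  rw [h1, h2, mul_zero, zero_add]

theorem integral_fdot_inl (fu fv : Rn N → ℝ → ℝ → ℝ) (z : ESpace N) {φ : Rn N → ℝ}
    (hφ : IsTest φ) : ∫ x, fdot fu fv z (WithLp.toLp 2 (hφ.toH1, 0)) x
      = ∫ x, fu x (val z.fst x) (val z.snd x) * φ x := by
  refine integral_congr_ae ?_
  filter_upwards [hφ.val_toH1, val_zero (N := N)] with x h1 h2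
  change fu x (val z.fst x) (val z.snd x) * val hφ.toH1 x
    + fv x (val z.fst x) (val z.snd x) * val (0 : H1 N) x = _
  rw [h1, h2, mul_zero, add_zero]

/-- Critical points of the energy are weak solutions. -/
theorem isSolution_of_critical (h : PotBounds a b η V₁ V₂ m M₁ M₂)
    (hW : IsNonlin W fu fv) (hK : IsEmbConst N K) {z : ESpace N}
    (hz : ∀ y, h.form z y = ∫ x, fdot fu fv z y x) : IsSolution V₁ V₂ W z := by
  have eu : Wu W = fu := by funext x u v; exact hW.Wu_eq x u v
  have ev : Wv W = fv := by funext x u v; exact hW.Wv_eq x u v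
  refine hW.growth.elim fun C HC => ?_
  refine ⟨?_, ?_, fun φ hφ => ?_, fun φ hφ => ?_⟩
  · rw [ev]
    exact locallyIntegrable_of_growth hK hW.cont_fv (fun x u v =>
      le_trans (le_add_of_nonneg_left (abs_nonneg _)) (HC.2 x u v)) z
  · rw [eu]
    exact locallyIntegrable_of_growth hK hW.cont_fu (fun x u v =>
      le_trans (le_add_of_nonneg_right (abs_nonneg _)) (HC.2 x u v)) z
  · rw [ev]
    exact (form_test_eq h z.fst z.snd hφ).symm.trans ((h.form_inr z hφ.toH1).symm.trans
      ((hz _).trans (integral_fdot_inr fu fv z hφ)))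
  · rw [eu]
    exact (form_test_eq h z.snd z.fst hφ).symm.trans ((h.form_inl z hφ.toH1).symm.trans
      ((hz _).trans (integral_fdot_inl fu fv z hφ)))

/-- Existence of a ground state for nonlinearities satisfying the pointwise hypotheses. -/
theorem exists_ground_state_solution (hN : 3 ≤ N) (h : PotBounds a b η V₁ V₂ m M₁ M₂)
    (hp₁ : Periodic1 V₁) (hp₂ : Periodic1 V₂) (hW : IsNonlin W fu fv) (hW2 : CondW2 a b W) :
    ∃ z : ESpace N, IsSolution V₁ V₂ W z ∧ z ∈ NMinus a b V₁ V₂ W ∧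
      IsGLB (Phi V₁ V₂ W '' NMinus a b V₁ V₂ W) (Phi V₁ V₂ W z) ∧ 0 < Phi V₁ V₂ W z := by
  have hsep := separableSpace_H1 N
  have hnt := nontrivial_H1 N
  refine (exists_isEmbConst hN).elim fun K hK => ?_
  refine ((energySaddle hN h hW hK).exists_ground_state (energySaddle_isSuper hN h hW hK hW2)
    (energySaddle_isLions hN h hW hK hp₁ hp₂) (energySaddle_isWeakCont hN h hW hK)
    (energySaddle_isFatou hN h hW hK)).elim fun z hz => ?_
  have hd0 : ∀ y, (energySaddle hN h hW hK).dΦ z y = 0 := fun y => by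
    rw [hz.1]; rfl
  have hmem : z ∈ NMinus a b V₁ V₂ W :=
    (mem_NMinus_iff hN h hW hK z).2 ⟨hz.2.1, hd0 z, fun w => hd0 _⟩
  refine ⟨z, isSolution_of_critical h hW hK fun y => sub_eq_zero.1 (hd0 y), hmem, ?_, ?_⟩
  · rw [Phi_eq hN h hW hK]
    -- The infimum is attained at `z`, since a critical point off `E⁻` belongs to the Nehari–Pankov
    -- set.
    refine IsLeast.isGLB ⟨⟨z, hmem, rfl⟩, ?_⟩
    rintro _ ⟨y, hy, rfl⟩
    have hy' := (mem_NMinus_iff hN h hW hK y).1 hy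
    exact hz.2.2.2 y hy'.1 hy'.2.1 hy'.2.2
  · rw [Phi_eq hN h hW hK]
    exact hz.2.2.1

end

end HamSys
end

theorem corollary1p9 (N : ℕ) (hN : 3 ≤ N)
    (a b η : ℝ) (ha : 0 < a) (hb : 0 < b) (hη₀ : 0 < η) (hη₁ : η < 1)
    (V₁ V₂ : HamSys.Rn N → ℝ)
    (hV0 : HamSys.CondV0 a b η V₁ V₂)
    (hV1 : HamSys.Periodic1 V₁ ∧ HamSys.Periodic1 V₂)
    (k l : ℕ) (α β : Fin k → ℝ) (α' β' : Fin l → ℝ)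
    (g : Fin k → HamSys.Rn N → ℝ → ℝ) (h : Fin l → HamSys.Rn N → ℝ → ℝ)
    (hαβ : ∀ i, α i ^ 2 + β i ^ 2 ≠ 0) (hαβ' : ∀ j, β' j ^ 2 < α' j)
    (hg : ∀ i, HamSys.ClassND (g i)) (hh : ∀ j, HamSys.ClassND (h j))
    (W : HamSys.Rn N → ℝ → ℝ → ℝ)
    (hW : ∀ x u v, W x u v =
      (∑ i, ∫ s in (0 : ℝ)..|α i * u + β i * v|, g i x s * s)
        + ∑ j, ∫ s in (0 : ℝ)..√(u ^ 2 + 2 * β' j * u * v + α' j * v ^ 2), h j x s * s)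
    (hW2 : HamSys.CondW2 a b W) :
    ∃ z : HamSys.ESpace N,
      HamSys.IsSolution V₁ V₂ W z ∧
      z ∈ HamSys.NMinus a b V₁ V₂ W ∧
      IsGLB (HamSys.Phi V₁ V₂ W '' HamSys.NMinus a b V₁ V₂ W) (HamSys.Phi V₁ V₂ W z) ∧
      0 < HamSys.Phi V₁ V₂ W z := by
  obtain ⟨fu, fv, hWf⟩ := HamSys.exists_isNonlin hN α β α' β' hαβ' hg hh hW
  obtain ⟨m, M₁, M₂, hV⟩ := hV0.exists_potBounds ha hb hη₀ hη₁
  exact HamSys.exists_ground_state_solution hN hV hV1.1 hV1.2 hWf hW2
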